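/- Let $d\ge 1$ and let $f$ be a probability density on $[0,1]^d$ that is bounded away from zero and infinity. There is a constant $C_f>0$, depending only on $f$ and $d$ (with $C_f = 2^{d+1}/(d-1)!$ when $f$ is uniform), such that the following holds. For each $s$ let $Z_i=(X_i,Y_i)$, $i=1,\dots,s$, be i.i.d., where $X_i\in[0,1]^d$ has density $f$ and the conditional law of $Y$ given $X$ does not depend on $s$. Assume that $u\mapsto E[Y\mid X=u]$ and $u\mapsto E[Y^2\mid X=u]$ are finite and Lipschitz continuous on $[0,1]^d$, that $E[Y^2\mid X=u]$ is uniformly bounded, and that $\operatorname{Var}(Y\mid X=x)>0$ at the test point $x\in[0,1]^d$. For each $s\ge1$ let a (possibly randomized) tree with axis-aligned splits be grown on $Z_1,\dots,Z_s$. Assume that the trees are regular: there are $\pi,\gamma>0$, not depending on $s$, such that (A) whatever splits led to a node, if the node is split then it is split on variable $j$ with probability at least $\pi$, for every $j=1,\dots,d$; (B) each split leaves at least a fraction $\gamma$ of the available examples in the node on each side, where the available examples are either all $s$ examples or the prediction points of (C); (C) there is a set $\mathcal P$ of at least $s/2$ prediction points, set aside independently of the data, such that almost surely every test point $p\in[0,1]^d$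 shares its leaf with $X_i$ for exactly one $i=i^*(p)\in\mathcal P$; the prediction is $T(p)=Y_{i^*(p)}$. Assume also that the trees are honest at $x$: a label $Y_i$ is not used both to determine that $i$ is selected and as the prediction. That is, for each $i$, conditionally on $X_i$ and with the other examples given, the distribution of $Y_i$ does not depend on knowing whether $i=i^*(x)$: $$\mathcal L\big(Y_i \mid X_i,\ (Z_j)_{j\ne i},\ i^*(x)=i\big)=\mathcal L\big(Y_i\mid X_i\big).$$ Then $T=T(x)$ is $\alpha(s)$-incremental at $x$ with $\alpha(s)=C_f/\log(s)^d$: for the Hájek projection $\mathring T=E[T]+\sum_{i=1}^s\big(E[T\mid Z_i]-E[T]\big)$, $$\liminf_{s\to\infty}\ \frac{\operatorname{Var}(\mathring T)/\operatorname{Var}(T)}{C_f/\log(s)^d}\ \ge\ 1 .$$ -/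

import Mathlib

open MeasureTheory ProbabilityTheory Filter
open scoped ENNReal Topology

/-! ### The data -/

/-- The feature space `[0, 1] ^ d`. -/
def unitCube (d : ℕ) : Set (Fin d → ℝ) := Set.Icc 0 1

/-- `f` is a probability density on `[0, 1] ^ d`, bounded away from zero and infinity. -/
structure IsBoundedDensity {d : ℕ} (f : (Fin d → ℝ) → ℝ) : Prop where
  measurable : Measurable f
  bounds : ∃ a > 0, ∃ b, ∀ u ∈ unitCube d, a ≤ f u ∧ f u ≤ b
  lintegral_eq_one : ∫⁻ u in unitCube d, ENNReal.ofReal (f u) = 1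

/-- The law on `[0, 1] ^ d` with density `f`. -/
noncomputable def featureLaw {d : ℕ} (f : (Fin d → ℝ) → ℝ) : Measure (Fin d → ℝ) :=
  (volume.restrict (unitCube d)).withDensity (fun u => ENNReal.ofReal (f u))

/-- `κ u` is the conditional law of `Y` given `X = u`. Its first two moments are finite and
Lipschitz on `[0, 1] ^ d`, and the second one is bounded there. -/
structure HasLipschitzMoments {d : ℕ} (κ : Kernel (Fin d → ℝ) ℝ) : Prop where
  integrable_sq : ∀ u ∈ unitCube d, Integrable (fun y : ℝ => y ^ 2) (κ u)
  lipschitz_one : ∃ K, LipschitzOnWith K (fun u => ∫ y, y ∂(κ u)) (unitCube d)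
  lipschitz_two : ∃ K, LipschitzOnWith K (fun u => ∫ y, y ^ 2 ∂(κ u)) (unitCube d)
  bounded_two : ∃ M, ∀ u ∈ unitCube d, ∫ y, y ^ 2 ∂(κ u) ≤ M

/-- `(X i, Y i)`, `i < s`, are independent, the `X i` have density `f` on `[0, 1] ^ d`, and the
conditional law of `Y i` given `X i` is `κ`. -/
structure IsSample {Ω : Type*} [MeasurableSpace Ω] (μ : Measure Ω) {d s : ℕ}
    (f : (Fin d → ℝ) → ℝ) (κ : Kernel (Fin d → ℝ) ℝ)
    (X : Fin s → Ω → (Fin d → ℝ)) (Y : Fin s → Ω → ℝ) : Prop where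
  measurable_X : ∀ i, Measurable (X i)
  measurable_Y : ∀ i, Measurable (Y i)
  law : ∀ i, μ.map (fun ω => (X i ω, Y i ω)) = featureLaw f ⊗ₘ κ
  indep : iIndepFun (fun i ω => (X i ω, Y i ω)) μ

/-! ### Trees grown by recursive axis-aligned partitioning -/

/-- A finite binary tree of axis-aligned splits: `node j t l r` sends the points `p` with
`p j ≤ t` to `l` and the other points to `r`. -/
inductive SplitTree (d : ℕ) : Type
  | leaf : SplitTree d
  | node (j : Fin d) (t : ℝ) (l r : SplitTree d) : SplitTree d

namespace SplitTree

/-- The address (`true` for left, `false` for right) of the leaf that contains the point `p`. -/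
noncomputable def leafOf {d : ℕ} : SplitTree d → (Fin d → ℝ) → List Bool
  | leaf, _ => []
  | node j t l r, p => if p j ≤ t then true :: l.leafOf p else false :: r.leafOf p

/-- The subtree at an address (a leaf if the address is not in the tree). -/
def subtree {d : ℕ} : SplitTree d → List Bool → SplitTree d
  | τ, [] => τ
  | leaf, _ :: _ => leaf
  | node _ _ l r, b :: v => if b then l.subtree v else r.subtree v

/-- The variable on which a tree splits its root, `none` for a leaf. -/
def rootVar {d : ℕ} : SplitTree d → Option (Fin d)
  | leaf => none
  | node j _ _ _ => some j

/-- The position at which a tree splits its root (`0` for a leaf). -/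
def rootPos {d : ℕ} : SplitTree d → ℝ
  | leaf => 0
  | node _ t _ _ => t

/-- The variable on which the node at address `v` is split, `none` if there is no such split. -/
def splitVar {d : ℕ} (τ : SplitTree d) (v : List Bool) : Option (Fin d) := (τ.subtree v).rootVar

/-- The position of the split at address `v` (`0` if there is no such split). -/
def splitPos {d : ℕ} (τ : SplitTree d) (v : List Bool) : ℝ := (τ.subtree v).rootPos

end SplitTree

/-- The information in the split (variable and position) that the random tree `τ` makes at
address `v`. -/
abbrev splitSigma {Ω : Type*} {d : ℕ} (τ : Ω → SplitTree d) (v : List Bool) : MeasurableSpace Ω :=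
  MeasurableSpace.comap (fun ω => (τ ω).splitVar v) ⊤ ⊔
    MeasurableSpace.comap (fun ω => (τ ω).splitPos v) inferInstance

/-- The information in the splits at all proper ancestors of the node at address `v`. -/
abbrev ancestorSigma {Ω : Type*} {d : ℕ} (τ : Ω → SplitTree d) (v : List Bool) :
    MeasurableSpace Ω :=
  ⨆ u ∈ {u : List Bool | u <+: v ∧ u ≠ v}, splitSigma τ u

/-- The number of indices `i ∈ Q` for which the point `p i` lies in the node at address `v`. -/
noncomputable def nodeCount {d s : ℕ} (τ : SplitTree d) (p : Fin s → (Fin d → ℝ))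
    (Q : Finset (Fin s)) (v : List Bool) : ℕ :=
  {i : Fin s | i ∈ Q ∧ v <+: τ.leafOf (p i)}.ncard

/-- Every split of `τ` leaves at least a fraction `γ` of the points `p i`, `i ∈ Q`, of the node
that is split on each of the two sides. -/
def IsBalanced {d s : ℕ} (τ : SplitTree d) (p : Fin s → (Fin d → ℝ))
    (Q : Finset (Fin s)) (γ : ℝ) : Prop :=
  ∀ v : List Bool, τ.splitVar v ≠ none →
    ∀ b : Bool, γ * (nodeCount τ p Q v : ℝ) ≤ (nodeCount τ p Q (v ++ [b]) : ℝ)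

/-- The random tree `τ` with prediction points `P`, grown on the sample `(X i, Y i)`, `i < s`, is
regular with constants `π` and `γ`. The tree is any random variable on the probability space of the
sample, so that it may depend both on the sample and on the randomization of the algorithm. -/
structure IsRegularTree {Ω : Type*} [MeasurableSpace Ω] (μ : Measure Ω) {d s : ℕ}
    (X : Fin s → Ω → (Fin d → ℝ)) (Y : Fin s → Ω → ℝ)
    (τ : Ω → SplitTree d) (P : Ω → Finset (Fin s)) (π γ : ℝ) : Prop where
  measurable_tree : ∀ v, splitSigma τ v ≤ ‹MeasurableSpace Ω›
  measurable_pred : ∀ Q, MeasurableSet {ω | P ω = Q}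
  /-- Whatever the splits that led to a node, if the node is split then it is split on variable `j`
  with probability at least `π`. (A bound that holds given the sample as well implies this one.) -/
  split_prob : ∀ (v : List Bool) (j : Fin d) (E : Set Ω), MeasurableSet[ancestorSigma τ v] E →
    π * μ.real (E ∩ {ω | (τ ω).splitVar v ≠ none}) ≤ μ.real (E ∩ {ω | (τ ω).splitVar v = some j})
  /-- Each split leaves at least a fraction `γ` of the available examples on each side. Available
  are either all examples the tree is grown on, or the prediction points. -/
  balanced : (∀ᵐ ω ∂μ, IsBalanced (τ ω) (fun i => X i ω) Finset.univ γ) ∨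
    (∀ᵐ ω ∂μ, IsBalanced (τ ω) (fun i => X i ω) (P ω) γ)
  /-- The prediction points are set aside without looking at the sample. -/
  pred_indep : Indep (MeasurableSpace.comap P ⊤)
    (MeasurableSpace.comap (fun ω i => (X i ω, Y i ω)) inferInstance) μ
  /-- They are at least half of the examples. -/
  pred_card : ∀ᵐ ω ∂μ, (s : ℝ) / 2 ≤ ((P ω).card : ℝ)
  /-- Each test point shares its leaf with exactly one prediction point. -/
  fully_grown : ∀ᵐ ω ∂μ, ∀ p ∈ unitCube d,
    ∃! i, i ∈ P ω ∧ (τ ω).leafOf (X i ω) = (τ ω).leafOf p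

/-- The event that `i` is the index selected at the test point `x`: the prediction point in the same
leaf as `x`. -/
def selected {Ω : Type*} {d s : ℕ} (X : Fin s → Ω → (Fin d → ℝ))
    (τ : Ω → SplitTree d) (P : Ω → Finset (Fin s)) (x : Fin d → ℝ) (i : Fin s) : Set Ω :=
  {ω | i ∈ P ω ∧ (τ ω).leafOf (X i ω) = (τ ω).leafOf x}

/-- The prediction at `x`: the label of the selected index. -/
noncomputable def treePrediction {Ω : Type*} {d s : ℕ} (X : Fin s → Ω → (Fin d → ℝ))
    (Y : Fin s → Ω → ℝ) (τ : Ω → SplitTree d) (P : Ω → Finset (Fin s)) (x : Fin d → ℝ) :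
    Ω → ℝ :=
  fun ω => ∑ i, (selected X τ P x i).indicator (Y i) ω

/-- The information in `X i` and in all examples other than the `i`-th. -/
abbrev othersSigma {Ω : Type*} {d s : ℕ} (X : Fin s → Ω → (Fin d → ℝ)) (Y : Fin s → Ω → ℝ)
    (i : Fin s) : MeasurableSpace Ω :=
  MeasurableSpace.comap (X i) inferInstance ⊔
    ⨆ j ∈ {j : Fin s | j ≠ i}, MeasurableSpace.comap (fun ω => (X j ω, Y j ω)) inferInstance

/-- Honesty at the test point `x`: no label `Y i` is used both to determine that `i` is selected and
as the prediction. That is, with the other examples given, knowing that `i` is selected does not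
change the conditional law `κ (X i)` of `Y i` given `X i`. -/
def IsHonestAt {Ω : Type*} [MeasurableSpace Ω] (μ : Measure Ω) {d s : ℕ}
    (κ : Kernel (Fin d → ℝ) ℝ) (X : Fin s → Ω → (Fin d → ℝ)) (Y : Fin s → Ω → ℝ)
    (τ : Ω → SplitTree d) (P : Ω → Finset (Fin s)) (x : Fin d → ℝ) : Prop :=
  ∀ (i : Fin s) (E : Set Ω), MeasurableSet[othersSigma X Y i] E →
    ∀ B : Set ℝ, MeasurableSet B →
      μ (Y i ⁻¹' B ∩ (selected X τ P x i ∩ E)) =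
        ∫⁻ ω in selected X τ P x i ∩ E, κ (X i ω) B ∂μ

/-! ### Incrementality -/

/-- The Hájek projection of `T` on the examples `Z i`. -/
noncomputable def hajekProjection {Ω 𝓩 : Type*} [MeasurableSpace Ω] [MeasurableSpace 𝓩]
    (μ : Measure Ω) {s : ℕ} (Z : Fin s → Ω → 𝓩) (T : Ω → ℝ) : Ω → ℝ :=
  fun ω => μ[T] + ∑ i, ((μ[T | MeasurableSpace.comap (Z i) inferInstance]) ω - μ[T])

/-- `f(s) ≳ g(s)`: the lower limit of `f(s) / g(s)` as `s → ∞`, which may be infinite, is at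
least `1`. -/
def AsympGE (f g : ℕ → ℝ) : Prop :=
  (1 : EReal) ≤ liminf (fun s => ((f s / g s : ℝ) : EReal)) atTop

/-- The predictors `T s`, trained on the examples `Z s i`, `i < s`, are `α(s)`-incremental. -/
def IsIncremental {Ω : ℕ → Type*} {𝓩 : Type*} [∀ s, MeasurableSpace (Ω s)] [MeasurableSpace 𝓩]
    (μ : ∀ s, Measure (Ω s)) (Z : ∀ s, Fin s → Ω s → 𝓩) (T : ∀ s, Ω s → ℝ) (α : ℕ → ℝ) : Prop :=
  AsympGE (fun s => variance (hajekProjection (μ s) (Z s) (T s)) (μ s) / variance (T s) (μ s)) α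

/-! ### Addresses, splits and nodes -/

namespace SplitTree

variable {d : ℕ}

/-! The variance of the Hájek projection is bounded below by testing. The projection and `T` have
the same covariance with every centered sum `H = ∑ h (Z i)`, so Cauchy–Schwarz gives
`Var(projection) ≥ Cov(T, H)² / Var(H)` (`sq_integral_mul_le_variance_hajekProjection`). The test
function is `H = ∑ 1_A(X i) (Y i - E[Y | X i])`, where `A` is the set of points that span with `x` a
box of volume at most a constant times `log log s / s`.

Denominator: the volume of `A` is of order at most `(log log s / s) (log s)^(d-1)`
(`volume_real_spannedVolume_le`), so that `Var(H)` is at most of order `log log s · (log s)^(d-1)`.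
The variance of `T` is bounded (`variance_treePrediction_le`).

Covariance: write the selected label as `(Y - E[Y | X]) + (E[Y | X] - E[Y | x]) + E[Y | x]`. By
honesty the first part contributes the conditional variance at the selected point, on the event that
this point lies in `A` (`setIntegral_sub_condMean_mul`). The second is a bias, controlled by
Lipschitz continuity and the distance from `x` to the selected point; the third vanishes because `H`
is centered (`le_integral_treePrediction_mul`). Two facts make the covariance at least `Var(Y | x) /
2` for large `s`.

Selection falls in `A` with probability tending to one: the box spanned by `x` and the selected
point lies in one leaf, hence contains no other prediction point, and this is exponentially unlikely
when its volume is large (`measure_selected_inter_le`, `one_sub_div_log_le_sum_measureReal`).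

The selected point approaches `x` at a polynomial rate. Outside an event of polynomially small
probability, counts in all boxes are near their means (`measure_boxDeviation_le`); the path to `x`
then has at least `n` nodes for `n` of order `log s`, and each split on a variable shrinks that side
by a fixed factor (`exists_box_of_isBalanced`). The number of splits on each variable dominates a
binomial one (`lintegral_pathWeight_le`). This beats every power of `log s` in the bias term
(`tendsto_rate_mul_log_pow`).

The resulting ratio is at least a constant over `log log s · (log s)^(d-1)`, which eventually
exceeds `C / (log s)^d` for every `C`. The value of the constant therefore plays no role in the
argument. -/

theorem append_singleton_prefix_leafOf (τ : SplitTree d) (v : List Bool) (b : Bool)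
    (p : Fin d → ℝ) :
    v ++ [b] <+: τ.leafOf p ↔
      v <+: τ.leafOf p ∧ ∃ j, τ.splitVar v = some j ∧ (b = true ↔ p j ≤ τ.splitPos v) := by
  induction τ generalizing v with
  | leaf => cases v <;> simp [leafOf, splitVar, subtree, rootVar]
  | node j t l r ihl ihr =>
    cases v with
    | nil =>
      by_cases h : p j ≤ t <;> cases b <;>
        simp [leafOf, splitVar, splitPos, subtree, rootVar, rootPos, h] <;> exact not_le.1 h
    | cons c v =>
      by_cases h : p j ≤ t <;> cases c <;>
        simp [leafOf, h, splitVar, splitPos, subtree] at ihl ihr ⊢ <;>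
        first | exact ihl v | exact ihr v

/-- An address stops exactly where the node is not split. This expresses leaves through node
membership and splits, the only data about the random tree that are assumed measurable. -/
theorem leafOf_eq_iff (τ : SplitTree d) (v : List Bool) (p : Fin d → ℝ) :
    τ.leafOf p = v ↔ v <+: τ.leafOf p ∧ τ.splitVar v = none := by
  induction τ generalizing v with
  | leaf => cases v <;> simp [leafOf, splitVar, subtree, rootVar]
  | node j t l r ihl ihr =>
    cases v with
    | nil => by_cases h : p j ≤ t <;> simp [leafOf, splitVar, subtree, rootVar, h]
    | cons c v =>
      by_cases h : p j ≤ t <;> cases c <;>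
        simp [leafOf, h, splitVar, subtree] at ihl ihr ⊢ <;>
        first | exact ihl v | exact ihr v

/-- The number of splits on variable `j` at the proper ancestors of the node at address `v`. -/
def splitCount (τ : SplitTree d) (j : Fin d) (v : List Bool) : ℕ :=
  ∑ k ∈ Finset.range v.length, if τ.splitVar (v.take k) = some j then 1 else 0

theorem splitCount_nil (τ : SplitTree d) (j : Fin d) : τ.splitCount j [] = 0 := by
  simp [splitCount]

theorem splitCount_append_singleton (τ : SplitTree d) (j : Fin d) (v : List Bool) (b : Bool) :
    τ.splitCount j (v ++ [b]) =
      τ.splitCount j v + if τ.splitVar v = some j then 1 else 0 := by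
  unfold splitCount
  rw [List.length_append, List.length_singleton, Finset.sum_range_succ]
  congr 1
  · refine Finset.sum_congr rfl fun k hk => ?_
    rw [List.take_append_of_le_length (Finset.mem_range.1 hk).le]
  · simp

/-- If a node consists of the points of a half-open box, then so do the two parts of its split. -/
theorem exists_box_split {τ : SplitTree d} {v : List Bool} {S : Set (Fin d → ℝ)}
    {lo hi : Fin d → ℝ} (h : ∀ p ∈ S, v <+: τ.leafOf p ↔ ∀ k, p k ∈ Set.Ioc (lo k) (hi k))
    {j : Fin d} (hj : τ.splitVar v = some j) (b : Bool) :
    ∃ lo' hi' : Fin d → ℝ,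
      (∀ p ∈ S, v ++ [b] <+: τ.leafOf p ↔ ∀ k, p k ∈ Set.Ioc (lo' k) (hi' k)) ∧
      (∀ k, k ≠ j → lo' k = lo k ∧ hi' k = hi k) ∧
      Set.Ioc (lo' j) (hi' j) = Set.Ioc (lo j) (hi j) ∩
        if b then Set.Iic (τ.splitPos v) else Set.Ioi (τ.splitPos v) := by
  classical
  -- Only side `j` changes. Ties `p j = t` go left, so boxes open below and closed above are stable
  -- under both kinds of child.
  refine ⟨if b then lo else Function.update lo j (max (lo j) (τ.splitPos v)),
    if b then Function.update hi j (min (hi j) (τ.splitPos v)) else hi, ?_, ?_, ?_⟩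
  · intro p hp
    rw [append_singleton_prefix_leafOf, h p hp]
    simp only [hj, Option.some.injEq, exists_eq_left']
    cases b
    · simp only [Bool.false_eq_true, false_iff, not_le, if_false]
      constructor
      · rintro ⟨h1, h2⟩ k
        by_cases hk : k = j
        · subst hk; simpa using ⟨⟨(h1 k).1, h2⟩, (h1 k).2⟩
        · simpa [hk] using h1 k
      · intro h1
        refine ⟨fun k => ?_, ?_⟩
        · have := h1 k
          by_cases hk : k = j
          · subst hk; simp at this; exact ⟨this.1.1, this.2⟩
          · simpa [hk] using this
        · have := h1 j; simp at this; exact this.1.2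
    · simp only [true_iff, if_true]
      constructor
      · rintro ⟨h1, h2⟩ k
        by_cases hk : k = j
        · subst hk; simpa using ⟨(h1 k).1, (h1 k).2, h2⟩
        · simpa [hk] using h1 k
      · intro h1
        refine ⟨fun k => ?_, ?_⟩
        · have := h1 k
          by_cases hk : k = j
          · subst hk; simp at this; exact ⟨this.1, this.2.1⟩
          · simpa [hk] using this
        · have := h1 j; simp at this; exact this.2.2
  · intro k hk
    cases b <;> simp [hk]
  · cases b
    · ext y; simp only [Bool.false_eq_true, if_false, Function.update_self, Set.mem_inter_iff,
        Set.mem_Ioc, Set.mem_Ioi, max_lt_iff]; tauto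
    · ext y; simp only [if_true, Function.update_self, Set.mem_inter_iff, Set.mem_Ioc,
        Set.mem_Iic, le_min_iff]; tauto

end SplitTree

/-! ### Measurability of the splits along a path -/

section Measurability

variable {Ω : Type*} {d : ℕ}

theorem measurableSet_splitVar (τ : Ω → SplitTree d) (v : List Bool) (S : Set (Option (Fin d))) :
    MeasurableSet[splitSigma τ v] {ω | (τ ω).splitVar v ∈ S} :=
  (le_sup_left : _ ≤ splitSigma τ v) _ ⟨S, trivial, rfl⟩

theorem measurable_splitPos (τ : Ω → SplitTree d) (v : List Bool) :
    Measurable[splitSigma τ v] fun ω => (τ ω).splitPos v :=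
  (comap_measurable _).mono le_sup_right le_rfl

/-- The splits at the proper ancestors of a node determine the points in its cell. -/
theorem measurableSet_prefix_leafOf {m : MeasurableSpace Ω} {τ : Ω → SplitTree d}
    {p : Ω → Fin d → ℝ} (hp : Measurable[m] p) (v : List Bool)
    (hτ : ∀ u, u <+: v → u ≠ v → splitSigma τ u ≤ m) :
    MeasurableSet[m] {ω | v <+: (τ ω).leafOf (p ω)} := by
  induction v using List.reverseRecOn with
  | nil => simp
  | append_singleton v b ih =>
    have ih' := ih fun u hu huv => hτ u (hu.trans (List.prefix_append v [b])) (by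
      rintro rfl
      have := hu.length_le
      simp at this)
    have hv : splitSigma τ v ≤ m := hτ v (List.prefix_append v [b]) (by simp)
    simp only [SplitTree.append_singleton_prefix_leafOf]
    refine ih'.inter ?_
    have : {ω | ∃ j, (τ ω).splitVar v = some j ∧ (b = true ↔ p ω j ≤ (τ ω).splitPos v)} =
        ⋃ j, {ω | (τ ω).splitVar v ∈ ({some j} : Set _)} ∩
          {ω | b = true ↔ p ω j ≤ (τ ω).splitPos v} := by
      ext ω; simp
    change MeasurableSet[m]
      {ω | ∃ j, (τ ω).splitVar v = some j ∧ (b = true ↔ p ω j ≤ (τ ω).splitPos v)}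
    rw [this]
    refine MeasurableSet.iUnion fun j => (hv _ (measurableSet_splitVar τ v _)).inter ?_
    have hle : MeasurableSet[m] {ω | p ω j ≤ (τ ω).splitPos v} :=
      measurableSet_le ((measurable_pi_apply j).comp hp) ((measurable_splitPos τ v).mono hv le_rfl)
    cases b
    · convert hle.compl using 1
      ext ω; simp
    · simpa using hle

theorem splitSigma_le_ancestorSigma (τ : Ω → SplitTree d) {u v : List Bool} (huv : u <+: v)
    (hne : u ≠ v) : splitSigma τ u ≤ ancestorSigma τ v :=
  le_iSup₂_of_le (f := fun (u : List Bool) (_ : u ∈ {u : List Bool | u <+: v ∧ u ≠ v}) =>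
    splitSigma τ u) u ⟨huv, hne⟩ le_rfl

theorem measurable_splitCount (τ : Ω → SplitTree d) (j : Fin d) (v : List Bool) :
    Measurable[ancestorSigma τ v] fun ω => (τ ω).splitCount j v := by
  classical
  unfold SplitTree.splitCount
  let := ancestorSigma τ v
  refine Finset.measurable_sum _ fun k hk => Measurable.ite ?_ measurable_const measurable_const
  have hk := Finset.mem_range.1 hk
  refine splitSigma_le_ancestorSigma τ (List.take_prefix k v) ?_ _
    (measurableSet_splitVar τ (v.take k) {some j})
  intro h
  have := congrArg List.length h
  simp at this
  omega

end Measurability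

/-! ### Measurability of leaves and of the selection event -/

section Selection

variable {Ω : Type*} [MeasurableSpace Ω] {d s : ℕ} {X : Fin s → Ω → (Fin d → ℝ)}
  {τ : Ω → SplitTree d} {P : Ω → Finset (Fin s)}

theorem measurableSet_leafOf_eq (hτ : ∀ v, splitSigma τ v ≤ ‹MeasurableSpace Ω›)
    {p : Ω → Fin d → ℝ} (hp : Measurable p) (v : List Bool) :
    MeasurableSet {ω | (τ ω).leafOf (p ω) = v} := by
  simp only [SplitTree.leafOf_eq_iff]
  exact (measurableSet_prefix_leafOf hp v fun u _ _ => hτ u).inter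
    (hτ v _ (measurableSet_splitVar τ v {none}))

theorem measurableSet_selected (hX : ∀ i, Measurable (X i))
    (hτ : ∀ v, splitSigma τ v ≤ ‹MeasurableSpace Ω›) (hP : ∀ Q, MeasurableSet {ω | P ω = Q})
    (x : Fin d → ℝ) (i : Fin s) : MeasurableSet (selected X τ P x i) := by
  have : selected X τ P x i = (⋃ Q ∈ {Q : Finset (Fin s) | i ∈ Q}, {ω | P ω = Q}) ∩
      ⋃ v : List Bool, {ω | (τ ω).leafOf (X i ω) = v} ∩ {ω | (τ ω).leafOf x = v} := by
    ext ω
    simp [selected, eq_comm]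
  rw [this]
  exact (MeasurableSet.biUnion (Set.to_countable _) fun Q _ => hP Q).inter
    (MeasurableSet.iUnion fun v => (measurableSet_leafOf_eq hτ (hX i) v).inter
      (measurableSet_leafOf_eq hτ measurable_const v))

end Selection

/-! ### The number of splits on a variable along a path -/

/-- An inequality on all events of `m` is an inequality between two restricted measures trimmed to
`m`, so it passes to integrals of `m`-measurable weights. This turns the split probability bound
into one weighted by a power of the number of past splits. -/
theorem const_mul_setLIntegral_le_of_forall_measurableSet {Ω : Type*}
    {m mΩ : MeasurableSpace Ω} (hm : m ≤ mΩ)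
    (μ : Measure[mΩ] Ω) [IsFiniteMeasure μ] {S T : Set Ω} {c : ℝ} (hc : 0 ≤ c)
    (h : ∀ E, MeasurableSet[m] E → c * μ.real (E ∩ S) ≤ μ.real (E ∩ T))
    {φ : Ω → ℝ≥0∞} (hφ : Measurable[m] φ) :
    ENNReal.ofReal c * ∫⁻ ω in S, φ ω ∂μ ≤ ∫⁻ ω in T, φ ω ∂μ := by
  have hle : (ENNReal.ofReal c • μ.restrict S).trim hm ≤ (μ.restrict T).trim hm := by
    refine Measure.le_iff.2 fun E hE => ?_
    rw [trim_measurableSet_eq hm hE, trim_measurableSet_eq hm hE, Measure.smul_apply,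
      Measure.restrict_apply (hm _ hE), Measure.restrict_apply (hm _ hE), smul_eq_mul,
      ← ofReal_measureReal, ← ofReal_measureReal, ← ENNReal.ofReal_mul hc]
    exact ENNReal.ofReal_le_ofReal (h E hE)
  have := lintegral_mono' hle (le_refl φ)
  rwa [lintegral_trim hm hφ, lintegral_trim hm hφ, lintegral_smul_measure] at this

section SplitCount

variable {Ω : Type*} {d : ℕ}

/-- `θ` to the number of splits on variable `j` at the first `n` nodes of the path with
address `w`, zero if there are fewer nodes. -/
noncomputable def pathWeight (τ : SplitTree d) (x : Fin d → ℝ) (j : Fin d) (θ : ℝ) (n : ℕ) : ℝ≥0∞ :=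
  if n ≤ (τ.leafOf x).length then ENNReal.ofReal θ ^ τ.splitCount j ((τ.leafOf x).take n) else 0

theorem pathWeight_of_prefix {τ : SplitTree d} {x : Fin d → ℝ} {v : List Bool} (j : Fin d) (θ : ℝ)
    (hv : v <+: τ.leafOf x) :
    pathWeight τ x j θ v.length = ENNReal.ofReal θ ^ τ.splitCount j v := by
  rw [pathWeight, if_pos hv.length_le, ← List.prefix_iff_eq_take.1 hv]

/-- The one-step recursion behind the binomial comparison. Giving weight zero to paths that have
stopped loses nothing later: in the good event the path to `x` has at least `n` splits. -/
theorem pathWeight_succ_of_prefix {τ : SplitTree d} {x : Fin d → ℝ} {v : List Bool} (j : Fin d)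
    (θ : ℝ) (hv : v <+: τ.leafOf x) :
    pathWeight τ x j θ (v.length + 1) =
      if τ.splitVar v = none then 0 else if τ.splitVar v = some j then
        ENNReal.ofReal θ * ENNReal.ofReal θ ^ τ.splitCount j v
      else ENNReal.ofReal θ ^ τ.splitCount j v := by
  by_cases h : τ.splitVar v = none
  · have := (τ.leafOf_eq_iff v x).2 ⟨hv, h⟩
    rw [if_pos h, pathWeight, this, if_neg (by omega)]
  · rw [if_neg h]
    obtain ⟨u, hu⟩ := hv
    have hu' : u ≠ [] := by
      rintro rfl
      exact h ((τ.leafOf_eq_iff v x).1 (by simpa using hu.symm)).2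
    obtain ⟨b, u, rfl⟩ := List.exists_cons_of_ne_nil hu'
    have hb : v ++ [b] <+: τ.leafOf x := ⟨u, by simpa using hu⟩
    have h1 := pathWeight_of_prefix (τ := τ) (x := x) j θ hb
    rw [List.length_append, List.length_singleton, SplitTree.splitCount_append_singleton] at h1
    rw [h1]
    split_ifs with h2
    · rw [pow_succ, mul_comm]
    · simp

variable {τ : Ω → SplitTree d} {x : Fin d → ℝ}

theorem measurableSet_prefix_leafOf_const (v : List Bool) :
    MeasurableSet[ancestorSigma τ v] {ω | v <+: (τ ω).leafOf x} :=
  measurableSet_prefix_leafOf (m := ancestorSigma τ v) (p := fun _ => x)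
    (@measurable_const _ _ _ (ancestorSigma τ v) x) v
    fun _ hu hne => splitSigma_le_ancestorSigma τ hu hne

variable [mΩ : MeasurableSpace Ω]

/-- Nodes at one depth are disjoint, and the weight vanishes where the path is too short to meet any
of them. The random path can thus be treated one deterministic address at a time. -/
theorem lintegral_pathWeight_eq (μ : Measure Ω) (hτ : ∀ v, splitSigma τ v ≤ mΩ) (j : Fin d) (θ : ℝ)
    (n k : ℕ) (hnk : n ≤ k) :
    ∫⁻ ω, pathWeight (τ ω) x j θ k ∂μ =
      ∑' v : {v : List Bool // v.length = n}, ∫⁻ ω in {ω | v.1 <+: (τ ω).leafOf x},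
        pathWeight (τ ω) x j θ k ∂μ := by
  have hm : ∀ v, ancestorSigma τ v ≤ mΩ := fun v => iSup₂_le fun u _ => hτ u
  have hA : ∀ v, MeasurableSet {ω | v <+: (τ ω).leafOf x} := fun v =>
    hm v _ (measurableSet_prefix_leafOf_const v)
  rw [← lintegral_iUnion
    (s := fun v : {v : List Bool // v.length = n} => {ω | v.1 <+: (τ ω).leafOf x})
    (fun v => hA v.1)]
  · rw [setLIntegral_eq_of_support_subset]
    intro ω hω
    have hk : k ≤ ((τ ω).leafOf x).length := by
      by_contra hk
      simp [pathWeight, hk] at hω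
    refine Set.mem_iUnion.2 ⟨⟨((τ ω).leafOf x).take n, by simp; omega⟩, ?_⟩
    exact List.take_prefix _ _
  · intro v w hvw
    refine Set.disjoint_left.2 fun ω hv hw => hvw (Subtype.ext ?_)
    have h1 := List.prefix_iff_eq_take.1 (show v.1 <+: (τ ω).leafOf x from hv)
    have h2 := List.prefix_iff_eq_take.1 (show w.1 <+: (τ ω).leafOf x from hw)
    rw [h1, h2, v.2, w.2]

/-- If a node is split on variable `j` with probability at least `π`, then the number of such splits
along a path dominates a binomial random variable. -/
theorem lintegral_pathWeight_le (μ : Measure Ω) [IsProbabilityMeasure μ]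
    (hτ : ∀ v, splitSigma τ v ≤ mΩ) (j : Fin d) {π θ : ℝ} (hπ0 : 0 ≤ π) (hπ1 : π ≤ 1) (hθ0 : 0 ≤ θ)
    (hθ1 : θ ≤ 1)
    (hπ : ∀ (v : List Bool) (E : Set Ω), MeasurableSet[ancestorSigma τ v] E →
      π * μ.real (E ∩ {ω | (τ ω).splitVar v ≠ none}) ≤ μ.real (E ∩ {ω | (τ ω).splitVar v = some j}))
    (n : ℕ) :
    ∫⁻ ω, pathWeight (τ ω) x j θ n ∂μ ≤ ENNReal.ofReal (1 - π * (1 - θ)) ^ n := by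
  have hm : ∀ v, ancestorSigma τ v ≤ mΩ := fun v => iSup₂_le fun u _ => hτ u
  have hA : ∀ v, MeasurableSet {ω | v <+: (τ ω).leafOf x} := fun v =>
    hm v _ (measurableSet_prefix_leafOf_const v)
  induction n with
  | zero => simp [pathWeight, SplitTree.splitCount_nil]
  | succ n ih =>
    rw [pow_succ, mul_comm]
    refine le_trans ?_ (mul_le_mul_right ih _)
    rw [lintegral_pathWeight_eq μ hτ j θ n _ n.le_succ, lintegral_pathWeight_eq μ hτ j θ n _ le_rfl,
      ← ENNReal.tsum_mul_left]
    refine ENNReal.tsum_le_tsum fun v => ?_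
    obtain ⟨v, rfl⟩ := v
    set A := {ω | v <+: (τ ω).leafOf x}
    let φ : Ω → ℝ≥0∞ := fun ω => ENNReal.ofReal θ ^ (τ ω).splitCount j v
    let S : Set Ω := {ω | (τ ω).splitVar v ≠ none}
    let T : Set Ω := {ω | (τ ω).splitVar v = some j}
    have hS : MeasurableSet S := hτ v _ (measurableSet_splitVar τ v {none}ᶜ)
    have hT : MeasurableSet T := hτ v _ (measurableSet_splitVar τ v {some j})
    have hTS : T ⊆ S := fun ω (h : _ = _) => show _ ≠ _ by simp [h]
    have hφm : Measurable[ancestorSigma τ v] φ :=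
      (measurable_from_top (f := fun n : ℕ => ENNReal.ofReal θ ^ n)).comp
        (measurable_splitCount τ j v)
    have hφ : Measurable φ := hφm.mono (hm v) le_rfl
    -- Both the passage of the path through `v` and the number of earlier splits on `j` are
    -- determined by the ancestors of `v`, so they may serve as a weight.
    have key : ENNReal.ofReal π * ∫⁻ ω in S, A.indicator φ ω ∂μ ≤ ∫⁻ ω in T, A.indicator φ ω ∂μ :=
      const_mul_setLIntegral_le_of_forall_measurableSet (hm v) μ hπ0 (hπ v)
        (hφm.indicator (measurableSet_prefix_leafOf_const v))
    rw [← lintegral_inter_add_sdiff (A.indicator φ) S hT, Set.inter_eq_right.2 hTS] at key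
    have e1 : ∫⁻ ω in A, pathWeight (τ ω) x j θ (v.length + 1) ∂μ =
        ENNReal.ofReal θ * ∫⁻ ω in T, A.indicator φ ω ∂μ + ∫⁻ ω in S \ T, A.indicator φ ω ∂μ := by
      rw [← lintegral_const_mul _ (hφ.indicator (hA v)), ← lintegral_indicator hT,
        ← lintegral_indicator (hS.diff hT), ← lintegral_indicator (hA v),
        ← lintegral_add_left (((hφ.indicator (hA v)).const_mul _).indicator hT)]
      refine lintegral_congr fun ω => ?_
      by_cases hω : ω ∈ A
      · have hω' : v <+: (τ ω).leafOf x := hω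
        have hs := pathWeight_succ_of_prefix j θ hω'
        by_cases h1 : (τ ω).splitVar v = none
        · simp [Set.indicator, S, T, h1, hω', hs]
        · by_cases h2 : (τ ω).splitVar v = some j
          · simp [Set.indicator, S, T, h2, hω', hs, φ]
          · simp [Set.indicator, S, T, h1, h2, hω, hω', hs, φ]
      · simp [Set.indicator, hω, show ¬ v <+: (τ ω).leafOf x from hω]
    have e2 : ∫⁻ ω in T, A.indicator φ ω ∂μ + ∫⁻ ω in S \ T, A.indicator φ ω ∂μ ≤
        ∫⁻ ω in A, pathWeight (τ ω) x j θ v.length ∂μ := by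
      calc _ = ∫⁻ ω in S, A.indicator φ ω ∂μ := by
            rw [← lintegral_inter_add_sdiff (A.indicator φ) S hT, Set.inter_eq_right.2 hTS]
        _ ≤ ∫⁻ ω, A.indicator φ ω ∂μ := setLIntegral_le_lintegral _ _
        _ = _ := by
            rw [lintegral_indicator (hA v)]
            exact setLIntegral_congr_fun (hA v) fun ω hω => (pathWeight_of_prefix j θ hω).symm
    have hfin : ∀ U : Set Ω, ∫⁻ ω in U, A.indicator φ ω ∂μ ≠ ∞ := by
      intro U
      refine ne_top_of_le_ne_top (measure_ne_top (μ.restrict U) Set.univ) ?_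
      rw [← lintegral_one]
      refine lintegral_mono fun ω => Set.indicator_le' (fun ω _ => ?_) (fun _ _ => zero_le_one) ω
      exact pow_le_one' (ENNReal.ofReal_le_one.2 hθ1) _
    rw [e1]
    refine le_trans ?_ (mul_le_mul_right e2 _)
    -- What remains is arithmetic: `π (a + b) ≤ a` gives `θ a + b = (a + b) - (1 - θ) a ≤ (1 - π (1
    -- - θ)) (a + b)`.
    generalize (∫⁻ ω in T, A.indicator φ ω ∂μ) = a, hfin T = ha at *
    generalize (∫⁻ ω in S \ T, A.indicator φ ω ∂μ) = b, hfin (S \ T) = hb at *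
    lift a to NNReal using ha
    lift b to NNReal using hb
    have hρ : 0 ≤ 1 - π * (1 - θ) := by nlinarith
    lift π to NNReal using hπ0
    lift θ to NNReal using hθ0
    obtain ⟨ρ, hρe⟩ : ∃ ρ : NNReal, (ρ : ℝ) = 1 - π * (1 - θ) := ⟨⟨_, hρ⟩, rfl⟩
    rw [← hρe]
    simp only [ENNReal.ofReal_coe_nnreal] at key ⊢
    norm_cast at key ⊢
    rw [← NNReal.coe_le_coe] at key ⊢
    push_cast at key ⊢
    rw [hρe]
    have : (θ : ℝ) ≤ 1 := hθ1
    nlinarith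

end SplitCount

/-! ### The feature law -/

section FeatureLaw

variable {d : ℕ} {f : (Fin d → ℝ) → ℝ}

theorem measurableSet_unitCube (d : ℕ) : MeasurableSet (unitCube d) := measurableSet_Icc

theorem mem_unitCube_iff {d : ℕ} {u : Fin d → ℝ} :
    u ∈ unitCube d ↔ ∀ j, u j ∈ Set.Icc (0 : ℝ) 1 :=
  ⟨fun h j => ⟨h.1 j, h.2 j⟩, fun h => ⟨fun j => (h j).1, fun j => (h j).2⟩⟩

theorem unitCube_eq_pi (d : ℕ) : unitCube d = Set.univ.pi fun _ => Set.Icc (0 : ℝ) 1 := by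
  ext u
  rw [mem_unitCube_iff, Set.mem_univ_pi]

theorem volume_unitCube (d : ℕ) : volume (unitCube d) = 1 := by
  rw [unitCube_eq_pi, volume_pi_pi]
  simp

theorem IsBoundedDensity.isProbabilityMeasure (hf : IsBoundedDensity f) :
    IsProbabilityMeasure (featureLaw f) := by
  constructor
  rw [featureLaw, withDensity_apply _ MeasurableSet.univ, Measure.restrict_univ,
    hf.lintegral_eq_one]

theorem featureLaw_compl_unitCube (f : (Fin d → ℝ) → ℝ) : featureLaw f (unitCube d)ᶜ = 0 := by
  rw [featureLaw, withDensity_apply _ (measurableSet_unitCube d).compl,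
    Measure.restrict_restrict (measurableSet_unitCube d).compl, Set.compl_inter_self,
    Measure.restrict_empty, lintegral_zero_measure]

theorem featureLaw_le {b : ℝ} (hb : ∀ u ∈ unitCube d, f u ≤ b) {B : Set (Fin d → ℝ)}
    (hB : MeasurableSet B) : featureLaw f B ≤ ENNReal.ofReal b * volume (B ∩ unitCube d) := by
  rw [featureLaw, withDensity_apply _ hB, Measure.restrict_restrict hB]
  refine (setLIntegral_mono' (hB.inter (measurableSet_unitCube d))
    (g := fun _ => ENNReal.ofReal b) fun u hu => ENNReal.ofReal_le_ofReal (hb u hu.2)).trans ?_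
  rw [setLIntegral_const]

theorem le_featureLaw {a : ℝ} (ha : ∀ u ∈ unitCube d, a ≤ f u) {B : Set (Fin d → ℝ)}
    (hB : MeasurableSet B) : ENNReal.ofReal a * volume (B ∩ unitCube d) ≤ featureLaw f B := by
  rw [featureLaw, withDensity_apply _ hB, Measure.restrict_restrict hB]
  refine le_trans ?_ (setLIntegral_mono' (hB.inter (measurableSet_unitCube d))
    (f := fun _ => ENNReal.ofReal a) fun u hu => ENNReal.ofReal_le_ofReal (ha u hu.2))
  rw [setLIntegral_const]

theorem volume_inter_unitCube_ne_top (B : Set (Fin d → ℝ)) : volume (B ∩ unitCube d) ≠ ∞ :=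
  ne_top_of_le_ne_top (by simp [volume_unitCube]) (measure_mono Set.inter_subset_right)

theorem featureLaw_real_le {b : ℝ} (hb0 : 0 ≤ b) (hb : ∀ u ∈ unitCube d, f u ≤ b)
    {B : Set (Fin d → ℝ)} (hB : MeasurableSet B) :
    (featureLaw f).real B ≤ b * volume.real (B ∩ unitCube d) := by
  have := ENNReal.toReal_mono (ENNReal.mul_ne_top ENNReal.ofReal_ne_top
    (volume_inter_unitCube_ne_top B)) (featureLaw_le hb hB)
  rwa [ENNReal.toReal_mul, ENNReal.toReal_ofReal hb0] at this

theorem IsBoundedDensity.le_real_featureLaw (hf : IsBoundedDensity f) {a : ℝ} (ha0 : 0 ≤ a)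
    (ha : ∀ u ∈ unitCube d, a ≤ f u) {B : Set (Fin d → ℝ)} (hB : MeasurableSet B) :
    a * volume.real (B ∩ unitCube d) ≤ (featureLaw f).real B := by
  have := hf.isProbabilityMeasure
  have := ENNReal.toReal_mono (measure_ne_top _ _) (le_featureLaw ha hB)
  rwa [ENNReal.toReal_mul, ENNReal.toReal_ofReal ha0] at this

theorem volume_real_box (I : Fin d → Set ℝ) :
    volume.real (Set.univ.pi I ∩ unitCube d) = ∏ j, volume.real (I j ∩ Set.Icc 0 1) := by
  rw [unitCube_eq_pi, ← Set.pi_inter_distrib, measureReal_def, volume_pi_pi, ENNReal.toReal_prod]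
  rfl

/-- The part of the unit cube where coordinate `j` belongs to `I` has the volume of `I`. -/
theorem volume_real_slab (j : Fin d) (I : Set ℝ) :
    volume.real ({u : Fin d → ℝ | u j ∈ I} ∩ unitCube d) = volume.real (I ∩ Set.Icc 0 1) := by
  classical
  have : {u : Fin d → ℝ | u j ∈ I} = Set.univ.pi (Function.update (fun _ => Set.univ) j I) := by
    ext u
    simp only [Set.mem_ofPred_eq, Set.mem_univ_pi]
    constructor
    · intro h k
      by_cases hk : k = j
      · subst hk; simpa using h
      · simp [hk]
    · intro h
      simpa using h j
  rw [this, volume_real_box, Finset.prod_eq_single j]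
  · simp
  · intro k _ hk
    simp [hk]
  · simp

end FeatureLaw

/-! ### Uniform concentration on boxes -/

section Count

variable {Ω 𝓔 : Type*} {s : ℕ}

/-- The number of `i ∈ Q` for which `p i` belongs to `C`. -/
noncomputable def countIn (p : Fin s → 𝓔) (Q : Finset (Fin s)) (C : Set 𝓔) : ℝ :=
  ∑ i ∈ Q, C.indicator 1 (p i)

theorem countIn_mono {p : Fin s → 𝓔} {Q : Finset (Fin s)} {C D : Set 𝓔}
    (h : ∀ i ∈ Q, p i ∈ C → p i ∈ D) : countIn p Q C ≤ countIn p Q D := by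
  refine Finset.sum_le_sum fun i hi => ?_
  by_cases hC : p i ∈ C
  · simp [hC, h i hi hC]
  · simp [hC, Set.indicator_nonneg]

variable [MeasurableSpace 𝓔]

/-- Chebyshev's inequality, with variance at most one per independent indicator. A polynomial tail
is enough, since the grids used below have polynomially many cells. -/
theorem measure_abs_countIn_sub_ge_le [MeasurableSpace Ω] {μ : Measure Ω} [IsProbabilityMeasure μ] {F : Measure 𝓔}
    [IsProbabilityMeasure F] {U : Fin s → Ω → 𝓔} (hU : ∀ i, Measurable (U i))
    (hlaw : ∀ i, μ.map (U i) = F) (hind : iIndepFun U μ) (Q : Finset (Fin s)) {C : Set 𝓔}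
    (hC : MeasurableSet C) {t : ℝ} (ht : 0 < t) :
    μ {ω | t ≤ |countIn (fun i => U i ω) Q C - Q.card * F.real C|} ≤
      ENNReal.ofReal (Q.card / t ^ 2) := by
  let ξ : Fin s → Ω → ℝ := fun i ω => C.indicator 1 (U i ω)
  have hm1 : Measurable (C.indicator (1 : 𝓔 → ℝ)) := measurable_one.indicator hC
  have hξ : ∀ i, MemLp (ξ i) 2 μ := fun i =>
    MemLp.of_bound (hm1.comp (hU i)).aestronglyMeasurable 1 (ae_of_all _ fun ω => by
      simp only [ξ]
      by_cases h : U i ω ∈ C <;> simp [h])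
  have hmean : ∀ i, μ[ξ i] = F.real C := fun i => by
    have : ∫ ω, C.indicator (1 : 𝓔 → ℝ) (U i ω) ∂μ = ∫ u, C.indicator 1 u ∂(μ.map (U i)) :=
      (integral_map (hU i).aemeasurable hm1.aestronglyMeasurable).symm
    rw [this, hlaw, integral_indicator_one hC]
  have hvar : ∀ i, variance (ξ i) μ ≤ 1 := fun i => by
    refine (variance_le_expectation_sq (hξ i).1).trans ?_
    calc _ ≤ ∫ _, (1 : ℝ) ∂μ := by
          refine integral_mono_of_nonneg (ae_of_all _ fun ω => sq_nonneg _)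
            (integrable_const _) (ae_of_all _ fun ω => ?_)
          simp only [ξ, Pi.pow_apply]
          by_cases h : U i ω ∈ C <;> simp [h]
      _ = 1 := by simp
  have hsum : MemLp (∑ i ∈ Q, ξ i) 2 μ := memLp_finsetSum' _ fun i _ => hξ i
  have hcheb := meas_ge_le_variance_div_sq hsum ht
  have hv : variance (∑ i ∈ Q, ξ i) μ ≤ Q.card := by
    rw [IndepFun.variance_sum (fun i _ => hξ i) fun i _ j _ hij =>
      (hind.indepFun hij).comp hm1 hm1]
    calc _ ≤ ∑ i ∈ Q, (1 : ℝ) := Finset.sum_le_sum fun i _ => hvar i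
      _ = _ := by simp
  have hE : μ[∑ i ∈ Q, ξ i] = Q.card * F.real C := by
    simp only [Finset.sum_apply]
    rw [integral_finsetSum _ fun i _ => (hξ i).integrable one_le_two]
    simp [hmean]
  rw [hE] at hcheb
  simp only [Finset.sum_apply] at hcheb
  refine hcheb.trans (ENNReal.ofReal_le_ofReal ?_)
  gcongr

/-- Independence lets the random index set be frozen at each of its finitely many values. Only
values of positive probability matter, so almost sure properties of the set may be used as if they
were deterministic. -/
theorem measure_exists_of_indep {Ω 𝓠 : Type*} {m mΩ : MeasurableSpace Ω}
    {μ : Measure[mΩ] Ω} [Fintype 𝓠] {P : Ω → 𝓠} (hind : Indep (MeasurableSpace.comap P ⊤) m μ)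
    [IsProbabilityMeasure μ] (hP : ∀ Q, MeasurableSet[mΩ] {ω | P ω = Q})
    {B : 𝓠 → Set Ω} (hB : ∀ Q, MeasurableSet[m] (B Q)) {δ : ℝ≥0∞}
    (hδ : ∀ Q, μ {ω | P ω = Q} ≠ 0 → μ (B Q) ≤ δ) : μ {ω | ω ∈ B (P ω)} ≤ δ := by
  have h1 : {ω | ω ∈ B (P ω)} = ⋃ Q, {ω | P ω = Q} ∩ B Q := by ext ω; simp
  rw [h1]
  calc _ ≤ ∑ Q, μ ({ω | P ω = Q} ∩ B Q) := measure_iUnion_fintype_le _ _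
    _ = ∑ Q, μ {ω | P ω = Q} * μ (B Q) := Finset.sum_congr rfl fun Q _ =>
        (Indep_iff _ _ μ).1 hind _ _ ⟨{Q}, trivial, rfl⟩ (hB Q)
    _ ≤ ∑ Q, μ {ω | P ω = Q} * δ := by
        refine Finset.sum_le_sum fun Q _ => ?_
        by_cases h : μ {ω | P ω = Q} = 0
        · simp [h]
        · exact mul_le_mul_right (hδ Q h) _
    _ = μ (⋃ Q, {ω | P ω = Q}) * δ := by
        rw [← Finset.sum_mul, measure_iUnion, tsum_fintype]
        · intro Q R hQR
          exact Set.disjoint_left.2 fun ω h1 h2 => hQR (h1.symm.trans h2)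
        · exact hP
    _ ≤ 1 * δ := mul_le_mul_left prob_le_one _
    _ = δ := one_mul _

end Count

/-! ### Discretization of boxes by a grid -/

section Grid

variable {d : ℕ}

/-- The index of the cell of side `1 / M` that contains a point. -/
noncomputable def gridIndex (M : ℕ) (u : Fin d → ℝ) : Fin d → Fin (M + 1) :=
  -- On the cube the extra index `M` is taken only at coordinate `1`; the minimum has an effect only
  -- outside the cube.
  fun j => ⟨min ⌊M * u j⌋₊ M, by omega⟩

theorem measurable_gridIndex (M : ℕ) : Measurable (gridIndex (d := d) M) := by
  refine measurable_pi_lambda _ fun j => ?_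
  have : Measurable fun n : ℕ => (⟨min n M, by omega⟩ : Fin (M + 1)) := measurable_from_top
  have hj : Measurable fun u : Fin d → ℝ => (M : ℝ) * u j := by fun_prop
  exact this.comp (Nat.measurable_floor.comp hj)

theorem abs_sub_le_of_gridIndex_eq {M : ℕ} (hM : 0 < M) {u w : Fin d → ℝ} (hu : u ∈ unitCube d)
    (hw : w ∈ unitCube d) (h : gridIndex M u = gridIndex M w) (j : Fin d) :
    |u j - w j| ≤ 1 / M := by
  have hM' : (0 : ℝ) < M := by exact_mod_cast hM
  have hu := mem_unitCube_iff.1 hu j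
  have hw := mem_unitCube_iff.1 hw j
  have hfl : ∀ t : ℝ, t ∈ Set.Icc (0 : ℝ) 1 → ⌊M * t⌋₊ ≤ M := fun t ht =>
    Nat.floor_le_of_le (by nlinarith [ht.2])
  have h1 : ⌊M * u j⌋₊ = ⌊M * w j⌋₊ := by
    have := congrArg Fin.val (congrFun h j)
    simpa [gridIndex, hfl _ hu, hfl _ hw] using this
  have hu1 := Nat.floor_le (mul_nonneg hM'.le hu.1)
  have hw1 := Nat.floor_le (mul_nonneg hM'.le hw.1)
  have hu2 := Nat.lt_floor_add_one (M * u j)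
  have hw2 := Nat.lt_floor_add_one (M * w j)
  rw [h1] at hu1 hu2
  rw [abs_le, ← neg_div, div_le_iff₀ hM', le_div_iff₀ hM']
  constructor <;> nlinarith

/-- The box of the points `p` with `lo j < p j ≤ hi j` for all `j`. -/
def halfOpenBox (lo hi : Fin d → ℝ) : Set (Fin d → ℝ) :=
  Set.univ.pi fun j => Set.Ioc (lo j) (hi j)

theorem measurableSet_halfOpenBox (lo hi : Fin d → ℝ) : MeasurableSet (halfOpenBox lo hi) :=
  MeasurableSet.univ_pi fun _ => measurableSet_Ioc

/-- The points with a coordinate that is within `r` of an end of the box. -/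
def boxBoundary (lo hi : Fin d → ℝ) (r : ℝ) : Set (Fin d → ℝ) :=
  ⋃ j, {u | u j ∈ Set.Icc (lo j - r) (lo j + r) ∪ Set.Icc (hi j - r) (hi j + r)}

theorem measurableSet_boxBoundary (lo hi : Fin d → ℝ) (r : ℝ) :
    MeasurableSet (boxBoundary lo hi r) :=
  MeasurableSet.iUnion fun j => measurable_pi_apply j (measurableSet_Icc.union measurableSet_Icc)

/-- In some coordinate an end of the box separates the two points, and they differ there by at most
`1 / M`. Hence both are that close to this end. -/
theorem mem_boxBoundary_of_gridIndex_eq {M : ℕ} (hM : 0 < M) {lo hi u w z : Fin d → ℝ}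
    (hu : u ∈ unitCube d) (hw : w ∈ unitCube d) (h : gridIndex M u = gridIndex M w)
    (huB : u ∈ halfOpenBox lo hi) (hwB : w ∉ halfOpenBox lo hi) (hz : z = u ∨ z = w) :
    z ∈ boxBoundary lo hi (1 / M) := by
  simp only [halfOpenBox, Set.mem_univ_pi, not_forall] at huB hwB
  obtain ⟨j, hj⟩ := hwB
  have hd := abs_le.1 (abs_sub_le_of_gridIndex_eq hM hu hw h j)
  have huj := huB j
  refine Set.mem_iUnion.2 ⟨j, ?_⟩
  simp only [Set.mem_Ioc, not_and_or, not_lt, not_le] at hj huj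
  simp only [Set.mem_ofPred_eq, Set.mem_union, Set.mem_Icc]
  rcases hj with hj | hj
  · left
    rcases hz with rfl | rfl <;> constructor <;> linarith
  · right
    rcases hz with rfl | rfl <;> constructor <;> linarith

theorem volume_real_boxBoundary_le (lo hi : Fin d → ℝ) {r : ℝ} (hr : 0 ≤ r) :
    volume.real (boxBoundary lo hi r ∩ unitCube d) ≤ d * (4 * r) := by
  have hfin : ∀ B : Set (Fin d → ℝ), volume (B ∩ unitCube d) ≠ ∞ := volume_inter_unitCube_ne_top
  rw [boxBoundary, Set.iUnion_inter]
  refine (measureReal_iUnion_fintype_le _).trans ?_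
  calc _ ≤ ∑ j : Fin d, 4 * r := by
        refine Finset.sum_le_sum fun j _ => ?_
        rw [volume_real_slab]
        have hI : ∀ c : ℝ, volume.real (Set.Icc (c - r) (c + r)) = 2 * r := fun c => by
          rw [Real.volume_real_Icc_of_le (by linarith)]; ring
        calc _ ≤ volume.real (Set.Icc (lo j - r) (lo j + r) ∪ Set.Icc (hi j - r) (hi j + r)) :=
              measureReal_mono Set.inter_subset_left
                (ne_top_of_le_ne_top (by simp) (measure_union_le _ _))
          _ ≤ _ := measureReal_union_le _ _
          _ = 4 * r := by rw [hI, hI]; ring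
    _ = d * (4 * r) := by simp

variable {s : ℕ}

/-- If the counts of all unions of grid cells are close to their expected values, then the counts of
all boxes are. -/
theorem abs_countIn_halfOpenBox_sub_le {F : Measure (Fin d → ℝ)} [IsProbabilityMeasure F]
    (hF : F (unitCube d)ᶜ = 0) {b : ℝ} (hb0 : 0 ≤ b)
    (hb : ∀ B, MeasurableSet B → F.real B ≤ b * volume.real (B ∩ unitCube d))
    {p : Fin s → Fin d → ℝ} (hp : ∀ i, p i ∈ unitCube d) {Q : Finset (Fin s)} {M : ℕ} (hM : 0 < M)
    {D : ℝ}
    (hD : ∀ S : Set (Fin d → Fin (M + 1)),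
      |countIn p Q (gridIndex M ⁻¹' S) - Q.card * F.real (gridIndex M ⁻¹' S)| ≤ D)
    (lo hi : Fin d → ℝ) :
    |countIn p Q (halfOpenBox lo hi) - Q.card * F.real (halfOpenBox lo hi)| ≤
      D + Q.card * (4 * d * b / M) := by
  set R := halfOpenBox lo hi
  set E := boxBoundary lo hi (1 / M)
  have hE : F.real E ≤ 4 * d * b / M := by
    refine (hb E (measurableSet_boxBoundary _ _ _)).trans ?_
    refine (mul_le_mul_of_nonneg_left (volume_real_boxBoundary_le lo hi (by positivity)) hb0).trans
      (le_of_eq (by ring))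
  have hmono : ∀ A B : Set (Fin d → ℝ), (∀ u ∈ unitCube d, u ∈ A → u ∈ B) →
      F.real A ≤ F.real B := fun A B h => by
    refine ENNReal.toReal_mono (measure_ne_top _ _) (measure_mono_ae ?_)
    filter_upwards [compl_mem_ae_iff.2 hF] with u hu hA
    exact h u (by simpa using hu) hA
  -- The outer and inner approximations of the box by grid cells. Within the cube, each differs from
  -- the box by a subset of the boundary layer `E`.
  let So : Set (Fin d → Fin (M + 1)) := {c | ∃ w ∈ unitCube d, w ∈ R ∧ gridIndex M w = c}
  let Si : Set (Fin d → Fin (M + 1)) := {c | ∀ w ∈ unitCube d, gridIndex M w = c → w ∈ R}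
  have ho : F.real (gridIndex M ⁻¹' So) ≤ F.real R + F.real E := by
    refine (hmono _ (R ∪ E) ?_).trans (measureReal_union_le _ _)
    rintro u hu ⟨w, hw, hwR, h⟩
    by_cases huR : u ∈ R
    · exact Or.inl huR
    · exact Or.inr (mem_boxBoundary_of_gridIndex_eq hM hw hu h hwR huR (Or.inr rfl))
  have hi' : F.real R ≤ F.real (gridIndex M ⁻¹' Si) + F.real E := by
    refine (hmono _ (gridIndex M ⁻¹' Si ∪ E) ?_).trans (measureReal_union_le _ _)
    intro u hu huR
    by_cases h : u ∈ gridIndex M ⁻¹' Si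
    · exact Or.inl h
    · simp only [Set.mem_preimage, Set.mem_ofPred_eq, Si, not_forall] at h
      obtain ⟨w, hw, hwu, hwR⟩ := h
      exact Or.inr (mem_boxBoundary_of_gridIndex_eq hM hu hw hwu.symm huR hwR (Or.inl rfl))
  have h1 : countIn p Q R ≤ countIn p Q (gridIndex M ⁻¹' So) :=
    countIn_mono fun i _ h => ⟨p i, hp i, h, rfl⟩
  have h2 : countIn p Q (gridIndex M ⁻¹' Si) ≤ countIn p Q R :=
    countIn_mono fun i _ h => h (p i) (hp i) rfl
  have h3 := abs_le.1 (hD So)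
  have h4 := abs_le.1 (hD Si)
  have hq : (0 : ℝ) ≤ Q.card := Nat.cast_nonneg _
  rw [abs_le]
  constructor
  · nlinarith [mul_le_mul_of_nonneg_left hi' hq, mul_le_mul_of_nonneg_left hE hq]
  · nlinarith [mul_le_mul_of_nonneg_left ho hq, mul_le_mul_of_nonneg_left hE hq]

variable {Ω : Type*}

theorem countIn_preimage_eq_sum {𝓔 𝓒 : Type*} [Fintype 𝓒] (p : Fin s → 𝓔) (Q : Finset (Fin s))
    (g : 𝓔 → 𝓒) (S : Set 𝓒) [DecidablePred (· ∈ S)] :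
    countIn p Q (g ⁻¹' S) = ∑ c with c ∈ S, countIn p Q (g ⁻¹' {c}) := by
  classical
  simp only [countIn]
  rw [Finset.sum_comm]
  refine Finset.sum_congr rfl fun i _ => ?_
  simp [Set.indicator_apply, Finset.sum_ite_eq]

/-- Adding up the errors of the cells costs a factor `Fintype.card 𝓒`, but it leaves a union bound
over cells instead of over the exponentially many sets of cells. -/
theorem abs_countIn_preimage_sub_le {𝓔 𝓒 : Type*} [MeasurableSpace 𝓔] [MeasurableSpace 𝓒]
    [MeasurableSingletonClass 𝓒] [Fintype 𝓒] {F : Measure 𝓔} [IsProbabilityMeasure F]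
    {p : Fin s → 𝓔} {Q : Finset (Fin s)} {g : 𝓔 → 𝓒} (hg : Measurable g) {t : ℝ} (ht : 0 ≤ t)
    (h : ∀ c, |countIn p Q (g ⁻¹' {c}) - Q.card * F.real (g ⁻¹' {c})| ≤ t) (S : Set 𝓒) :
    |countIn p Q (g ⁻¹' S) - Q.card * F.real (g ⁻¹' S)| ≤ Fintype.card 𝓒 * t := by
  classical
  have hF : F.real (g ⁻¹' S) = ∑ c with c ∈ S, F.real (g ⁻¹' {c}) := by
    rw [sum_measureReal_preimage_singleton _ fun c _ => hg (measurableSet_singleton c)]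
    simp
  rw [countIn_preimage_eq_sum, hF, Finset.mul_sum, ← Finset.sum_sub_distrib]
  calc _ ≤ ∑ c with c ∈ S, t :=
        (Finset.abs_sum_le_sum_abs _ _).trans (Finset.sum_le_sum fun c _ => h c)
    _ ≤ ∑ c : 𝓒, t := Finset.sum_le_sum_of_subset_of_nonneg (Finset.subset_univ _)
        fun _ _ _ => ht
    _ = _ := by simp

/-- The counts of independent sample points in the cells of a partition, over a random set of
indices that is independent of the sample, are close to their expected values. -/
theorem measure_exists_abs_countIn_sub_gt_le {𝓔 𝓒 : Type*} [MeasurableSpace 𝓔]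
    [MeasurableSpace 𝓒] [MeasurableSingletonClass 𝓒] [Fintype 𝓒] [mΩ : MeasurableSpace Ω]
    {μ : Measure Ω} [IsProbabilityMeasure μ]
    {F : Measure 𝓔} [IsProbabilityMeasure F] {U : Fin s → Ω → 𝓔} (hU : ∀ i, Measurable (U i))
    (hlaw : ∀ i, μ.map (U i) = F) (hind : iIndepFun U μ) {P : Ω → Finset (Fin s)}
    (hP : ∀ Q, MeasurableSet {ω | P ω = Q})
    (hPU : Indep (MeasurableSpace.comap P ⊤)
      (MeasurableSpace.comap (fun ω i => U i ω) inferInstance) μ)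
    {g : 𝓔 → 𝓒} (hg : Measurable g) {t : ℝ} (ht : 0 < t) :
    μ {ω | ∃ S : Set 𝓒, Fintype.card 𝓒 * t <
      |countIn (fun i => U i ω) (P ω) (g ⁻¹' S) - (P ω).card * F.real (g ⁻¹' S)|} ≤
      ENNReal.ofReal (Fintype.card 𝓒 * (s / t ^ 2)) := by
  let B : Finset (Fin s) → Set Ω := fun Q =>
    ⋃ c, {ω | t ≤ |countIn (fun i => U i ω) Q (g ⁻¹' {c}) - Q.card * F.real (g ⁻¹' {c})|}
  have hgc : ∀ c, MeasurableSet (g ⁻¹' {c}) := fun c => hg (measurableSet_singleton c)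
  have hBm : ∀ Q, MeasurableSet[MeasurableSpace.comap (fun ω i => U i ω) inferInstance] (B Q) := by
    intro Q
    refine MeasurableSet.iUnion fun c => ?_
    refine ⟨{u : Fin s → 𝓔 | t ≤ |countIn u Q (g ⁻¹' {c}) - Q.card * F.real (g ⁻¹' {c})|},
      measurableSet_le measurable_const ?_, rfl⟩
    refine (Measurable.sub_const ?_ _).abs
    exact Finset.measurable_sum _ fun i _ =>
      (measurable_one.indicator (hgc c)).comp (measurable_pi_apply i)
  refine (measure_mono ?_).trans (measure_exists_of_indep hPU hP hBm fun Q _ => ?_)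
  · intro ω ⟨S, hS⟩
    by_contra hω
    refine absurd hS (not_lt.2 (abs_countIn_preimage_sub_le hg ht.le (fun c => ?_) S))
    by_contra hc
    exact hω (Set.mem_iUnion.2 ⟨c, (not_le.1 hc).le⟩)
  · refine (measure_iUnion_fintype_le _ _).trans ?_
    calc _ ≤ ∑ c : 𝓒, ENNReal.ofReal (s / t ^ 2) := by
          refine Finset.sum_le_sum fun c _ =>
            (measure_abs_countIn_sub_ge_le hU hlaw hind Q (hgc c) ht).trans
              (ENNReal.ofReal_le_ofReal ?_)
          gcongr
          simpa using Finset.card_le_univ Q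
      _ = _ := by
          rw [Finset.sum_const, nsmul_eq_mul, Finset.card_univ, ENNReal.ofReal_mul (by positivity),
            ENNReal.ofReal_natCast]

end Grid

/-! ### Contraction of the nodes along a path -/

section Contraction

variable {d s : ℕ}

theorem nodeCount_eq_countIn (τ : SplitTree d) (p : Fin s → Fin d → ℝ) (Q : Finset (Fin s))
    (v : List Bool) : (nodeCount τ p Q v : ℝ) = countIn p Q {q | v <+: τ.leafOf q} := by
  classical
  have : {i : Fin s | i ∈ Q ∧ v <+: τ.leafOf (p i)} = ↑(Q.filter fun i => v <+: τ.leafOf (p i)) := by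
    ext i; simp
  rw [nodeCount, this, Set.ncard_coe_finset, countIn, Finset.card_filter]
  push_cast
  exact Finset.sum_congr rfl fun i _ => by simp [Set.indicator_apply]

theorem countIn_congr {𝓔 : Type*} {p : Fin s → 𝓔} {Q : Finset (Fin s)} {C D : Set 𝓔}
    (h : ∀ i, p i ∈ C ↔ p i ∈ D) : countIn p Q C = countIn p Q D :=
  le_antisymm (countIn_mono fun i _ => (h i).1) (countIn_mono fun i _ => (h i).2)

/-- The side length of a box within the unit cube. -/
noncomputable def sideLength (lo hi : Fin d → ℝ) (j : Fin d) : ℝ :=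
  volume.real (Set.Ioc (lo j) (hi j) ∩ Set.Icc 0 1)

theorem sideLength_nonneg (lo hi : Fin d → ℝ) (j : Fin d) : 0 ≤ sideLength lo hi j :=
  measureReal_nonneg

theorem volume_real_halfOpenBox (lo hi : Fin d → ℝ) :
    volume.real (halfOpenBox lo hi ∩ unitCube d) = ∏ j, sideLength lo hi j :=
  volume_real_box _

theorem abs_sub_le_sideLength {lo hi : Fin d → ℝ} {j : Fin d} {p q : ℝ}
    (hp : p ∈ Set.Ioc (lo j) (hi j)) (hq : q ∈ Set.Ioc (lo j) (hi j)) (hp' : p ∈ Set.Icc (0 : ℝ) 1)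
    (hq' : q ∈ Set.Icc (0 : ℝ) 1) : |p - q| ≤ sideLength lo hi j := by
  have h : Set.uIcc q p ⊆ Set.Ioc (lo j) (hi j) ∩ Set.Icc 0 1 :=
    Set.subset_inter (Set.ordConnected_Ioc.uIcc_subset hq hp)
      (Set.ordConnected_Icc.uIcc_subset hq' hp')
  have := measureReal_mono (μ := volume) h
    (ne_top_of_le_ne_top (by simp) (measure_mono Set.inter_subset_right))
  rwa [Set.uIcc, Real.volume_real_Icc_of_le inf_le_sup, max_sub_min_eq_abs] at this

/-- The two parts of a split add up to the node. -/
theorem sideLength_add_of_split {lo hi lo' hi' lo'' hi'' : Fin d → ℝ} {j : Fin d} {b : Bool} {t : ℝ}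
    (h' : Set.Ioc (lo' j) (hi' j) = Set.Ioc (lo j) (hi j) ∩ if b then Set.Iic t else Set.Ioi t)
    (h'' : Set.Ioc (lo'' j) (hi'' j) = Set.Ioc (lo j) (hi j) ∩
      if !b then Set.Iic t else Set.Ioi t) :
    sideLength lo' hi' j + sideLength lo'' hi'' j = sideLength lo hi j := by
  set J := Set.Ioc (lo j) (hi j) ∩ Set.Icc (0 : ℝ) 1
  have hJ : volume J ≠ ∞ := ne_top_of_le_ne_top (by simp) (measure_mono Set.inter_subset_right)
  have key := measureReal_inter_add_sdiff (μ := volume) (s := J) (measurableSet_Iic (a := t)) hJ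
  have e1 : Set.Ioc (lo j) (hi j) ∩ Set.Iic t ∩ Set.Icc 0 1 = J ∩ Set.Iic t :=
    Set.inter_right_comm _ _ _
  have e2 : Set.Ioc (lo j) (hi j) ∩ Set.Ioi t ∩ Set.Icc 0 1 = J \ Set.Iic t := by
    rw [Set.inter_right_comm, Set.sdiff_eq, Set.compl_Iic]
  unfold sideLength
  rw [h', h'']
  cases b
  · simp only [Bool.false_eq_true, if_false, Bool.not_false, if_true, e1, e2]
    rw [add_comm]; exact key
  · simp only [if_true, Bool.not_true, Bool.false_eq_true, if_false, e1, e2]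
    exact key

variable {F : Measure (Fin d → ℝ)} {a b : ℝ}

/-- Each split on variable `j` reduces side `j` by a constant factor, as long as the counts
are well approximated by their expected values. -/
theorem exists_box_of_isBalanced (ha0 : 0 < a) (hab : a ≤ b)
    (ha : ∀ B, MeasurableSet B → a * volume.real (B ∩ unitCube d) ≤ F.real B)
    (hb : ∀ B, MeasurableSet B → F.real B ≤ b * volume.real (B ∩ unitCube d))
    {τ : SplitTree d} {p : Fin s → Fin d → ℝ} (hp : ∀ i, p i ∈ unitCube d)
    {A : Finset (Fin s)} (hA : A.Nonempty) {γ : ℝ} (hγ0 : 0 < γ) (hγ1 : γ ≤ 1)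
    (hbal : IsBalanced τ p A γ) {n : ℕ} {ε : ℝ} (hε : ε ≤ γ ^ (n + 1) / 3)
    (hdev : ∀ lo hi, |countIn p A (halfOpenBox lo hi) - A.card * F.real (halfOpenBox lo hi)| ≤
      A.card * ε) {x : Fin d → ℝ} (v : List Bool) (hv : v <+: τ.leafOf x) (hvn : v.length ≤ n) :
    ∃ lo hi : Fin d → ℝ,
      (∀ q ∈ unitCube d, v <+: τ.leafOf q ↔ ∀ k, q k ∈ Set.Ioc (lo k) (hi k)) ∧
      (∀ j, sideLength lo hi j ≤ (1 - γ * a / (2 * b)) ^ τ.splitCount j v) ∧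
      γ ^ v.length * A.card ≤ countIn p A (halfOpenBox lo hi) := by
  induction v using List.reverseRecOn with
  | nil =>
    -- The lower end `-1` makes the half-open root box contain the faces of the cube at `0`.
    refine ⟨fun _ => -1, fun _ => 1, fun q hq => ?_, fun j => ?_, ?_⟩
    · simp only [List.nil_prefix, true_iff]
      intro k
      have := mem_unitCube_iff.1 hq k
      exact ⟨by linarith [this.1], this.2⟩
    · rw [SplitTree.splitCount_nil, pow_zero, sideLength]
      refine (measureReal_mono Set.inter_subset_right (by simp)).trans ?_
      simp
    · have : ∀ i, p i ∈ halfOpenBox (fun _ : Fin d => (-1 : ℝ)) fun _ => 1 := fun i k _ => by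
        have := mem_unitCube_iff.1 (hp i) k
        exact ⟨by linarith [this.1], this.2⟩
      simp [countIn, this]
  | append_singleton v c ih =>
    rw [List.length_append, List.length_singleton] at hvn
    have hv' := (SplitTree.append_singleton_prefix_leafOf τ v c x).1 hv
    obtain ⟨j, hj, -⟩ := hv'.2
    obtain ⟨lo, hi, hbox, hlen, hcount⟩ := ih hv'.1 (by omega)
    obtain ⟨lo', hi', hbox', hne', hj'⟩ := SplitTree.exists_box_split hbox hj c
    -- The sibling is what shortens the child: balance gives the sibling enough points, hence enough
    -- volume, and its side is cut off from the parent's.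
    obtain ⟨lo'', hi'', hbox'', hne'', hj''⟩ := SplitTree.exists_box_split hbox hj (!c)
    have hnode : ∀ (w : List Bool) (l h : Fin d → ℝ),
        (∀ q ∈ unitCube d, w <+: τ.leafOf q ↔ ∀ k, q k ∈ Set.Ioc (l k) (h k)) →
        (nodeCount τ p A w : ℝ) = countIn p A (halfOpenBox l h) := fun w l h hw => by
      rw [nodeCount_eq_countIn]
      exact countIn_congr fun i => by simpa [halfOpenBox] using hw (p i) (hp i)
    have hsplit : τ.splitVar v ≠ none := by simp [hj]
    have hb' := hbal v hsplit c
    have hb'' := hbal v hsplit (!c)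
    rw [hnode v lo hi hbox, hnode _ lo' hi' hbox'] at hb'
    rw [hnode v lo hi hbox, hnode _ lo'' hi'' hbox''] at hb''
    refine ⟨lo', hi', hbox', fun k => ?_, ?_⟩
    · rw [SplitTree.splitCount_append_singleton, hj]
      by_cases hk : k = j
      swap
      · rw [if_neg (by simpa using fun h : j = k => hk h.symm), add_zero]
        have : sideLength lo' hi' k = sideLength lo hi k := by
          simp only [sideLength, (hne' k hk).1, (hne' k hk).2]
        exact this ▸ hlen k
      subst hk
      rw [if_pos rfl, pow_succ]
      have hA0 : (0 : ℝ) < A.card := by exact_mod_cast hA.card_pos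
      set N := countIn p A (halfOpenBox lo hi)
      set N'' := countIn p A (halfOpenBox lo'' hi'')
      have hd := abs_le.1 (hdev lo hi)
      have hd'' := abs_le.1 (hdev lo'' hi'')
      have hγn : γ ^ n ≤ γ ^ v.length := pow_le_pow_of_le_one hγ0.le hγ1 (by omega)
      have hγ1n : γ ^ (n + 1) = γ ^ n * γ := pow_succ γ n
      have hγpos : 0 < γ ^ n := pow_pos hγ0 n
      have hn : ∃ r, N = A.card * r := ⟨N / A.card, by field_simp⟩
      obtain ⟨r, hr⟩ := hn
      have hr1 : γ ^ n ≤ r := by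
        rw [hr, mul_comm] at hcount
        exact hγn.trans (le_of_mul_le_mul_left hcount hA0)
      have hr2 : F.real (halfOpenBox lo hi) - ε ≤ r := by
        refine le_of_mul_le_mul_left ?_ hA0
        linarith [hd.1, hr, mul_sub (A.card : ℝ) (F.real (halfOpenBox lo hi)) ε]
      have hr3 : r - ε ≤ F.real (halfOpenBox lo hi) := by
        refine le_of_mul_le_mul_left ?_ hA0
        linarith [hd.2, hr, mul_sub (A.card : ℝ) r ε]
      have hr4 : γ * r - ε ≤ F.real (halfOpenBox lo'' hi'') := by
        refine le_of_mul_le_mul_left ?_ hA0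
        rw [hr] at hb''
        linarith [hd''.2, mul_sub (A.card : ℝ) (γ * r) ε, mul_left_comm γ (A.card : ℝ) r]
      have hFpos : 0 < F.real (halfOpenBox lo hi) := by nlinarith
      -- With `F ≤ r + ε` and `γ r - ε ≤ F''` it suffices that `ε (1 + γ / 2) ≤ γ r / 2`. This
      -- follows from `r ≥ γ ^ n`, `γ ≤ 1` and `ε ≤ γ ^ (n + 1) / 3`, where the factor `1 / 3` is
      -- just small enough.
      have hF : γ / 2 * F.real (halfOpenBox lo hi) ≤ F.real (halfOpenBox lo'' hi'') := by
        nlinarith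
      have h1 := ha _ (measurableSet_halfOpenBox lo hi)
      have h2 := hb _ (measurableSet_halfOpenBox lo hi)
      have h3 := hb _ (measurableSet_halfOpenBox lo'' hi'')
      rw [volume_real_halfOpenBox, ← Finset.mul_prod_erase _ _ (Finset.mem_univ k)] at h1 h2 h3
      have hrest : ∏ i ∈ Finset.univ.erase k, sideLength lo'' hi'' i =
          ∏ i ∈ Finset.univ.erase k, sideLength lo hi i := by
        refine Finset.prod_congr rfl fun i hi => ?_
        have hi := Finset.ne_of_mem_erase hi
        simp only [sideLength, (hne'' i hi).1, (hne'' i hi).2]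
      rw [hrest] at h3
      have hadd := sideLength_add_of_split hj' hj''
      set ρ := ∏ i ∈ Finset.univ.erase k, sideLength lo hi i
      set ℓ := sideLength lo hi k
      set ℓ'' := sideLength lo'' hi'' k
      have hb0 : 0 < b := ha0.trans_le hab
      have hρ0 : 0 ≤ ρ := Finset.prod_nonneg fun i _ => sideLength_nonneg _ _ _
      have hρ : 0 < ρ := by
        refine hρ0.lt_of_ne fun h => ?_
        rw [← h] at h2
        simp at h2
        linarith
      -- Parent and sibling agree in all sides but `k`, so the common product `ρ` cancels. Passing
      -- between mass and volume costs the factor `a / b`.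
      have hl : γ * a / (2 * b) * ℓ ≤ ℓ'' := by
        have : γ / 2 * (a * ℓ) * ρ ≤ b * ℓ'' * ρ := by nlinarith
        have := le_of_mul_le_mul_right this hρ
        rw [div_mul_eq_mul_div, div_le_iff₀ (by positivity)]
        linarith
      have hc : 0 ≤ 1 - γ * a / (2 * b) := by
        rw [sub_nonneg, div_le_one (by positivity)]
        nlinarith
      have : sideLength lo' hi' k ≤ ℓ * (1 - γ * a / (2 * b)) := by linarith
      exact this.trans (mul_le_mul_of_nonneg_right (hlen k) hc)
    · rw [List.length_append, List.length_singleton, pow_succ]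
      nlinarith

/-- If the counts are well approximated by their expected values, then the prediction point that
shares the leaf of `x` is close to `x`. -/
theorem abs_sub_le_of_isBalanced (ha0 : 0 < a) (hab : a ≤ b)
    (ha : ∀ B, MeasurableSet B → a * volume.real (B ∩ unitCube d) ≤ F.real B)
    (hb : ∀ B, MeasurableSet B → F.real B ≤ b * volume.real (B ∩ unitCube d))
    {τ : SplitTree d} {p : Fin s → Fin d → ℝ} (hp : ∀ i, p i ∈ unitCube d)
    {A P : Finset (Fin s)} (hA : A.Nonempty) {γ : ℝ} (hγ0 : 0 < γ) (hγ1 : γ ≤ 1)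
    (hbal : IsBalanced τ p A γ) {n : ℕ} {ε : ℝ} (hε : ε ≤ γ ^ (n + 1) / 3)
    (hdev : ∀ lo hi, |countIn p A (halfOpenBox lo hi) - A.card * F.real (halfOpenBox lo hi)| ≤
      A.card * ε)
    (hdevP : ∀ lo hi, |countIn p P (halfOpenBox lo hi) - P.card * F.real (halfOpenBox lo hi)| ≤
      P.card * ε)
    (hPn : 3 < γ ^ n * P.card) {x : Fin d → ℝ} (hx : x ∈ unitCube d)
    (huniq : ∃! i, i ∈ P ∧ τ.leafOf (p i) = τ.leafOf x) :
    n ≤ (τ.leafOf x).length ∧ ∀ i, τ.leafOf (p i) = τ.leafOf x → ∀ j,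
      |p i j - x j| ≤ (1 - γ * a / (2 * b)) ^ τ.splitCount j ((τ.leafOf x).take n) := by
  classical
  have hγ1n : γ ^ (n + 1) ≤ γ ^ n := pow_le_pow_of_le_one hγ0.le hγ1 n.le_succ
  have hdepth : n ≤ (τ.leafOf x).length := by
    -- A shallower leaf would contain at least a fraction `γ ^ n` of `A`, hence have mass at least
    -- `γ ^ n - ε`, hence contain at least `γ ^ n / 3 * P.card > 1` prediction points. The detour
    -- through `F` is needed because balance may refer to other points than `P`.
    by_contra hlt
    obtain ⟨lo, hi, hbox, -, hcount⟩ := exists_box_of_isBalanced ha0 hab ha hb hp hA hγ0 hγ1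
      hbal hε hdev (τ.leafOf x) List.prefix_rfl (by omega)
    have hle : countIn p P (halfOpenBox lo hi) ≤ 1 := by
      obtain ⟨i, -, hi'⟩ := huniq
      have hnone := ((τ.leafOf_eq_iff (τ.leafOf x) x).1 rfl).2
      calc _ ≤ ∑ k ∈ P, if k = i then (1 : ℝ) else 0 := by
            refine Finset.sum_le_sum fun k hk => ?_
            by_cases h : p k ∈ halfOpenBox lo hi
            · have h1 := (hbox (p k) (hp k)).2 (by simpa [halfOpenBox] using h)
              rw [if_pos (hi' k ⟨hk, (τ.leafOf_eq_iff _ _).2 ⟨h1, hnone⟩⟩)]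
              simp [h]
            · rw [Set.indicator_of_notMem h]
              split_ifs <;> norm_num
        _ ≤ 1 := by
            rw [Finset.sum_ite_eq']
            split_ifs <;> norm_num
    have hA0 : (0 : ℝ) < A.card := by exact_mod_cast hA.card_pos
    have hγn : γ ^ n ≤ γ ^ (τ.leafOf x).length := pow_le_pow_of_le_one hγ0.le hγ1 (by omega)
    have hd := abs_le.1 (hdev lo hi)
    have hdP := abs_le.1 (hdevP lo hi)
    have h1 : γ ^ n - ε ≤ F.real (halfOpenBox lo hi) := by
      refine le_of_mul_le_mul_left ?_ hA0
      nlinarith [hd.2]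
    have hP0 : (0 : ℝ) ≤ P.card := Nat.cast_nonneg _
    have h2 : γ ^ n / 3 ≤ F.real (halfOpenBox lo hi) - ε := by linarith
    nlinarith [mul_le_mul_of_nonneg_left h2 hP0, hdP.1]
  refine ⟨hdepth, fun i hi j => ?_⟩
  have hpre := List.take_prefix n (τ.leafOf x)
  obtain ⟨lo, hi', hbox, hlen, -⟩ := exists_box_of_isBalanced ha0 hab ha hb hp hA hγ0 hγ1
    hbal hε hdev _ hpre (by simp)
  exact (abs_sub_le_sideLength ((hbox (p i) (hp i)).1 (hi ▸ hpre) j) ((hbox x hx).1 hpre j)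
    (mem_unitCube_iff.1 (hp i) j) (mem_unitCube_iff.1 hx j)).trans (hlen j)

end Contraction

/-! ### The sample -/

section Sample

variable {Ω : Type*} [mΩ : MeasurableSpace Ω] {μ : Measure Ω} {d s : ℕ}
  {f : (Fin d → ℝ) → ℝ} {κ : Kernel (Fin d → ℝ) ℝ}
  {X : Fin s → Ω → (Fin d → ℝ)} {Y : Fin s → Ω → ℝ}

theorem IsSample.map_X [IsMarkovKernel κ] (hf : IsBoundedDensity f) (h : IsSample μ f κ X Y)
    (i : Fin s) : μ.map (X i) = featureLaw f := by
  have := hf.isProbabilityMeasure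
  have h1 : (μ.map fun ω => (X i ω, Y i ω)).map Prod.fst = μ.map (X i) :=
    Measure.map_map measurable_fst ((h.measurable_X i).prodMk (h.measurable_Y i))
  rw [← h1, h.law]
  exact Measure.fst_compProd _ _

theorem IsSample.indep_X (h : IsSample μ f κ X Y) : iIndepFun X μ :=
  h.indep.comp (fun _ => Prod.fst) fun _ => measurable_fst

theorem IsSample.ae_mem_unitCube [IsMarkovKernel κ] (hf : IsBoundedDensity f)
    (h : IsSample μ f κ X Y) : ∀ᵐ ω ∂μ, ∀ i, X i ω ∈ unitCube d := by
  refine ae_all_iff.2 fun i => ?_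
  refine ae_of_ae_map (h.measurable_X i).aemeasurable (p := fun u => u ∈ unitCube d) ?_
  rw [h.map_X hf]
  have := compl_mem_ae_iff.2 (featureLaw_compl_unitCube f)
  rwa [compl_compl] at this

end Sample

/-! ### The selected point is close to the test point -/

section Shrinkage

variable {Ω : Type*} [mΩ : MeasurableSpace Ω] {μ : Measure Ω} [IsProbabilityMeasure μ] {d s : ℕ}
  {f : (Fin d → ℝ) → ℝ} {κ : Kernel (Fin d → ℝ) ℝ} [IsMarkovKernel κ]
  {X : Fin s → Ω → (Fin d → ℝ)} {Y : Fin s → Ω → ℝ}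

/-- The counts of the sample points with index in `Q` deviate from their expected values in some
box by more than a fraction `ε`. -/
def boxDeviation (f : (Fin d → ℝ) → ℝ) (p : Fin s → Fin d → ℝ) (Q : Finset (Fin s)) (ε : ℝ) :
    Prop :=
  ∃ lo hi, Q.card * ε <
    |countIn p Q (halfOpenBox lo hi) - Q.card * (featureLaw f).real (halfOpenBox lo hi)|

theorem measure_boxDeviation_le (hf : IsBoundedDensity f) {b : ℝ} (hb0 : 0 ≤ b)
    (hb : ∀ u ∈ unitCube d, f u ≤ b) (hs : 0 < s) (hXY : IsSample μ f κ X Y)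
    {Q : Ω → Finset (Fin s)} (hQ : ∀ R, MeasurableSet {ω | Q ω = R})
    (hQX : Indep (MeasurableSpace.comap Q ⊤)
      (MeasurableSpace.comap (fun ω i => (X i ω, Y i ω)) inferInstance) μ)
    (hcard : ∀ᵐ ω ∂μ, (s : ℝ) / 2 ≤ (Q ω).card) {ε : ℝ} (hε0 : 0 < ε) (hε1 : ε ≤ 1) :
    μ {ω | boxDeviation f (fun i => X i ω) (Q ω) ε} ≤
      ENNReal.ofReal (16 * (8 * d * b + 3) ^ (3 * d) * (1 / ε) ^ (3 * d + 2) / s) := by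
  have := hf.isProbabilityMeasure
  -- This `M` makes the boundary layer contribute at most half of the allowed deviation.
  set M := ⌈8 * d * b / ε⌉₊ + 1 with hMdef
  have hM : 0 < M := Nat.succ_pos _
  have hM1 : 8 * d * b / ε ≤ M := by
    rw [hMdef]; push_cast; linarith [Nat.le_ceil (8 * d * b / ε)]
  have hs' : (0 : ℝ) < s := by exact_mod_cast hs
  have hcard1 : (1 : ℝ) ≤ (M : ℝ) + 1 := by linarith [(Nat.cast_nonneg M : (0 : ℝ) ≤ M)]
  have hpos : (0 : ℝ) < ((M : ℝ) + 1) ^ d := by positivity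
  -- Over all cells this adds up to `ε * s / 4`, the other half of the allowed deviation, because
  -- the index set has at least `s / 2` elements.
  set t := ε * s / (4 * ((M : ℝ) + 1) ^ d) with ht
  have ht0 : 0 < t := by positivity
  have hcells : (Fintype.card (Fin d → Fin (M + 1)) : ℝ) = ((M : ℝ) + 1) ^ d := by simp
  have hind : Indep (MeasurableSpace.comap Q ⊤)
      (MeasurableSpace.comap (fun ω i => X i ω) inferInstance) μ := by
    refine indep_of_indep_of_le_right hQX ?_
    have hm : Measurable fun (z : Fin s → (Fin d → ℝ) × ℝ) i => (z i).1 := by fun_prop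
    rintro _ ⟨B, hB, rfl⟩
    exact ⟨_, hm hB, rfl⟩
  have key := measure_exists_abs_countIn_sub_gt_le hXY.measurable_X (fun i => hXY.map_X hf i)
    hXY.indep_X hQ hind (measurable_gridIndex M) ht0
  have hsub : μ {ω | boxDeviation f (fun i => X i ω) (Q ω) ε} ≤
      μ {ω | ∃ S : Set (Fin d → Fin (M + 1)), Fintype.card (Fin d → Fin (M + 1)) * t <
        |countIn (fun i => X i ω) (Q ω) (gridIndex M ⁻¹' S) -
          (Q ω).card * (featureLaw f).real (gridIndex M ⁻¹' S)|} := by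
    refine measure_mono_ae ?_
    filter_upwards [hcard, hXY.ae_mem_unitCube hf] with ω h1 h2
    rintro ⟨lo, hi, hdev⟩
    by_contra hno
    have hno : ∀ S : Set (Fin d → Fin (M + 1)), |countIn (fun i => X i ω) (Q ω) (gridIndex M ⁻¹' S) -
          (Q ω).card * (featureLaw f).real (gridIndex M ⁻¹' S)| ≤
          Fintype.card (Fin d → Fin (M + 1)) * t := fun S => not_lt.1 fun h => hno ⟨S, h⟩
    have := abs_countIn_halfOpenBox_sub_le (featureLaw_compl_unitCube f) hb0
      (fun B hB => featureLaw_real_le hb0 hb hB) h2 hM hno lo hi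
    refine absurd hdev (not_lt.2 (this.trans ?_))
    rw [hcells, ht]
    have e1 : ((M : ℝ) + 1) ^ d * (ε * s / (4 * ((M : ℝ) + 1) ^ d)) = ε * s / 4 := by
      field_simp
    have e2 : 4 * d * b / M ≤ ε / 2 := by
      rw [div_le_iff₀ hε0] at hM1
      rw [div_le_iff₀ (by exact_mod_cast hM)]
      linarith
    rw [e1]
    nlinarith [mul_le_mul_of_nonneg_left e2 (Nat.cast_nonneg (Q ω).card : (0 : ℝ) ≤ _)]
  refine hsub.trans (key.trans (ENNReal.ofReal_le_ofReal ?_))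
  rw [hcells, ht]
  have e3 : ((M : ℝ) + 1) ^ d * (s / (ε * s / (4 * ((M : ℝ) + 1) ^ d)) ^ 2) =
      16 * ((M : ℝ) + 1) ^ (3 * d) * (1 / ε) ^ 2 / s := by
    rw [pow_mul', pow_succ _ 2]
    field_simp
    ring
  have e4 : (M : ℝ) + 1 ≤ (8 * d * b + 3) * (1 / ε) := by
    have h1 := Nat.ceil_lt_add_one (show 0 ≤ 8 * d * b / ε by positivity)
    have h2 : (1 : ℝ) ≤ 1 / ε := by rw [le_div_iff₀ hε0]; linarith
    rw [hMdef]
    push_cast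
    have h3 : (8 * d * b + 3) * (1 / ε) = 8 * d * b / ε + 3 * (1 / ε) := by ring
    linarith
  have e5 := pow_le_pow_left₀ (by positivity) e4 (3 * d)
  rw [mul_pow] at e5
  calc _ = 16 * ((M : ℝ) + 1) ^ (3 * d) * (1 / ε) ^ 2 / s := e3
    _ ≤ 16 * ((8 * d * b + 3) ^ (3 * d) * (1 / ε) ^ (3 * d)) * (1 / ε) ^ 2 / s := by gcongr
    _ = _ := by rw [pow_add]; ring

theorem IsBalanced.mono {τ : SplitTree d} {p : Fin s → Fin d → ℝ} {Q : Finset (Fin s)} {γ γ' : ℝ}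
    (h : IsBalanced τ p Q γ) (hγ : γ' ≤ γ) : IsBalanced τ p Q γ' := fun v hv c =>
  (mul_le_mul_of_nonneg_right hγ (Nat.cast_nonneg _)).trans (h v hv c)

/-- If exactly one index is selected, then a sum over the selected indices has one term. -/
theorem exists_sum_indicator_selected {M Ω : Type*} [AddCommMonoid M] {X : Fin s → Ω → Fin d → ℝ}
    {τ : Ω → SplitTree d} {P : Ω → Finset (Fin s)} {x : Fin d → ℝ} {ω : Ω}
    (h : ∃! i, i ∈ P ω ∧ (τ ω).leafOf (X i ω) = (τ ω).leafOf x) :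
    ∃ i, ω ∈ selected X τ P x i ∧ ∀ g : Fin s → Ω → M,
      ∑ k, (selected X τ P x k).indicator (g k) ω = g i ω := by
  obtain ⟨i, hi, hi'⟩ := h
  have hsel : ω ∈ selected X τ P x i := hi
  refine ⟨i, hsel, fun g => ?_⟩
  rw [Finset.sum_eq_single i, Set.indicator_of_mem hsel]
  · intro k _ hk
    have : ω ∉ selected X τ P x k := fun h => hk (hi' k h)
    exact Set.indicator_of_notMem this _
  · simp

/-- In a regular tree, the selected point is close to the test point in every coordinate. -/
theorem sum_lintegral_abs_sub_le (hf : IsBoundedDensity f) {a b : ℝ} (ha0 : 0 < a) (hab : a ≤ b)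
    (ha : ∀ u ∈ unitCube d, a ≤ f u) (hb : ∀ u ∈ unitCube d, f u ≤ b) (hs : 0 < s)
    (hXY : IsSample μ f κ X Y) {τ : Ω → SplitTree d} {P : Ω → Finset (Fin s)} {π γ : ℝ}
    (hπ0 : 0 ≤ π) (hπ1 : π ≤ 1) (hγ0 : 0 < γ) (hγ1 : γ ≤ 1)
    (hreg : IsRegularTree μ X Y τ P π γ) {x : Fin d → ℝ} (hx : x ∈ unitCube d) {n : ℕ}
    (hn : 6 < γ ^ n * s) (j : Fin d) :
    ∑ i, ∫⁻ ω in selected X τ P x i, ENNReal.ofReal |X i ω j - x j| ∂μ ≤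
      ENNReal.ofReal ((1 - π * (γ * a / (2 * b))) ^ n) +
        2 * ENNReal.ofReal
          (16 * (8 * d * b + 3) ^ (3 * d) * (1 / (γ ^ (n + 1) / 3)) ^ (3 * d + 2) / s) := by
  have hb0 : 0 < b := ha0.trans_le hab
  have := hf.isProbabilityMeasure
  have hs' : (0 : ℝ) < s := by exact_mod_cast hs
  set ε := γ ^ (n + 1) / 3 with hε
  have hε0 : 0 < ε := by positivity
  have hε1 : ε ≤ 1 := by
    have := pow_le_one₀ (n := n + 1) hγ0.le hγ1
    rw [hε]; linarith
  set δ := ENNReal.ofReal (16 * (8 * d * b + 3) ^ (3 * d) * (1 / ε) ^ (3 * d + 2) / s)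
  set θ := 1 - γ * a / (2 * b) with hθ
  have hθ0 : 0 ≤ θ := by
    rw [hθ, sub_nonneg, div_le_one (by positivity)]
    nlinarith
  have hθ1 : θ ≤ 1 := by
    have : 0 ≤ γ * a / (2 * b) := by positivity
    linarith
  -- `A` is the set of available examples. Both readings of the balance condition give a set that is
  -- independent of the sample and has at least `s / 2` elements, so they are treated together.
  obtain ⟨A, hAm, hAi, hAc, hAb⟩ : ∃ A : Ω → Finset (Fin s), (∀ R, MeasurableSet {ω | A ω = R}) ∧
      Indep (MeasurableSpace.comap A ⊤)
        (MeasurableSpace.comap (fun ω i => (X i ω, Y i ω)) inferInstance) μ ∧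
      (∀ᵐ ω ∂μ, (s : ℝ) / 2 ≤ (A ω).card) ∧
      ∀ᵐ ω ∂μ, IsBalanced (τ ω) (fun i => X i ω) (A ω) γ := by
    rcases hreg.balanced with h | h
    · refine ⟨fun _ => Finset.univ, fun R => .const _, ?_, ae_of_all _ fun ω => ?_, h⟩
      · rw [MeasurableSpace.comap_const]
        exact indep_bot_left _
      · simp only [Finset.card_univ, Fintype.card_fin]
        linarith
    · exact ⟨P, hreg.measurable_pred, hreg.pred_indep, hreg.pred_card, h⟩
  let B : Set Ω := {ω | boxDeviation f (fun i => X i ω) (A ω) ε} ∪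
    {ω | boxDeviation f (fun i => X i ω) (P ω) ε}
  have hB : μ B ≤ 2 * δ := by
    refine (measure_union_le _ _).trans ?_
    rw [two_mul]
    exact add_le_add (measure_boxDeviation_le hf hb0.le hb hs hXY hAm hAi hAc hε0 hε1)
      (measure_boxDeviation_le hf hb0.le hb hs hXY hreg.measurable_pred hreg.pred_indep
        hreg.pred_card hε0 hε1)
  have hsel := fun i => measurableSet_selected hXY.measurable_X hreg.measurable_tree
    hreg.measurable_pred x i
  have hmeas : ∀ i, Measurable fun ω => ENNReal.ofReal |X i ω j - x j| := fun i =>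
    (((measurable_pi_apply j).comp (hXY.measurable_X i)).sub_const (x j)).abs.ennreal_ofReal
  calc _ = ∫⁻ ω, ∑ i, (selected X τ P x i).indicator
          (fun ω => ENNReal.ofReal |X i ω j - x j|) ω ∂μ := by
        rw [lintegral_finsetSum _ fun i _ => (hmeas i).indicator (hsel i)]
        exact Finset.sum_congr rfl fun i _ => (lintegral_indicator (hsel i) _).symm
    -- On the bad event `B` the distance is at most one; off it the side length bound applies.
    -- Deviation over all boxes is an uncountable union, so a measurable hull replaces `B`.
    _ ≤ ∫⁻ ω, pathWeight (τ ω) x j θ n + (toMeasurable μ B).indicator (1 : Ω → ℝ≥0∞) ω ∂μ := by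
        refine lintegral_mono_ae ?_
        filter_upwards [hXY.ae_mem_unitCube hf, hreg.fully_grown, hreg.pred_card, hAc, hAb]
          with ω hcube huniq hPc hAc hAb
        obtain ⟨i, hi, hsum⟩ := exists_sum_indicator_selected (M := ℝ≥0∞) (huniq x hx)
        · rw [hsum]
          by_cases hωB : ω ∈ B
          · rw [Set.indicator_of_mem (subset_toMeasurable μ B hωB)]
            refine le_add_left (ENNReal.ofReal_le_one.2 ?_)
            have h1 := mem_unitCube_iff.1 (hcube i) j
            have h2 := mem_unitCube_iff.1 hx j
            rw [abs_le]
            constructor <;> linarith [h1.1, h1.2, h2.1, h2.2]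
          · simp only [B, Set.mem_union, Set.mem_ofPred_eq, boxDeviation, not_or, not_exists,
              not_lt] at hωB
            have hAne : (A ω).Nonempty := by
              rw [← Finset.card_pos]
              have : (0 : ℝ) < (A ω).card := by linarith
              exact_mod_cast this
            have hPn : 3 < γ ^ n * (P ω).card := by
              nlinarith [mul_le_mul_of_nonneg_left hPc ((pow_pos hγ0 n).le)]
            obtain ⟨hd, hle⟩ := abs_sub_le_of_isBalanced ha0 hab
              (fun B hB => hf.le_real_featureLaw ha0.le ha hB)
              (fun B hB => featureLaw_real_le hb0.le hb hB) hcube hAne hγ0 hγ1 hAb le_rfl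
              hωB.1 hωB.2 hPn hx (huniq x hx)
            refine le_add_right ?_
            rw [pathWeight, if_pos hd, ← ENNReal.ofReal_pow hθ0]
            exact ENNReal.ofReal_le_ofReal (hle i hi.2 j)
    _ = ∫⁻ ω, pathWeight (τ ω) x j θ n ∂μ + μ B := by
        rw [lintegral_add_right _ (measurable_one.indicator (measurableSet_toMeasurable μ B)),
          lintegral_indicator_one (measurableSet_toMeasurable μ B), measure_toMeasurable]
    _ ≤ _ := by
        refine add_le_add ?_ hB
        have hρ : 0 ≤ 1 - π * (γ * a / (2 * b)) := by nlinarith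
        rw [ENNReal.ofReal_pow hρ]
        have := lintegral_pathWeight_le (x := x) μ hreg.measurable_tree j hπ0 hπ1 hθ0 hθ1
          (fun v E hE => hreg.split_prob v j E hE) n
        rwa [hθ, sub_sub_cancel] at this

end Shrinkage

/-! ### Potential nearest neighbours -/

section Volume

/-- The volume of the box spanned by two points. -/
def spannedVolume {d : ℕ} (x u : Fin d → ℝ) : ℝ := ∏ j, |u j - x j|

theorem continuous_spannedVolume {d : ℕ} (x : Fin d → ℝ) : Continuous (spannedVolume x) := by
  unfold spannedVolume
  fun_prop

/-- After translating `c` to the origin the domain lies in `[-1, 1]`, and each half of that interval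
contributes `1 / (1 - l)`. -/
theorem lintegral_Icc_abs_sub_rpow_le (c : ℝ) (hc : c ∈ Set.Icc (0 : ℝ) 1) {l : ℝ} (hl1 : l < 1) :
    ∫⁻ t in Set.Icc (0 : ℝ) 1, ENNReal.ofReal |t - c| ^ (-l) ≤ ENNReal.ofReal (2 / (1 - l)) := by
  let g : ℝ → ℝ≥0∞ := fun t => ENNReal.ofReal |t| ^ (-l)
  have hg : Measurable g := by fun_prop
  have hpos : ∫⁻ t in Set.Ioc (0 : ℝ) 1, g t = ENNReal.ofReal (1 / (1 - l)) := by
    have h1 : ∫⁻ t in Set.Ioc (0 : ℝ) 1, g t = ∫⁻ t in Set.Ioc (0 : ℝ) 1, ENNReal.ofReal (t ^ (-l)) := by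
      refine setLIntegral_congr_fun measurableSet_Ioc fun t ht => ?_
      simp only [g]
      rw [abs_of_pos ht.1, ENNReal.ofReal_rpow_of_pos ht.1]
    have hint := (intervalIntegral.intervalIntegrable_rpow' (a := 0) (b := 1)
      (show -1 < -l by linarith))
    rw [intervalIntegrable_iff_integrableOn_Ioc_of_le zero_le_one] at hint
    rw [h1, ← ofReal_integral_eq_lintegral_ofReal hint]
    · rw [← intervalIntegral.integral_of_le zero_le_one, integral_rpow (Or.inl (by linarith)),
        Real.one_rpow, Real.zero_rpow (by linarith), sub_zero, neg_add_eq_sub]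
    · exact (ae_restrict_iff' measurableSet_Ioc).2
        (ae_of_all _ fun t ht => Real.rpow_nonneg ht.1.le _)
  have hneg : ∫⁻ t in Set.Ico (-1 : ℝ) 0, g t = ∫⁻ t in Set.Ioc (0 : ℝ) 1, g t := by
    rw [← lintegral_indicator measurableSet_Ico, ← lintegral_indicator measurableSet_Ioc,
      ← lintegral_neg_eq_self]
    refine lintegral_congr fun t => ?_
    simp only [Set.indicator_apply, Set.mem_Ico, Set.mem_Ioc, g, abs_neg]
    congr 1
    refine propext ⟨fun h => ⟨by linarith [h.2], by linarith [h.1]⟩,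
      fun h => ⟨by linarith [h.2], by linarith [h.1]⟩⟩
  calc ∫⁻ t in Set.Icc (0 : ℝ) 1, g (t - c)
      = ∫⁻ t, (Set.Icc (0 - c) (1 - c)).indicator g (t - c) := by
        rw [← lintegral_indicator measurableSet_Icc]
        refine lintegral_congr fun t => ?_
        simp only [Set.indicator_apply, Set.mem_Icc]
        congr 1
        refine propext ⟨fun h => ⟨by linarith [h.1], by linarith [h.2]⟩,
          fun h => ⟨by linarith [h.1], by linarith [h.2]⟩⟩
    _ = ∫⁻ t in Set.Icc (0 - c) (1 - c), g t := by
        rw [lintegral_sub_right_eq_self, lintegral_indicator measurableSet_Icc]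
    _ ≤ ∫⁻ t in Set.Ico (-1 : ℝ) 0 ∪ ({0} ∪ Set.Ioc 0 1), g t := by
        refine lintegral_mono_set fun t ht => ?_
        rcases lt_trichotomy t 0 with h | h | h
        · exact Or.inl ⟨by linarith [ht.1, hc.2], h⟩
        · exact Or.inr (Or.inl h)
        · exact Or.inr (Or.inr ⟨h, by linarith [ht.2, hc.1]⟩)
    _ ≤ (∫⁻ t in Set.Ico (-1 : ℝ) 0, g t) +
          ((∫⁻ t in ({0} : Set ℝ), g t) + ∫⁻ t in Set.Ioc (0 : ℝ) 1, g t) :=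
        (lintegral_union_le _ _ _).trans (add_le_add le_rfl (lintegral_union_le _ _ _))
    _ = ENNReal.ofReal (2 / (1 - l)) := by
        have h0 : 0 ≤ 1 / (1 - l) := div_nonneg zero_le_one (by linarith)
        rw [hneg, hpos, setLIntegral_measure_zero _ _ (by simp), zero_add,
          ← ENNReal.ofReal_add h0 h0]
        congr 1; ring

theorem lintegral_unitCube_prod_le {m : ℕ} (x : Fin m → ℝ) (hx : x ∈ unitCube m) {l : ℝ}
    (hl1 : l < 1) :
    ∫⁻ u in unitCube m, ∏ j, ENNReal.ofReal |u j - x j| ^ (-l) ≤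
      ENNReal.ofReal (2 / (1 - l)) ^ m := by
  let ν : Measure ℝ := volume.restrict (Set.Icc 0 1)
  have hν : IsProbabilityMeasure ν := ⟨by simp [ν]⟩
  have hrestrict : (volume : Measure (Fin m → ℝ)).restrict (unitCube m) = Measure.pi fun _ => ν := by
    rw [unitCube_eq_pi, volume_pi, Measure.restrict_pi_pi]
  have hg : ∀ j, Measurable fun t : ℝ => ENNReal.ofReal |t - x j| ^ (-l) := fun j => by fun_prop
  have hind := iIndepFun_pi (μ := fun _ : Fin m => ν)
    (X := fun j t => ENNReal.ofReal |t - x j| ^ (-l)) fun j => (hg j).aemeasurable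
  rw [hrestrict, lintegral_prod_eq_prod_lintegral_of_indepFun Finset.univ _ hind
    fun j => (hg j).comp (measurable_pi_apply j)]
  calc _ = ∏ j, ∫⁻ t, ENNReal.ofReal |t - x j| ^ (-l) ∂ν := by
        refine Finset.prod_congr rfl fun j _ => ?_
        exact (measurePreserving_eval (fun _ : Fin m => ν) j).lintegral_comp (hg j)
    _ ≤ ∏ j : Fin m, ENNReal.ofReal (2 / (1 - l)) := Finset.prod_le_prod' fun j _ =>
        lintegral_Icc_abs_sub_rpow_le (x j) (mem_unitCube_iff.1 hx j) hl1
    _ = _ := by simp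

/-- Interpolation between the bounds `1` and `2 * v / w`. The power `l < 1` of `1 / w` is integrable
when `w` is the product of the remaining distances, whereas `1 / w` is not. -/
theorem volume_Icc_inter_abs_mul_le {c v w : ℝ} (hv : 0 < v) (hw : 0 ≤ w) {l : ℝ} (hl0 : 0 < l)
    (hl1 : l < 1) :
    volume (Set.Icc (0 : ℝ) 1 ∩ {t | |t - c| * w ≤ v}) ≤
      ENNReal.ofReal (2 * v) ^ l * ENNReal.ofReal w ^ (-l) := by
  rcases hw.eq_or_lt with rfl | hw
  · rw [ENNReal.ofReal_zero, ENNReal.zero_rpow_of_neg (by linarith), ENNReal.mul_top]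
    · exact le_top
    · exact (ENNReal.rpow_pos (by simpa using hv) ENNReal.ofReal_ne_top).ne'
  set V := volume (Set.Icc (0 : ℝ) 1 ∩ {t | |t - c| * w ≤ v})
  have h1 : V ≤ 1 := (measure_mono Set.inter_subset_left).trans (by simp)
  have h2 : V ≤ ENNReal.ofReal (2 * v / w) := by
    refine (measure_mono (t := Set.Icc (c - v / w) (c + v / w)) ?_).trans ?_
    · rintro t ⟨-, ht⟩
      have : |t - c| ≤ v / w := by rwa [le_div_iff₀ hw]
      have := abs_le.1 this
      exact ⟨by linarith, by linarith⟩
    · rw [Real.volume_Icc]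
      exact ENNReal.ofReal_le_ofReal (le_of_eq (by ring))
  calc V = V ^ l * V ^ (1 - l) := by
        rw [← ENNReal.rpow_add_of_nonneg _ _ hl0.le (by linarith), add_sub_cancel, ENNReal.rpow_one]
    _ ≤ ENNReal.ofReal (2 * v / w) ^ l * 1 := by
        gcongr
        exact ENNReal.rpow_le_one h1 (by linarith)
    _ = _ := by
        rw [mul_one, ENNReal.ofReal_div_of_pos hw, ENNReal.div_rpow_of_nonneg _ _ hl0.le,
          ENNReal.rpow_neg, div_eq_mul_inv]

/-- The points that span with `x` a box of volume at most `v` have small volume. -/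
theorem volume_spannedVolume_le {m : ℕ} {x : Fin (m + 1) → ℝ} (hx : x ∈ unitCube (m + 1)) {v : ℝ}
    (hv : 0 < v) {l : ℝ} (hl0 : 0 < l) (hl1 : l < 1) :
    volume (unitCube (m + 1) ∩ {u | spannedVolume x u ≤ v}) ≤
      ENNReal.ofReal (2 * v) ^ l * ENNReal.ofReal (2 / (1 - l)) ^ m := by
  set S := unitCube (m + 1) ∩ {u | spannedVolume x u ≤ v}
  have hS : MeasurableSet S := (measurableSet_unitCube _).inter
    (measurableSet_le (continuous_spannedVolume x).measurable measurable_const)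
  have hx' : (fun j : Fin m => x j.succ) ∈ unitCube m :=
    mem_unitCube_iff.2 fun j => mem_unitCube_iff.1 hx j.succ
  -- Coordinate `0` is split off and bounded slice by slice, so only the other `m` coordinates
  -- contribute a factor `2 / (1 - l)`. With `1 - l` equal to `1 / log s`, this is where the power
  -- `d - 1` of the logarithm arises.
  have e := (volume_preserving_piFinSuccAbove (fun _ : Fin (m + 1) => ℝ) 0).symm
  rw [← e.measure_preimage hS.nullMeasurableSet, Measure.volume_eq_prod,
    Measure.prod_apply_symm (e.measurable hS)]
  calc _ ≤ ∫⁻ u, (unitCube m).indicator (fun u => ENNReal.ofReal (2 * v) ^ l *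
          ∏ j, ENNReal.ofReal |u j - x j.succ| ^ (-l)) u := by
        refine lintegral_mono fun u => ?_
        have hmem : ∀ t : ℝ, (MeasurableEquiv.piFinSuccAbove (fun _ : Fin (m + 1) => ℝ) 0).symm (t, u)
            ∈ S → u ∈ unitCube m ∧ t ∈ Set.Icc (0 : ℝ) 1 ∩
              {t | |t - x 0| * ∏ j, |u j - x j.succ| ≤ v} := by
          rintro t ⟨ht1, ht2⟩
          have h1 := mem_unitCube_iff.1 ht1
          simp only [Set.mem_ofPred_eq, spannedVolume, Fin.prod_univ_succ] at ht2
          refine ⟨mem_unitCube_iff.2 fun j => ?_, ?_, ?_⟩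
          · simpa using h1 j.succ
          · simpa using h1 0
          · simpa using ht2
        by_cases hu : u ∈ unitCube m
        · rw [Set.indicator_of_mem hu]
          refine (measure_mono fun t ht => (hmem t ht).2).trans ?_
          refine (volume_Icc_inter_abs_mul_le hv (Finset.prod_nonneg fun _ _ => abs_nonneg _)
            hl0 hl1).trans (le_of_eq ?_)
          rw [ENNReal.ofReal_prod_of_nonneg fun _ _ => abs_nonneg _, ENNReal.prod_rpow_of_ne_top]
          exact fun _ _ => ENNReal.ofReal_ne_top
        · rw [Set.indicator_of_notMem hu]
          refine (le_of_eq ?_ : _ ≤ (0 : ℝ≥0∞))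
          refine measure_mono_null (t := ∅) (fun t ht => ?_) measure_empty
          exact hu (hmem t ht).1
    _ = ENNReal.ofReal (2 * v) ^ l *
          ∫⁻ u in unitCube m, ∏ j, ENNReal.ofReal |u j - x j.succ| ^ (-l) := by
        rw [lintegral_indicator (measurableSet_unitCube m), lintegral_const_mul']
        exact ENNReal.rpow_ne_top_of_nonneg hl0.le ENNReal.ofReal_ne_top
    _ ≤ _ := by
        gcongr
        exact lintegral_unitCube_prod_le _ hx' hl1

end Volume

/-! ### Empty spanned boxes and the selected point -/

section PotentialNeighbours

/-- A leaf contains the box spanned by any two of its points. -/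
theorem SplitTree.leafOf_eq_of_mem_uIcc {d : ℕ} {τ : SplitTree d} {x u w : Fin d → ℝ}
    (h : τ.leafOf u = τ.leafOf x) (hw : ∀ j, w j ∈ Set.uIcc (x j) (u j)) :
    τ.leafOf w = τ.leafOf x := by
  induction τ with
  | leaf => rfl
  | node j t l r ihl ihr =>
    have hj := hw j
    rw [Set.mem_uIcc] at hj
    by_cases hx : x j ≤ t <;> by_cases hu : u j ≤ t <;> simp only [leafOf, hx, hu, if_true, if_false,
      List.cons.injEq, true_and, reduceCtorEq, false_and] at h
    · have hw' : w j ≤ t := by rcases hj with hj | hj <;> linarith [hj.1, hj.2]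
      simp [leafOf, hx, hw', ihl h]
    · have hw' : ¬ w j ≤ t := by rcases hj with hj | hj <;> linarith [hj.1, hj.2]
      simp [leafOf, hx, hw', ihr h]

variable {Ω : Type*} [mΩ : MeasurableSpace Ω] {μ : Measure Ω} [IsProbabilityMeasure μ] {d s : ℕ}
  {f : (Fin d → ℝ) → ℝ} {κ : Kernel (Fin d → ℝ) ℝ} [IsMarkovKernel κ]
  {X : Fin s → Ω → (Fin d → ℝ)} {Y : Fin s → Ω → ℝ}

/-- The box spanned by two points. -/
def spannedBox (x u : Fin d → ℝ) : Set (Fin d → ℝ) := Set.univ.pi fun j => Set.uIcc (x j) (u j)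

theorem measurableSet_spannedBox (x u : Fin d → ℝ) : MeasurableSet (spannedBox x u) :=
  MeasurableSet.univ_pi fun _ => measurableSet_uIcc

theorem measurableSet_mem_spannedBox (x : Fin d → ℝ) :
    MeasurableSet {z : (Fin d → ℝ) × (Fin d → ℝ) | z.2 ∈ spannedBox x z.1} := by
  have : {z : (Fin d → ℝ) × (Fin d → ℝ) | z.2 ∈ spannedBox x z.1} =
      ⋂ j, {z | min (x j) (z.1 j) ≤ z.2 j} ∩ {z | z.2 j ≤ max (x j) (z.1 j)} := by
    ext z
    simp only [spannedBox, Set.mem_ofPred_eq, Set.mem_univ_pi, Set.uIcc, Set.mem_Icc,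
      Set.mem_iInter, Set.mem_inter_iff]
  rw [this]
  exact MeasurableSet.iInter fun j => (measurableSet_le (by fun_prop) (by fun_prop)).inter
    (measurableSet_le (by fun_prop) (by fun_prop))

/-- The spanned box stays inside the cube and has mass at least `a` times its volume; then `1 - t ≤
exp (-t)`. -/
theorem featureLaw_compl_spannedBox_le (hf : IsBoundedDensity f) {a : ℝ} (ha0 : 0 < a)
    (ha : ∀ u ∈ unitCube d, a ≤ f u) {x u : Fin d → ℝ} (hx : x ∈ unitCube d)
    (hu : u ∈ unitCube d) :
    featureLaw f (spannedBox x u)ᶜ ≤ ENNReal.ofReal (Real.exp (-(a * spannedVolume x u))) := by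
  have := hf.isProbabilityMeasure
  have hvol : volume.real (spannedBox x u ∩ unitCube d) = spannedVolume x u := by
    rw [spannedBox, volume_real_box]
    refine Finset.prod_congr rfl fun j _ => ?_
    rw [Set.inter_eq_left.2 (Set.ordConnected_Icc.uIcc_subset (mem_unitCube_iff.1 hx j)
      (mem_unitCube_iff.1 hu j)), Set.uIcc, Real.volume_real_Icc_of_le inf_le_sup,
      max_sub_min_eq_abs]
  have h1 := hf.le_real_featureLaw ha0.le ha (measurableSet_spannedBox x u)
  rw [hvol] at h1
  rw [← ofReal_measureReal, probReal_compl_eq_one_sub (measurableSet_spannedBox x u)]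
  refine ENNReal.ofReal_le_ofReal ?_
  linarith [Real.add_one_le_exp (-(a * spannedVolume x u))]

/-- Given `X i`, the other points are independent, and each misses the spanned box with probability
at most `exp (-(a * v))`. At least `s / 2 - 1` of them remain after `i` is removed. The mass of `B`
is kept as a factor, since the exponential alone is too weak at moderate volumes. -/
theorem measure_forall_notMem_spannedBox_le (hf : IsBoundedDensity f) {a : ℝ} (ha0 : 0 < a)
    (ha : ∀ u ∈ unitCube d, a ≤ f u) (hXY : IsSample μ f κ X Y) {x : Fin d → ℝ}
    (hx : x ∈ unitCube d) (i : Fin s) (Q : Finset (Fin s)) (hQ : (s : ℝ) / 2 ≤ Q.card)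
    {v : ℝ} (hv : 0 ≤ v) {B : Set (Fin d → ℝ)} (hB : MeasurableSet B)
    (hBv : ∀ u ∈ B, u ∈ unitCube d ∧ v ≤ spannedVolume x u) :
    μ {ω | X i ω ∈ B ∧ ∀ k ∈ Q.erase i, X k ω ∉ spannedBox x (X i ω)} ≤
      ENNReal.ofReal (Real.exp (-((s / 2 - 1) * (a * v)))) * featureLaw f B := by
  have := hf.isProbabilityMeasure
  let W : Ω → (Q.erase i) → (Fin d → ℝ) := fun ω k => X k ω
  have hW : Measurable W := measurable_pi_lambda _ fun k => hXY.measurable_X k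
  have hind : IndepFun (X i) W μ := by
    have h1 := hXY.indep_X.indepFun_finset {i} (Q.erase i) (by simp) hXY.measurable_X
    have hi : Measurable fun z : ({i} : Finset (Fin s)) → (Fin d → ℝ) => z ⟨i, by simp⟩ :=
      measurable_pi_apply _
    exact h1.comp hi measurable_id
  have hmap := (indepFun_iff_map_prod_eq_prod_map_map (hXY.measurable_X i).aemeasurable
    hW.aemeasurable).1 hind
  let T : Set ((Fin d → ℝ) × ((Q.erase i) → (Fin d → ℝ))) :=
    {z | z.1 ∈ B ∧ ∀ k, z.2 k ∉ spannedBox x z.1}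
  have hT : MeasurableSet T := by
    refine (measurable_fst hB).inter ?_
    have : {z : (Fin d → ℝ) × ((Q.erase i) → (Fin d → ℝ)) | ∀ k, z.2 k ∉ spannedBox x z.1} =
        ⋂ k, (fun z => (z.1, z.2 k)) ⁻¹' {z | z.2 ∈ spannedBox x z.1}ᶜ := by
      ext z; simp
    change MeasurableSet
      {z : (Fin d → ℝ) × ((Q.erase i) → (Fin d → ℝ)) | ∀ k, z.2 k ∉ spannedBox x z.1}
    rw [this]
    exact MeasurableSet.iInter fun k => (by fun_prop :
      Measurable fun z : (Fin d → ℝ) × ((Q.erase i) → (Fin d → ℝ)) => (z.1, z.2 k))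
      (measurableSet_mem_spannedBox x).compl
  have heq : {ω | X i ω ∈ B ∧ ∀ k ∈ Q.erase i, X k ω ∉ spannedBox x (X i ω)} =
      (fun ω => (X i ω, W ω)) ⁻¹' T := by
    ext ω
    simp [T, W]
  rw [heq, ← Measure.map_apply ((hXY.measurable_X i).prodMk hW) hT, hmap, hXY.map_X hf,
    Measure.prod_apply hT, ← setLIntegral_const, ← lintegral_indicator hB]
  refine lintegral_mono fun u => ?_
  by_cases hu : u ∈ B
  swap
  · rw [Set.indicator_of_notMem hu]
    exact (measure_mono_null (t := ∅) (fun w hw => hu hw.1) measure_empty).le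
  rw [Set.indicator_of_mem hu]
  obtain ⟨huc, huv⟩ := hBv u hu
  calc _ ≤ (μ.map W) {w | ∀ k, w k ∉ spannedBox x u} := measure_mono fun w hw => hw.2
    _ = μ (⋂ k ∈ Q.erase i, X k ⁻¹' (spannedBox x u)ᶜ) := by
        rw [Measure.map_apply hW]
        · congr 1
          ext ω
          simp [W]
        · have : {w : (Q.erase i) → (Fin d → ℝ) | ∀ k, w k ∉ spannedBox x u} =
              Set.univ.pi fun _ => (spannedBox x u)ᶜ := by ext w; simp
          rw [this]
          exact MeasurableSet.univ_pi fun _ => (measurableSet_spannedBox x u).compl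
    _ = ∏ k ∈ Q.erase i, featureLaw f (spannedBox x u)ᶜ := by
        rw [hXY.indep_X.measure_inter_preimage_eq_mul _
          fun _ _ => (measurableSet_spannedBox x u).compl]
        refine Finset.prod_congr rfl fun k _ => ?_
        rw [← Measure.map_apply (hXY.measurable_X k) (measurableSet_spannedBox x u).compl,
          hXY.map_X hf]
    _ ≤ ∏ k ∈ Q.erase i, ENNReal.ofReal (Real.exp (-(a * v))) := by
        refine Finset.prod_le_prod' fun k _ =>
          (featureLaw_compl_spannedBox_le hf ha0 ha hx huc).trans (ENNReal.ofReal_le_ofReal ?_)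
        gcongr
    _ = ENNReal.ofReal (Real.exp (-((Q.erase i).card * (a * v)))) := by
        rw [Finset.prod_const, ← ENNReal.ofReal_pow (Real.exp_pos _).le, ← Real.exp_nat_mul,
          mul_neg]
    _ ≤ _ := by
        refine ENNReal.ofReal_le_ofReal (Real.exp_le_exp.2 (neg_le_neg ?_))
        have h1 : (Q.card : ℝ) - 1 ≤ (Q.erase i).card := by
          have := Finset.pred_card_le_card_erase (s := Q) (a := i)
          have : Q.card ≤ (Q.erase i).card + 1 := by omega
          have : (Q.card : ℝ) ≤ (Q.erase i).card + 1 := by exact_mod_cast this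
          linarith
        have : 0 ≤ a * v := mul_nonneg ha0.le hv
        nlinarith

/-- A selected point is a potential nearest neighbour, so that it is unlikely to span with the test
point a box of large volume. -/
theorem measure_selected_inter_le (hf : IsBoundedDensity f) {a : ℝ} (ha0 : 0 < a)
    (ha : ∀ u ∈ unitCube d, a ≤ f u) (hXY : IsSample μ f κ X Y) {τ : Ω → SplitTree d}
    {P : Ω → Finset (Fin s)} {π γ : ℝ} (hreg : IsRegularTree μ X Y τ P π γ)
    {x : Fin d → ℝ} (hx : x ∈ unitCube d) (i : Fin s) {v : ℝ} (hv : 0 ≤ v) {B : Set (Fin d → ℝ)}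
    (hB : MeasurableSet B) (hBv : ∀ u ∈ B, u ∈ unitCube d ∧ v ≤ spannedVolume x u) :
    μ (selected X τ P x i ∩ X i ⁻¹' B) ≤
      ENNReal.ofReal (Real.exp (-((s / 2 - 1) * (a * v)))) * featureLaw f B := by
  let E : Finset (Fin s) → Set Ω := fun Q =>
    {ω | X i ω ∈ B ∧ ∀ k ∈ Q.erase i, X k ω ∉ spannedBox x (X i ω)}
  have hE : ∀ Q, MeasurableSet[MeasurableSpace.comap (fun ω i => (X i ω, Y i ω)) inferInstance]
      (E Q) := fun Q => by
    refine ⟨{z | (z i).1 ∈ B ∧ ∀ k ∈ Q.erase i, (z k).1 ∉ spannedBox x (z i).1}, ?_, rfl⟩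
    have hm : ∀ k, Measurable fun z : Fin s → (Fin d → ℝ) × ℝ => (z k).1 := fun k => by fun_prop
    refine (hm i hB).inter ?_
    have : {z : Fin s → (Fin d → ℝ) × ℝ | ∀ k ∈ Q.erase i, (z k).1 ∉ spannedBox x (z i).1} =
        ⋂ k ∈ Q.erase i, (fun z => ((z i).1, (z k).1)) ⁻¹' {w | w.2 ∈ spannedBox x w.1}ᶜ := by
      ext z; simp
    change MeasurableSet
      {z : Fin s → (Fin d → ℝ) × ℝ | ∀ k ∈ Q.erase i, (z k).1 ∉ spannedBox x (z i).1}
    rw [this]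
    exact Finset.measurableSet_biInter _ fun k _ =>
      ((hm i).prodMk (hm k)) (measurableSet_mem_spannedBox x).compl
  refine (measure_mono_ae ?_).trans (measure_exists_of_indep hreg.pred_indep hreg.measurable_pred
    hE fun Q hQ => ?_)
  · filter_upwards [hreg.fully_grown] with ω huniq hω
    obtain ⟨hsel, hωB⟩ := hω
    refine ⟨hωB, fun k hk hbox => ?_⟩
    rw [Finset.mem_erase] at hk
    -- Another prediction point in the spanned box would share the leaf of `x`, against uniqueness.
    have hleaf := SplitTree.leafOf_eq_of_mem_uIcc hsel.2
      (w := X k ω) (fun j => by simpa using hbox j trivial)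
    exact hk.1 ((huniq x hx).unique ⟨hk.2, hleaf⟩ hsel)
  · refine measure_forall_notMem_spannedBox_le hf ha0 ha hXY hx i Q ?_ hv hB hBv
    by_contra hlt
    refine hQ (measure_mono_null (fun ω hω => ?_) (ae_iff.1 hreg.pred_card))
    have : P ω = Q := hω
    simpa [this] using hlt

end PotentialNeighbours

/-! ### Honesty -/

section Honesty

variable {Ω : Type*} {d s : ℕ}
  {κ : Kernel (Fin d → ℝ) ℝ} [IsMarkovKernel κ]
  {X : Fin s → Ω → (Fin d → ℝ)} {Y : Fin s → Ω → ℝ} {τ : Ω → SplitTree d} {P : Ω → Finset (Fin s)}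
  {x : Fin d → ℝ}

/-- The sample with the `i`-th label removed. -/
def maskedSample (X : Fin s → Ω → (Fin d → ℝ)) (Y : Fin s → Ω → ℝ) (i : Fin s) (ω : Ω) :
    Fin s → (Fin d → ℝ) × ℝ :=
  fun k => if k = i then (X i ω, 0) else (X k ω, Y k ω)

theorem maskedSample_self (i : Fin s) (ω : Ω) : maskedSample X Y i ω i = (X i ω, 0) := if_pos rfl

theorem maskedSample_of_ne {i k : Fin s} (h : k ≠ i) (ω : Ω) :
    maskedSample X Y i ω k = (X k ω, Y k ω) := if_neg h

theorem measurable_maskedSample (i : Fin s) : Measurable[othersSigma X Y i] (maskedSample X Y i) := by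
  let m := othersSigma X Y i
  refine measurable_pi_lambda _ fun k => ?_
  by_cases hk : k = i
  · subst hk
    simp only [maskedSample_self]
    exact ((comap_measurable (X k)).mono le_sup_left le_rfl).prodMk measurable_const
  · simp only [maskedSample_of_ne hk]
    exact (comap_measurable fun ω => (X k ω, Y k ω)).mono
      ((le_iSup₂_of_le (f := fun (j : Fin s) (_ : j ∈ {j : Fin s | j ≠ i}) =>
        MeasurableSpace.comap (fun ω => (X j ω, Y j ω)) inferInstance) k hk le_rfl).trans
          le_sup_right) le_rfl

variable [mΩ : MeasurableSpace Ω] {μ : Measure Ω} [IsProbabilityMeasure μ]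

theorem othersSigma_le (hX : ∀ i, Measurable (X i)) (hY : ∀ i, Measurable (Y i)) (i : Fin s) :
    othersSigma X Y i ≤ mΩ :=
  sup_le (hX i).comap_le (iSup₂_le fun k _ => ((hX k).prodMk (hY k)).comap_le)

/-- Given that `i` is selected, and given `X i` and the other examples, the label `Y i` has the
law `κ (X i)`. -/
theorem IsHonestAt.map_eq_compProd (h : IsHonestAt μ κ X Y τ P x) (hX : ∀ i, Measurable (X i))
    (hY : ∀ i, Measurable (Y i)) (i : Fin s) :
    (μ.restrict (selected X τ P x i)).map (fun ω => (maskedSample X Y i ω, Y i ω)) =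
      ((μ.restrict (selected X τ P x i)).map (maskedSample X Y i)) ⊗ₘ
        (κ.comap (fun w : Fin s → (Fin d → ℝ) × ℝ => (w i).1) (by fun_prop)) := by
  have hW' := measurable_maskedSample (X := X) (Y := Y) i
  have hW : Measurable (maskedSample X Y i) := hW'.mono (othersSigma_le hX hY i) le_rfl
  refine Measure.ext_prod fun {E B} hE hB => ?_
  rw [Measure.compProd_apply_prod hE hB, Measure.map_apply (hW.prodMk (hY i)) (hE.prod hB),
    setLIntegral_map hE ((Kernel.measurable_coe _ hB)) hW, Measure.restrict_restrict (hW hE),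
    Measure.restrict_apply ((hW.prodMk (hY i)) (hE.prod hB))]
  have h1 := h i _ (hW' hE) B hB
  rw [Set.inter_comm (selected X τ P x i)] at h1
  simp only [Kernel.comap_apply, maskedSample_self]
  rw [← h1]
  congr 1
  ext ω
  simp only [Set.mem_inter_iff, Set.mem_preimage, Set.mem_prod]
  tauto

/-- The factorized law on the selection event allows the label to be integrated out first. The
integrand may involve the whole masked sample because the test function contains all the other
examples. -/
theorem IsHonestAt.setIntegral_eq (h : IsHonestAt μ κ X Y τ P x) (hX : ∀ i, Measurable (X i))
    (hY : ∀ i, Measurable (Y i)) (i : Fin s) {ψ : (Fin s → (Fin d → ℝ) × ℝ) → ℝ → ℝ}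
    (hψ : Measurable (Function.uncurry ψ))
    (hint : IntegrableOn (fun ω => ψ (maskedSample X Y i ω) (Y i ω)) (selected X τ P x i) μ) :
    ∫ ω in selected X τ P x i, ψ (maskedSample X Y i ω) (Y i ω) ∂μ =
      ∫ ω in selected X τ P x i, ∫ y, ψ (maskedSample X Y i ω) y ∂(κ (X i ω)) ∂μ := by
  have hW : Measurable (maskedSample X Y i) :=
    (measurable_maskedSample (X := X) (Y := Y) i).mono (othersSigma_le hX hY i) le_rfl
  have hWY := hW.prodMk (hY i)
  have h1 := integral_map hWY.aemeasurable (μ := μ.restrict (selected X τ P x i))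
    hψ.aestronglyMeasurable
  have h2 := (integrable_map_measure hψ.aestronglyMeasurable hWY.aemeasurable
    (μ := μ.restrict (selected X τ P x i))).2 hint
  rw [h.map_eq_compProd hX hY] at h1 h2
  rw [Measure.integral_compProd h2, integral_map hW.aemeasurable] at h1
  · simp only [Kernel.comap_apply, maskedSample_self] at h1
    exact h1.symm
  · exact (hψ.stronglyMeasurable.integral_kernel_prod_right').aestronglyMeasurable

end Honesty

/-! ### The Hájek projection -/

section Hajek

theorem MemLp.integrable_fun_mul {Ω : Type*} [MeasurableSpace Ω] {μ : Measure Ω} {f g : Ω → ℝ}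
    (hf : MemLp f 2 μ) (hg : MemLp g 2 μ) : Integrable (fun ω => f ω * g ω) μ :=
  hf.integrable_mul hg

/-- The quadratic `t ↦ ∫ (f + t g)²` is nonnegative, so its discriminant is not positive. -/
theorem sq_integral_mul_le {Ω : Type*} [MeasurableSpace Ω] {μ : Measure Ω} {f g : Ω → ℝ}
    (hf : MemLp f 2 μ) (hg : MemLp g 2 μ) :
    (∫ ω, f ω * g ω ∂μ) ^ 2 ≤ (∫ ω, f ω ^ 2 ∂μ) * ∫ ω, g ω ^ 2 ∂μ := by
  have hfg : Integrable (fun ω => f ω * g ω) μ := MemLp.integrable_fun_mul hf hg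
  have key : ∀ t : ℝ, 0 ≤ (∫ ω, g ω ^ 2 ∂μ) * (t * t) + 2 * (∫ ω, f ω * g ω ∂μ) * t +
      ∫ ω, f ω ^ 2 ∂μ := fun t => by
    have h1 : 0 ≤ ∫ ω, (f ω + t * g ω) ^ 2 ∂μ := integral_nonneg fun ω => sq_nonneg _
    have h2 : ∀ ω, (f ω + t * g ω) ^ 2 = (t * t) * g ω ^ 2 + 2 * t * (f ω * g ω) + f ω ^ 2 :=
      fun ω => by ring
    simp only [h2] at h1
    have h3 : Integrable (fun ω => (t * t) * g ω ^ 2) μ := hg.integrable_sq.const_mul _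
    have h4 : Integrable (fun ω => 2 * t * (f ω * g ω)) μ := hfg.const_mul _
    have h5 : Integrable (fun ω => (t * t) * g ω ^ 2 + 2 * t * (f ω * g ω)) μ := h3.add h4
    rw [integral_add h5 hf.integrable_sq, integral_add h3 h4, integral_const_mul,
      integral_const_mul] at h1
    linarith
  have := discrim_le_zero key
  unfold discrim at this
  nlinarith

variable {Ω 𝓩 : Type*} [mΩ : MeasurableSpace Ω] [MeasurableSpace 𝓩] {μ : Measure Ω}
  [IsProbabilityMeasure μ] {s : ℕ} {Z : Fin s → Ω → 𝓩} {T : Ω → ℝ} {h : 𝓩 → ℝ}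

theorem sq_integral_mul_le_variance {T H : Ω → ℝ} (hT : MemLp T 2 μ) (hH : MemLp H 2 μ)
    (hH0 : ∫ ω, H ω ∂μ = 0) :
    (∫ ω, T ω * H ω ∂μ) ^ 2 ≤ variance T μ * ∫ ω, H ω ^ 2 ∂μ := by
  rw [variance_eq_integral hT.1.aemeasurable]
  have h1 := sq_integral_mul_le (hT.sub (memLp_const (∫ ω, T ω ∂μ))) hH
  have h2 : ∫ ω, (T ω - ∫ ω, T ω ∂μ) * H ω ∂μ = ∫ ω, T ω * H ω ∂μ := by
    simp only [sub_mul]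
    rw [integral_sub (MemLp.integrable_fun_mul hT hH) ((hH.integrable one_le_two).const_mul _),
      integral_const_mul, hH0, mul_zero, sub_zero]
  simp only [Pi.sub_apply] at h1
  rwa [h2] at h1

theorem memLp_hajekProjection (hT : MemLp T 2 μ) : MemLp (hajekProjection μ Z T) 2 μ :=
  have hc : ∀ i ∈ (Finset.univ : Finset (Fin s)), MemLp (fun ω =>
      (μ[T | MeasurableSpace.comap (Z i) inferInstance]) ω - ∫ ω, T ω ∂μ) 2 μ :=
    fun i _ => (hT.condExp one_le_two).sub (memLp_const _)
  (memLp_const (∫ ω, T ω ∂μ)).add (memLp_finsetSum _ hc)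

/-- The projection has the same covariance as `T` with every sum of functions of the examples. -/
theorem integral_hajekProjection_mul (hZ : ∀ i, Measurable (Z i)) (hind : iIndepFun Z μ)
    (hT : MemLp T 2 μ) (hh : Measurable h) (hh2 : ∀ i, MemLp (fun ω => h (Z i ω)) 2 μ)
    (hh0 : ∀ i, ∫ ω, h (Z i ω) ∂μ = 0) :
    ∫ ω, hajekProjection μ Z T ω * ∑ i, h (Z i ω) ∂μ = ∫ ω, T ω * ∑ i, h (Z i ω) ∂μ := by
  let c : Fin s → Ω → ℝ := fun i => μ[T | MeasurableSpace.comap (Z i) inferInstance]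
  have hc : ∀ i, MemLp (c i) 2 μ := fun i => hT.condExp one_le_two
  have hle : ∀ i, MeasurableSpace.comap (Z i) inferInstance ≤ mΩ := fun i => (hZ i).comap_le
  have hhm : ∀ i, Measurable[MeasurableSpace.comap (Z i) inferInstance] fun ω => h (Z i ω) :=
    fun i => hh.comp (comap_measurable (Z i))
  -- `h (Z i)` can be pulled into the conditional expectation given `Z i`. For different indices,
  -- independence and centering give zero.
  have hdiag : ∀ i, ∫ ω, c i ω * h (Z i ω) ∂μ = ∫ ω, T ω * h (Z i ω) ∂μ := fun i => by
    have h1 := condExp_mul_of_stronglyMeasurable_right (μ := μ) (f := T)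
      (hhm i).stronglyMeasurable (hT.integrable_mul (hh2 i)) (hT.integrable one_le_two)
    have h2 := integral_condExp (hle i) (μ := μ) (f := T * fun ω => h (Z i ω))
    rw [integral_congr_ae h1] at h2
    exact h2
  have hoff : ∀ i k, i ≠ k → ∫ ω, c i ω * h (Z k ω) ∂μ = 0 := fun i k hik => by
    have hi : IndepFun (c i) (fun ω => h (Z k ω)) μ := by
      rw [IndepFun_iff_Indep]
      have h1 := (IndepFun_iff_Indep _ _ _).1 (hind.indepFun hik)
      exact indep_of_indep_of_le_right (indep_of_indep_of_le_left h1
        stronglyMeasurable_condExp.measurable.comap_le) (hhm k).comap_le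
    rw [hi.integral_fun_mul_eq_mul_integral (hc i).1 (hh2 k).1, hh0, mul_zero]
  have hprod : ∀ i k, Integrable (fun ω => (c i ω - ∫ ω, T ω ∂μ) * h (Z k ω)) μ := fun i k =>
    ((hc i).sub (memLp_const _)).integrable_mul (hh2 k)
  have hterm : ∀ i k, ∫ ω, (c i ω - ∫ ω, T ω ∂μ) * h (Z k ω) ∂μ =
      if i = k then ∫ ω, T ω * h (Z k ω) ∂μ else 0 := fun i k => by
    simp only [sub_mul]
    rw [integral_sub (MemLp.integrable_fun_mul (hc i) (hh2 k))
      (((hh2 k).integrable one_le_two).const_mul _), integral_const_mul, hh0, mul_zero, sub_zero]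
    split_ifs with hik
    · subst hik; exact hdiag i
    · exact hoff i k hik
  have hexp : ∀ ω, hajekProjection μ Z T ω * ∑ k, h (Z k ω) =
      (∫ ω, T ω ∂μ) * ∑ k, h (Z k ω) + ∑ i, ∑ k, (c i ω - ∫ ω, T ω ∂μ) * h (Z k ω) := fun ω => by
    rw [hajekProjection, add_mul, Finset.sum_mul_sum]
  simp only [hexp]
  rw [integral_add, integral_const_mul, integral_finsetSum, integral_finsetSum]
  · simp only [hh0, Finset.sum_const_zero, mul_zero, zero_add]
    simp_rw [Finset.mul_sum]
    rw [integral_finsetSum _ fun i _ => MemLp.integrable_fun_mul hT (hh2 i)]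
    refine Finset.sum_congr rfl fun i _ => ?_
    rw [integral_finsetSum _ fun k _ => hprod i k]
    simp [hterm]
  · exact fun i _ => integrable_finsetSum _ fun k _ => hprod i k
  · exact fun i _ => (hh2 i).integrable one_le_two
  · exact (integrable_finsetSum _ fun i _ => (hh2 i).integrable one_le_two).const_mul _
  · exact integrable_finsetSum _ fun i _ => integrable_finsetSum _ fun k _ => hprod i k

/-- The variational lower bound: the projection is never computed, only the covariance of `T` itself
with a chosen sum over the examples. -/
theorem sq_integral_mul_le_variance_hajekProjection (hZ : ∀ i, Measurable (Z i))
    (hind : iIndepFun Z μ) (hT : MemLp T 2 μ) (hh : Measurable h)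
    (hh2 : ∀ i, MemLp (fun ω => h (Z i ω)) 2 μ) (hh0 : ∀ i, ∫ ω, h (Z i ω) ∂μ = 0) :
    (∫ ω, T ω * ∑ i, h (Z i ω) ∂μ) ^ 2 ≤
      variance (hajekProjection μ Z T) μ * ∫ ω, (∑ i, h (Z i ω)) ^ 2 ∂μ := by
  rw [← integral_hajekProjection_mul hZ hind hT hh hh2 hh0]
  refine sq_integral_mul_le_variance (memLp_hajekProjection hT)
    (memLp_finsetSum _ fun i _ => hh2 i) ?_
  rw [integral_finsetSum _ fun i _ => (hh2 i).integrable one_le_two]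
  simp [hh0]

end Hajek

/-! ### Conditional moments of the labels -/

section Moments

variable {d : ℕ} {κ : Kernel (Fin d → ℝ) ℝ} [IsMarkovKernel κ]

/-- The conditional mean of `Y` given `X = u`. -/
noncomputable def condMean (κ : Kernel (Fin d → ℝ) ℝ) (u : Fin d → ℝ) : ℝ := ∫ y, y ∂(κ u)

theorem measurable_condMean : Measurable (condMean κ) :=
  (stronglyMeasurable_id.integral_kernel (κ := κ)).measurable

theorem HasLipschitzMoments.memLp_id (h : HasLipschitzMoments κ) {u : Fin d → ℝ}
    (hu : u ∈ unitCube d) : MemLp id 2 (κ u) :=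
  (memLp_two_iff_integrable_sq aestronglyMeasurable_id).2 (h.integrable_sq u hu)

theorem HasLipschitzMoments.variance_eq (h : HasLipschitzMoments κ) {u : Fin d → ℝ}
    (hu : u ∈ unitCube d) : variance id (κ u) = ∫ y, y ^ 2 ∂(κ u) - condMean κ u ^ 2 :=
  variance_eq_sub (h.memLp_id hu)

/-- Bounds on the conditional moments of the labels: `M` bounds them, and `K` is a Lipschitz
constant. -/
structure MomentBounds (κ : Kernel (Fin d → ℝ) ℝ) (M K : ℝ) : Prop where
  one_le : 1 ≤ M
  nonneg : 0 ≤ K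
  integral_sq_le : ∀ u ∈ unitCube d, ∫ y, y ^ 2 ∂(κ u) ≤ M
  variance_le : ∀ u ∈ unitCube d, variance id (κ u) ≤ M
  abs_condMean_le : ∀ u ∈ unitCube d, |condMean κ u| ≤ M
  abs_condMean_sub_le : ∀ u ∈ unitCube d, ∀ w ∈ unitCube d,
    |condMean κ u - condMean κ w| ≤ K * dist u w
  abs_variance_sub_le : ∀ u ∈ unitCube d, ∀ w ∈ unitCube d,
    |variance id (κ u) - variance id (κ w)| ≤ K * dist u w

theorem HasLipschitzMoments.exists_momentBounds (h : HasLipschitzMoments κ) :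
    ∃ M K, MomentBounds κ M K := by
  obtain ⟨K₁, h₁⟩ := h.lipschitz_one
  obtain ⟨K₂, h₂⟩ := h.lipschitz_two
  obtain ⟨M₀, hM₀⟩ := h.bounded_two
  set M := max M₀ 1
  have hM1 : 1 ≤ M := le_max_right _ _
  have hM : ∀ u ∈ unitCube d, ∫ y, y ^ 2 ∂(κ u) ≤ M := fun u hu =>
    (hM₀ u hu).trans (le_max_left _ _)
  -- The squared mean is at most the second moment, hence at most `M ≤ M ^ 2`; this is why `M` is
  -- taken to be at least one.
  have hmean : ∀ u ∈ unitCube d, |condMean κ u| ≤ M := fun u hu => by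
    have h1 := variance_nonneg id (κ u)
    rw [h.variance_eq hu] at h1
    refine abs_le_of_sq_le_sq ?_ (by linarith)
    nlinarith [hM u hu]
  have hK₁ : ∀ u ∈ unitCube d, ∀ w ∈ unitCube d,
      |condMean κ u - condMean κ w| ≤ K₁ * dist u w := fun u hu w hw => h₁.dist_le_mul u hu w hw
  have hK₁0 : (0 : ℝ) ≤ K₁ := K₁.2
  have hK₂0 : (0 : ℝ) ≤ K₂ := K₂.2
  refine ⟨M, K₁ + K₂ + 2 * M * K₁, hM1, by positivity, hM, fun u hu => ?_, hmean,
    fun u hu w hw => ?_, fun u hu w hw => ?_⟩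
  · rw [h.variance_eq hu]
    nlinarith [hM u hu, sq_nonneg (condMean κ u)]
  · refine (hK₁ u hu w hw).trans (mul_le_mul_of_nonneg_right ?_ dist_nonneg)
    nlinarith
  · rw [h.variance_eq hu, h.variance_eq hw]
    have h3 : |∫ y, y ^ 2 ∂(κ u) - ∫ y, y ^ 2 ∂(κ w)| ≤ K₂ * dist u w :=
      h₂.dist_le_mul u hu w hw
    have h4 : |condMean κ u ^ 2 - condMean κ w ^ 2| ≤ 2 * M * (K₁ * dist u w) := by
      rw [sq_sub_sq, abs_mul]
      refine mul_le_mul ?_ (hK₁ u hu w hw) (abs_nonneg _) (by linarith)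
      exact (abs_add_le _ _).trans (by linarith [hmean u hu, hmean w hw])
    calc _ = |(∫ y, y ^ 2 ∂(κ u) - ∫ y, y ^ 2 ∂(κ w)) - (condMean κ u ^ 2 - condMean κ w ^ 2)| := by
          congr 1; ring
      _ ≤ K₂ * dist u w + 2 * M * (K₁ * dist u w) := (abs_sub _ _).trans (add_le_add h3 h4)
      _ ≤ _ := by nlinarith [mul_nonneg hK₁0 (dist_nonneg (x := u) (y := w))]

variable {Ω : Type*} [mΩ : MeasurableSpace Ω] {μ : Measure Ω} {s : ℕ} {f : (Fin d → ℝ) → ℝ}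
  {X : Fin s → Ω → (Fin d → ℝ)} {Y : Fin s → Ω → ℝ} {M K : ℝ}

theorem IsSample.integrable_comp_iff (hf : IsBoundedDensity f) (hXY : IsSample μ f κ X Y)
    (i : Fin s) {g : (Fin d → ℝ) × ℝ → ℝ} (hg : Measurable g) :
    Integrable (fun ω => g (X i ω, Y i ω)) μ ↔
      (∀ᵐ u ∂(featureLaw f), Integrable (fun y => g (u, y)) (κ u)) ∧
        Integrable (fun u => ∫ y, ‖g (u, y)‖ ∂(κ u)) (featureLaw f) := by
  have := hf.isProbabilityMeasure
  have h1 := integrable_map_measure (μ := μ) (f := fun ω => (X i ω, Y i ω))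
    hg.aestronglyMeasurable ((hXY.measurable_X i).prodMk (hXY.measurable_Y i)).aemeasurable
  rw [hXY.law] at h1
  rw [← Measure.integrable_compProd_iff hg.aestronglyMeasurable]
  exact h1.symm

theorem IsSample.integral_comp_eq (hf : IsBoundedDensity f) (hXY : IsSample μ f κ X Y)
    (i : Fin s) {g : (Fin d → ℝ) × ℝ → ℝ} (hg : Measurable g)
    (hint : Integrable (fun ω => g (X i ω, Y i ω)) μ) :
    ∫ ω, g (X i ω, Y i ω) ∂μ = ∫ u, ∫ y, g (u, y) ∂(κ u) ∂(featureLaw f) := by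
  have := hf.isProbabilityMeasure
  have hXYm := ((hXY.measurable_X i).prodMk (hXY.measurable_Y i)).aemeasurable (μ := μ)
  have h1 := integral_map hXYm hg.aestronglyMeasurable
  have h2 := (integrable_map_measure hg.aestronglyMeasurable hXYm).2 hint
  rw [hXY.law] at h1 h2
  rw [Measure.integral_compProd h2] at h1
  exact h1.symm

theorem ae_featureLaw_mem_unitCube (f : (Fin d → ℝ) → ℝ) :
    ∀ᵐ u ∂(featureLaw f), u ∈ unitCube d := by
  have := compl_mem_ae_iff.2 (featureLaw_compl_unitCube f)
  rwa [compl_compl] at this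

theorem IsSample.memLp_Y (hf : IsBoundedDensity f) (hXY : IsSample μ f κ X Y)
    (hκ : HasLipschitzMoments κ) (hM : MomentBounds κ M K) (i : Fin s) : MemLp (Y i) 2 μ := by
  have := hf.isProbabilityMeasure
  refine (memLp_two_iff_integrable_sq (hXY.measurable_Y i).aestronglyMeasurable).2 ?_
  refine (hXY.integrable_comp_iff hf i (g := fun z => z.2 ^ 2) (by fun_prop)).2 ⟨?_, ?_⟩
  · filter_upwards [ae_featureLaw_mem_unitCube f] with u hu using hκ.integrable_sq u hu
  · refine Integrable.of_bound (C := M) ?_ ?_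
    · have hm : StronglyMeasurable fun y : ℝ => ‖y ^ 2‖ := by fun_prop
      exact (hm.integral_kernel (κ := κ)).aestronglyMeasurable
    · filter_upwards [ae_featureLaw_mem_unitCube f] with u hu
      rw [Real.norm_of_nonneg (integral_nonneg fun y => norm_nonneg _)]
      simpa using hM.integral_sq_le u hu

theorem IsSample.memLp_condMean [IsProbabilityMeasure μ] (hf : IsBoundedDensity f)
    (hXY : IsSample μ f κ X Y) (hM : MomentBounds κ M K) (i : Fin s) :
    MemLp (fun ω => condMean κ (X i ω)) 2 μ := by
  refine MemLp.of_bound (measurable_condMean.comp (hXY.measurable_X i)).aestronglyMeasurable M ?_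
  filter_upwards [hXY.ae_mem_unitCube hf] with ω hω using hM.abs_condMean_le _ (hω i)

/-- The centered label of an example in `A`. -/
noncomputable def centeredLabel (κ : Kernel (Fin d → ℝ) ℝ) (A : Set (Fin d → ℝ))
    (z : (Fin d → ℝ) × ℝ) : ℝ :=
  A.indicator 1 z.1 * (z.2 - condMean κ z.1)

theorem measurable_centeredLabel {A : Set (Fin d → ℝ)} (hA : MeasurableSet A) :
    Measurable (centeredLabel κ A) :=
  ((measurable_one.indicator hA).comp measurable_fst).mul
    (measurable_snd.sub (measurable_condMean.comp measurable_fst))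

theorem HasLipschitzMoments.integral_sub_condMean (hκ : HasLipschitzMoments κ) {u : Fin d → ℝ}
    (hu : u ∈ unitCube d) : ∫ y, (y - condMean κ u) ∂(κ u) = 0 := by
  have : Integrable (fun y : ℝ => y) (κ u) := (hκ.memLp_id hu).integrable one_le_two
  rw [integral_sub this (integrable_const _)]
  simp [condMean]

theorem integral_sub_condMean_sq (u : Fin d → ℝ) :
    ∫ y, (y - condMean κ u) ^ 2 ∂(κ u) = variance id (κ u) :=
  (variance_eq_integral aemeasurable_id).symm

theorem integral_indicator_mul_variance_le (hf : IsBoundedDensity f) (hM : MomentBounds κ M K)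
    {A : Set (Fin d → ℝ)} (hA : MeasurableSet A) :
    ∫ u, A.indicator 1 u * variance id (κ u) ∂(featureLaw f) ≤ M * (featureLaw f).real A := by
  have := hf.isProbabilityMeasure
  calc _ ≤ ∫ u, A.indicator 1 u * M ∂(featureLaw f) := by
        refine integral_mono_of_nonneg ?_ ?_ ?_
        · exact ae_of_all _ fun u => mul_nonneg (Set.indicator_nonneg (fun _ _ => zero_le_one) _)
            (variance_nonneg _ _)
        · exact ((integrable_const (1 : ℝ)).indicator hA).mul_const M
        · filter_upwards [ae_featureLaw_mem_unitCube f] with u hu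
          exact mul_le_mul_of_nonneg_left (hM.variance_le u hu)
            (Set.indicator_nonneg (fun _ _ => zero_le_one) _)
    _ = _ := by rw [integral_mul_const, integral_indicator_one hA, mul_comm]

variable [IsProbabilityMeasure μ]

theorem IsSample.memLp_centeredLabel (hf : IsBoundedDensity f) (hXY : IsSample μ f κ X Y)
    (hκ : HasLipschitzMoments κ) (hM : MomentBounds κ M K) {A : Set (Fin d → ℝ)}
    (hA : MeasurableSet A) (i : Fin s) : MemLp (fun ω => centeredLabel κ A (X i ω, Y i ω)) 2 μ := by
  refine MemLp.mono ((hXY.memLp_Y hf hκ hM i).sub (hXY.memLp_condMean hf hM i))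
    ((measurable_centeredLabel hA).comp
      ((hXY.measurable_X i).prodMk (hXY.measurable_Y i))).aestronglyMeasurable
    (ae_of_all _ fun ω => ?_)
  by_cases h : X i ω ∈ A <;> simp [centeredLabel, h]

theorem IsSample.integral_centeredLabel (hf : IsBoundedDensity f) (hXY : IsSample μ f κ X Y)
    (hκ : HasLipschitzMoments κ) (hM : MomentBounds κ M K) {A : Set (Fin d → ℝ)}
    (hA : MeasurableSet A) (i : Fin s) : ∫ ω, centeredLabel κ A (X i ω, Y i ω) ∂μ = 0 := by
  rw [hXY.integral_comp_eq hf i (measurable_centeredLabel hA)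
    ((hXY.memLp_centeredLabel hf hκ hM hA i).integrable one_le_two)]
  refine integral_eq_zero_of_ae ?_
  filter_upwards [ae_featureLaw_mem_unitCube f] with u hu
  simp only [centeredLabel, Pi.zero_apply]
  rw [integral_const_mul, hκ.integral_sub_condMean hu, mul_zero]

/-- The summands are independent and centered, so their second moments add up; each is the integral
over `A` of the conditional variance. -/
theorem IsSample.integral_sum_centeredLabel_sq_le (hf : IsBoundedDensity f)
    (hXY : IsSample μ f κ X Y) (hκ : HasLipschitzMoments κ) (hM : MomentBounds κ M K)
    {A : Set (Fin d → ℝ)} (hA : MeasurableSet A) :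
    ∫ ω, (∑ i, centeredLabel κ A (X i ω, Y i ω)) ^ 2 ∂μ ≤ s * (M * (featureLaw f).real A) := by
  have hL2 := hXY.memLp_centeredLabel hf hκ hM hA
  have h0 := hXY.integral_centeredLabel hf hκ hM hA
  have hmeas := measurable_centeredLabel (κ := κ) hA
  have hvar0 : ∀ H : Ω → ℝ, MemLp H 2 μ → ∫ ω, H ω ∂μ = 0 → variance H μ = ∫ ω, H ω ^ 2 ∂μ :=
    fun H hH h => by rw [variance_eq_integral hH.1.aemeasurable, h]; simp
  have hsum : MemLp (∑ i, fun ω => centeredLabel κ A (X i ω, Y i ω)) 2 μ :=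
    memLp_finsetSum' _ fun i _ => hL2 i
  have hv := IndepFun.variance_sum (μ := μ) (s := Finset.univ)
    (X := fun i ω => centeredLabel κ A (X i ω, Y i ω)) (fun i _ => hL2 i)
    fun i _ j _ hij => (hXY.indep.indepFun hij).comp hmeas hmeas
  rw [hvar0 _ hsum] at hv
  · simp only [Finset.sum_apply] at hv
    rw [hv]
    calc _ ≤ ∑ i : Fin s, M * (featureLaw f).real A := by
          refine Finset.sum_le_sum fun i _ => ?_
          rw [hvar0 _ (hL2 i) (h0 i), hXY.integral_comp_eq hf i (hmeas.pow_const 2)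
            (hL2 i).integrable_sq]
          refine le_trans (le_of_eq ?_) (integral_indicator_mul_variance_le hf hM hA)
          refine integral_congr_ae (ae_of_all _ fun u => ?_)
          simp only [centeredLabel, mul_pow]
          rw [integral_const_mul, integral_sub_condMean_sq]
          by_cases h : u ∈ A <;> simp [h]
      _ = _ := by simp
  · simp only [Finset.sum_apply]
    rw [integral_finsetSum _ fun i _ => (hL2 i).integrable one_le_two]
    simp [h0]

end Moments

/-! ### The prediction and its covariance with the test function -/

section Prediction

variable {d : ℕ} {κ : Kernel (Fin d → ℝ) ℝ} [IsMarkovKernel κ]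
  {Ω : Type*} [mΩ : MeasurableSpace Ω] {μ : Measure Ω} [IsProbabilityMeasure μ] {s : ℕ}
  {f : (Fin d → ℝ) → ℝ} {X : Fin s → Ω → (Fin d → ℝ)} {Y : Fin s → Ω → ℝ} {M K : ℝ}
  {τ : Ω → SplitTree d} {P : Ω → Finset (Fin s)} {π γ : ℝ} {x : Fin d → ℝ}

theorem IsRegularTree.measurableSet_selected (hXY : IsSample μ f κ X Y)
    (hreg : IsRegularTree μ X Y τ P π γ) (x : Fin d → ℝ) (i : Fin s) :
    MeasurableSet (selected X τ P x i) :=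
  _root_.measurableSet_selected hXY.measurable_X hreg.measurable_tree hreg.measurable_pred x i

theorem memLp_treePrediction (hf : IsBoundedDensity f) (hXY : IsSample μ f κ X Y)
    (hκ : HasLipschitzMoments κ) (hM : MomentBounds κ M K) (hreg : IsRegularTree μ X Y τ P π γ) :
    MemLp (treePrediction X Y τ P x) 2 μ :=
  memLp_finsetSum _ fun i _ =>
    (hXY.memLp_Y hf hκ hM i).indicator (hreg.measurableSet_selected hXY x i)

theorem sum_measureReal_selected (hXY : IsSample μ f κ X Y) (hreg : IsRegularTree μ X Y τ P π γ)
    (hx : x ∈ unitCube d) : ∑ i, μ.real (selected X τ P x i) = 1 := by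
  have hsel := hreg.measurableSet_selected hXY x
  have h1 : ∀ i, μ.real (selected X τ P x i) = ∫ ω, (selected X τ P x i).indicator 1 ω ∂μ :=
    fun i => (integral_indicator_one (hsel i)).symm
  simp only [h1]
  rw [← integral_finsetSum]
  · have : ∀ᵐ ω ∂μ, ∑ i, (selected X τ P x i).indicator (1 : Ω → ℝ) ω = 1 := by
      filter_upwards [hreg.fully_grown] with ω hω
      obtain ⟨i, -, hi⟩ := exists_sum_indicator_selected (M := ℝ) (hω x hx)
      exact hi fun _ => 1
    rw [integral_congr_ae this]
    simp
  · exact fun i _ => (integrable_const (1 : ℝ)).indicator (hsel i)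

/-- Since one index is selected, the square of the prediction is the squared selected label. Honesty
keeps its conditional second moment below `M`, so selection cannot favor large labels. -/
theorem variance_treePrediction_le (hf : IsBoundedDensity f) (hXY : IsSample μ f κ X Y)
    (hκ : HasLipschitzMoments κ) (hM : MomentBounds κ M K) (hreg : IsRegularTree μ X Y τ P π γ)
    (hhon : IsHonestAt μ κ X Y τ P x) (hx : x ∈ unitCube d) :
    variance (treePrediction X Y τ P x) μ ≤ M := by
  have hsel := hreg.measurableSet_selected hXY x
  have hint : ∀ i, Integrable (fun ω => Y i ω ^ 2) μ := fun i =>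
    (hXY.memLp_Y hf hκ hM i).integrable_sq
  refine (variance_le_expectation_sq (memLp_treePrediction hf hXY hκ hM hreg).1).trans ?_
  have h1 : ∀ᵐ ω ∂μ, (treePrediction X Y τ P x ^ 2) ω =
      ∑ i, (selected X τ P x i).indicator (fun ω => Y i ω ^ 2) ω := by
    filter_upwards [hreg.fully_grown] with ω hω
    obtain ⟨i, -, hi⟩ := exists_sum_indicator_selected (M := ℝ) (hω x hx)
    rw [hi, Pi.pow_apply, treePrediction, hi]
  rw [integral_congr_ae h1, integral_finsetSum _ fun i _ => (hint i).indicator (hsel i)]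
  calc _ ≤ ∑ i, M * μ.real (selected X τ P x i) := by
        refine Finset.sum_le_sum fun i _ => ?_
        rw [integral_indicator (hsel i)]
        have h2 := hhon.setIntegral_eq hXY.measurable_X hXY.measurable_Y i (ψ := fun _ y => y ^ 2)
          (by fun_prop) (hint i).integrableOn
        rw [h2]
        calc _ ≤ ∫ ω in selected X τ P x i, M ∂μ := by
              refine integral_mono_of_nonneg (ae_of_all _ fun ω => integral_nonneg fun y =>
                sq_nonneg y) (integrable_const _) ?_
              filter_upwards [ae_restrict_of_ae (hXY.ae_mem_unitCube hf)] with ω hω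
                using hM.integral_sq_le _ (hω i)
          _ = _ := by rw [setIntegral_const, smul_eq_mul, mul_comm]
    _ = M := by rw [← Finset.mul_sum, sum_measureReal_selected hXY hreg hx, mul_one]

/-- The contribution of the labels that are used for prediction. -/
theorem setIntegral_sub_condMean_mul (hf : IsBoundedDensity f) (hXY : IsSample μ f κ X Y)
    (hκ : HasLipschitzMoments κ) (hM : MomentBounds κ M K)
    (hhon : IsHonestAt μ κ X Y τ P x) {A : Set (Fin d → ℝ)} (hA : MeasurableSet A) (i : Fin s) :
    ∫ ω in selected X τ P x i,
        (Y i ω - condMean κ (X i ω)) * ∑ k, centeredLabel κ A (X k ω, Y k ω) ∂μ =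
      ∫ ω in selected X τ P x i, A.indicator 1 (X i ω) * variance id (κ (X i ω)) ∂μ := by
  -- Only the `i`-th term of the test function contains `Y i`; the others are functions of the
  -- masked sample.
  let ψ : (Fin s → (Fin d → ℝ) × ℝ) → ℝ → ℝ := fun w y =>
    (y - condMean κ (w i).1) * (centeredLabel κ A ((w i).1, y) +
      ∑ k ∈ Finset.univ.erase i, centeredLabel κ A (w k))
  have hcl := measurable_centeredLabel (κ := κ) hA
  have hcm := measurable_condMean (κ := κ)
  have hψ : Measurable (Function.uncurry ψ) := by
    refine Measurable.mul (measurable_snd.sub (hcm.comp (by fun_prop))) (Measurable.add ?_ ?_)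
    · exact hcl.comp (by fun_prop)
    · exact Finset.measurable_sum _ fun k _ => hcl.comp (by fun_prop)
  have hsum : ∀ ω, ∑ k ∈ Finset.univ.erase i, centeredLabel κ A (maskedSample X Y i ω k) =
      ∑ k ∈ Finset.univ.erase i, centeredLabel κ A (X k ω, Y k ω) := fun ω =>
    Finset.sum_congr rfl fun k hk => by rw [maskedSample_of_ne (Finset.ne_of_mem_erase hk)]
  have hψ1 : ∀ ω, ψ (maskedSample X Y i ω) (Y i ω) =
      (Y i ω - condMean κ (X i ω)) * ∑ k, centeredLabel κ A (X k ω, Y k ω) := fun ω => by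
    simp only [ψ, maskedSample_self, hsum]
    rw [Finset.add_sum_erase _ (fun k => centeredLabel κ A (X k ω, Y k ω)) (Finset.mem_univ i)]
  have hint : Integrable (fun ω => ψ (maskedSample X Y i ω) (Y i ω)) μ := by
    simp only [hψ1]
    exact MemLp.integrable_fun_mul ((hXY.memLp_Y hf hκ hM i).sub (hXY.memLp_condMean hf hM i))
      (memLp_finsetSum _ fun k _ => hXY.memLp_centeredLabel hf hκ hM hA k)
  have h1 := hhon.setIntegral_eq hXY.measurable_X hXY.measurable_Y i hψ hint.integrableOn
  simp only [hψ1] at h1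
  rw [h1]
  refine integral_congr_ae ?_
  filter_upwards [ae_restrict_of_ae (hXY.ae_mem_unitCube hf)] with ω hω
  simp only [ψ, maskedSample_self, hsum]
  simp only [centeredLabel]
  set c := ∑ k ∈ Finset.univ.erase i, A.indicator 1 (X k ω) * (Y k ω - condMean κ (X k ω))
  set a : ℝ := A.indicator 1 (X i ω)
  have hL2 : MemLp (fun y => y - condMean κ (X i ω)) 2 (κ (X i ω)) :=
    (hκ.memLp_id (hω i)).sub (memLp_const _)
  -- The other examples enter through `c`, constant in `y`, so their contribution has mean zero and
  -- only the variance term survives.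
  have hexp : ∀ y, (y - condMean κ (X i ω)) * (a * (y - condMean κ (X i ω)) + c) =
      a * (y - condMean κ (X i ω)) ^ 2 + c * (y - condMean κ (X i ω)) := fun y => by ring
  simp only [hexp]
  rw [integral_add (hL2.integrable_sq.const_mul _) ((hL2.integrable one_le_two).const_mul _),
    integral_const_mul, integral_const_mul, hκ.integral_sub_condMean (hω i),
    integral_sub_condMean_sq, mul_zero, add_zero]

/-- The expected distance, summed over the coordinates, between the selected and the test point. -/
noncomputable def selectedDist (μ : Measure Ω) (X : Fin s → Ω → (Fin d → ℝ)) (τ : Ω → SplitTree d)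
    (P : Ω → Finset (Fin s)) (x : Fin d → ℝ) : ℝ :=
  ∑ i, ∫ ω in selected X τ P x i, ∑ j, |X i ω j - x j| ∂μ

theorem dist_le_sum_abs_sub (u w : Fin d → ℝ) : dist u w ≤ ∑ j, |u j - w j| :=
  (dist_pi_le_iff (Finset.sum_nonneg fun _ _ => abs_nonneg _)).2 fun j =>
    Finset.single_le_sum (f := fun j => |u j - w j|) (fun _ _ => abs_nonneg _) (Finset.mem_univ j)

theorem dist_le_one_of_mem_unitCube {u w : Fin d → ℝ} (hu : u ∈ unitCube d) (hw : w ∈ unitCube d) :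
    dist u w ≤ 1 :=
  (dist_pi_le_iff zero_le_one).2 fun j => by
    have h1 := mem_unitCube_iff.1 hu j
    have h2 := mem_unitCube_iff.1 hw j
    rw [Real.dist_eq, abs_le]
    constructor <;> linarith [h1.1, h1.2, h2.1, h2.2]

theorem integrable_sum_abs_sub (hf : IsBoundedDensity f) (hXY : IsSample μ f κ X Y)
    (hx : x ∈ unitCube d) (i : Fin s) : Integrable (fun ω => ∑ j, |X i ω j - x j|) μ := by
  have hm := hXY.measurable_X i
  refine integrable_finsetSum _ fun j _ => Integrable.of_bound (C := 1) ?_ ?_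
  · exact (((measurable_pi_apply j).comp hm).sub_const (x j)).abs.aestronglyMeasurable
  · filter_upwards [hXY.ae_mem_unitCube hf] with ω hω
    rw [Real.norm_eq_abs, abs_abs, ← Real.dist_eq]
    exact (dist_le_pi_dist (X i ω) x j).trans (dist_le_one_of_mem_unitCube (hω i) hx)

theorem selectedDist_nonneg : 0 ≤ selectedDist μ X τ P x :=
  Finset.sum_nonneg fun _ _ => integral_nonneg fun _ => Finset.sum_nonneg fun _ _ => abs_nonneg _

/-- Lipschitz continuity replaces the conditional variance at the selected point by that at `x`, at
a cost proportional to the distance. -/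
theorem sub_selectedDist_le_sum (hf : IsBoundedDensity f) (hXY : IsSample μ f κ X Y)
    (hM : MomentBounds κ M K) (hreg : IsRegularTree μ X Y τ P π γ)
    (hx : x ∈ unitCube d) {A : Set (Fin d → ℝ)} (hA : MeasurableSet A) :
    variance id (κ x) * ∑ i, μ.real (selected X τ P x i ∩ X i ⁻¹' A) -
        K * selectedDist μ X τ P x ≤
      ∑ i, ∫ ω in selected X τ P x i, A.indicator 1 (X i ω) * variance id (κ (X i ω)) ∂μ := by
  have hsel := hreg.measurableSet_selected hXY x
  rw [selectedDist, Finset.mul_sum, Finset.mul_sum, ← Finset.sum_sub_distrib]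
  refine Finset.sum_le_sum fun i _ => ?_
  have hAi : MeasurableSet (X i ⁻¹' A) := hXY.measurable_X i hA
  have hDint := (integrable_sum_abs_sub hf hXY hx i).integrableOn (s := selected X τ P x i)
  have hone : IntegrableOn (fun ω => A.indicator (1 : (Fin d → ℝ) → ℝ) (X i ω))
      (selected X τ P x i) μ := by
    have := ((integrable_const (1 : ℝ)).indicator hAi).integrableOn (μ := μ)
      (s := selected X τ P x i)
    exact this
  have e1 : μ.real (selected X τ P x i ∩ X i ⁻¹' A) =
      ∫ ω in selected X τ P x i, A.indicator (1 : (Fin d → ℝ) → ℝ) (X i ω) ∂μ := by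
    have h1 : ∫ ω in selected X τ P x i, (X i ⁻¹' A).indicator (1 : Ω → ℝ) ω ∂μ =
        (μ.restrict (selected X τ P x i)).real (X i ⁻¹' A) := integral_indicator_one hAi
    rw [measureReal_restrict_apply hAi, Set.inter_comm] at h1
    exact h1.symm
  have hvm : Measurable fun u => variance id (κ u) := by
    have h2 : StronglyMeasurable fun z : (Fin d → ℝ) × ℝ => (z.2 - condMean κ z.1) ^ 2 :=
      ((measurable_snd.sub (measurable_condMean.comp measurable_fst)).pow_const 2).stronglyMeasurable
    have h3 := (h2.integral_kernel_prod_right' (κ := κ)).measurable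
    simpa only [integral_sub_condMean_sq] using h3
  rw [e1, ← integral_const_mul, ← integral_const_mul, ← integral_sub (hone.const_mul _)
    (hDint.const_mul _)]
  refine integral_mono_ae ((hone.const_mul _).sub (hDint.const_mul _)) ?_ ?_
  · refine Integrable.of_bound (C := M) (((measurable_one.indicator hA).comp
      (hXY.measurable_X i)).mul (hvm.comp (hXY.measurable_X i))).aestronglyMeasurable ?_
    filter_upwards [ae_restrict_of_ae (hXY.ae_mem_unitCube hf)] with ω hω
    have h0 := variance_nonneg id (κ (X i ω))
    by_cases h : X i ω ∈ A
    · simpa [h, abs_of_nonneg h0] using hM.variance_le _ (hω i)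
    · simpa [h] using zero_le_one.trans hM.one_le
  · filter_upwards [ae_restrict_of_ae (hXY.ae_mem_unitCube hf)] with ω hω
    have h1 := abs_le.1 (hM.abs_variance_sub_le _ (hω i) _ hx)
    have h2 := mul_le_mul_of_nonneg_left (dist_le_sum_abs_sub (X i ω) x) hM.nonneg
    have h3 : 0 ≤ K * ∑ j, |X i ω j - x j| :=
      mul_nonneg hM.nonneg (Finset.sum_nonneg fun _ _ => abs_nonneg _)
    by_cases h : X i ω ∈ A
    · simp only [h, Set.indicator_of_mem, Pi.one_apply, mul_one, one_mul]
      linarith [h1.1]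
    · simpa [h] using h3

/-- Lower bound for the covariance of the prediction with the test function. -/
theorem le_integral_treePrediction_mul (hf : IsBoundedDensity f) (hXY : IsSample μ f κ X Y)
    (hκ : HasLipschitzMoments κ) (hM : MomentBounds κ M K) (hreg : IsRegularTree μ X Y τ P π γ)
    (hhon : IsHonestAt μ κ X Y τ P x) (hx : x ∈ unitCube d) {A : Set (Fin d → ℝ)}
    (hA : MeasurableSet A) :
    variance id (κ x) * ∑ i, μ.real (selected X τ P x i ∩ X i ⁻¹' A) -
        K * selectedDist μ X τ P x -
        √(K ^ 2 * selectedDist μ X τ P x * (s * (M * (featureLaw f).real A))) ≤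
      ∫ ω, treePrediction X Y τ P x ω * ∑ i, centeredLabel κ A (X i ω, Y i ω) ∂μ := by
  have hsel := hreg.measurableSet_selected hXY x
  have hY := hXY.memLp_Y hf hκ hM
  have hm := hXY.memLp_condMean hf hM
  have hcl := hXY.memLp_centeredLabel hf hκ hM hA
  set H : Ω → ℝ := fun ω => ∑ i, centeredLabel κ A (X i ω, Y i ω)
  have hH : MemLp H 2 μ := memLp_finsetSum _ fun i _ => hcl i
  have hH0 : ∫ ω, H ω ∂μ = 0 := by
    rw [integral_finsetSum _ fun i _ => (hcl i).integrable one_le_two]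
    simp [hXY.integral_centeredLabel hf hκ hM hA]
  -- The bias of the selected label. It depends on the tree, hence possibly on all labels, so its
  -- covariance with `H` is only bounded by Cauchy–Schwarz.
  let G : Ω → ℝ := fun ω => ∑ i, (selected X τ P x i).indicator
    (fun ω => condMean κ (X i ω) - condMean κ x) ω
  have hG : MemLp G 2 μ := memLp_finsetSum _ fun i _ =>
    ((hm i).sub (memLp_const _)).indicator (hsel i)
  have hmain : ∀ i, Integrable ((selected X τ P x i).indicator
      fun ω => (Y i ω - condMean κ (X i ω)) * H ω) μ := fun i =>
    (MemLp.integrable_fun_mul ((hY i).sub (hm i)) hH).indicator (hsel i)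
  have hdecomp : ∀ᵐ ω ∂μ, treePrediction X Y τ P x ω * H ω =
      ∑ i, (selected X τ P x i).indicator (fun ω => (Y i ω - condMean κ (X i ω)) * H ω) ω +
        (G ω * H ω + condMean κ x * H ω) := by
    filter_upwards [hreg.fully_grown] with ω hω
    obtain ⟨i, -, hi⟩ := exists_sum_indicator_selected (M := ℝ) (hω x hx)
    simp only [treePrediction, G]
    rw [hi, hi, hi]
    ring
  have hGH : Integrable (fun ω => G ω * H ω) μ := MemLp.integrable_fun_mul hG hH
  have hcH : Integrable (fun ω => condMean κ x * H ω) μ := (hH.integrable one_le_two).const_mul _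
  have hrest : Integrable (fun ω => G ω * H ω + condMean κ x * H ω) μ := hGH.add hcH
  rw [integral_congr_ae hdecomp, integral_add (integrable_finsetSum _ fun i _ => hmain i) hrest, integral_finsetSum _ fun i _ => hmain i, integral_add hGH hcH,
    integral_const_mul, hH0, mul_zero, add_zero]
  have h1 : ∑ i, ∫ ω, (selected X τ P x i).indicator
      (fun ω => (Y i ω - condMean κ (X i ω)) * H ω) ω ∂μ =
      ∑ i, ∫ ω in selected X τ P x i, A.indicator 1 (X i ω) * variance id (κ (X i ω)) ∂μ :=
    Finset.sum_congr rfl fun i _ => by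
      rw [integral_indicator (hsel i), setIntegral_sub_condMean_mul hf hXY hκ hM hhon hA i]
  have h2 := sub_selectedDist_le_sum hf hXY hM hreg hx hA
  have hG2 : ∫ ω, G ω ^ 2 ∂μ ≤ K ^ 2 * selectedDist μ X τ P x := by
    have hle : ∀ᵐ ω ∂μ, G ω ^ 2 ≤ ∑ i, (selected X τ P x i).indicator
        (fun ω => K ^ 2 * ∑ j, |X i ω j - x j|) ω := by
      filter_upwards [hreg.fully_grown, hXY.ae_mem_unitCube hf] with ω hω hcube
      obtain ⟨i, -, hi⟩ := exists_sum_indicator_selected (M := ℝ) (hω x hx)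
      simp only [G]
      rw [hi, hi]
      have h3 := hM.abs_condMean_sub_le _ (hcube i) _ hx
      have h4 := dist_le_one_of_mem_unitCube (hcube i) hx
      have h5 := dist_le_sum_abs_sub (X i ω) x
      have h6 : (0 : ℝ) ≤ dist (X i ω) x := dist_nonneg
      calc _ = |condMean κ (X i ω) - condMean κ x| ^ 2 := (sq_abs _).symm
        _ ≤ (K * dist (X i ω) x) ^ 2 := pow_le_pow_left₀ (abs_nonneg _) h3 2
        _ = K ^ 2 * dist (X i ω) x ^ 2 := mul_pow _ _ _
        -- Distances in the cube are at most one, so the squared distance is bounded by the distance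
        -- and a first moment suffices.
        _ ≤ _ := mul_le_mul_of_nonneg_left (by nlinarith) (sq_nonneg K)
    have hint : ∀ i, Integrable ((selected X τ P x i).indicator
        fun ω => K ^ 2 * ∑ j, |X i ω j - x j|) μ := fun i =>
      ((integrable_sum_abs_sub hf hXY hx i).const_mul _).indicator (hsel i)
    refine (integral_mono_ae hG.integrable_sq (integrable_finsetSum _ fun i _ => hint i) hle).trans
      (le_of_eq ?_)
    rw [integral_finsetSum _ fun i _ => hint i, selectedDist, Finset.mul_sum]
    exact Finset.sum_congr rfl fun i _ => by rw [integral_indicator (hsel i), integral_const_mul]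
  have h3 := sq_integral_mul_le hG hH
  have h4 := hXY.integral_sum_centeredLabel_sq_le hf hκ hM hA
  have h5 : (∫ ω, G ω * H ω ∂μ) ^ 2 ≤
      K ^ 2 * selectedDist μ X τ P x * (s * (M * (featureLaw f).real A)) :=
    h3.trans (mul_le_mul hG2 h4 (integral_nonneg fun ω => sq_nonneg _)
      (mul_nonneg (sq_nonneg K) selectedDist_nonneg))
  have h6 := abs_le.1 (Real.abs_le_sqrt h5)
  rw [h1]
  linarith [h6.1]

end Prediction

/-! ### Rates -/

section Rates

variable {d : ℕ} {κ : Kernel (Fin d → ℝ) ℝ} [IsMarkovKernel κ]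
  {Ω : Type*} [mΩ : MeasurableSpace Ω] {μ : Measure Ω} [IsProbabilityMeasure μ] {s : ℕ}
  {f : (Fin d → ℝ) → ℝ} {X : Fin s → Ω → (Fin d → ℝ)} {Y : Fin s → Ω → ℝ}
  {τ : Ω → SplitTree d} {P : Ω → Finset (Fin s)} {π γ : ℝ} {x : Fin d → ℝ}

theorem selectedDist_le (hf : IsBoundedDensity f) {a b : ℝ} (ha0 : 0 < a) (hab : a ≤ b)
    (ha : ∀ u ∈ unitCube d, a ≤ f u) (hb : ∀ u ∈ unitCube d, f u ≤ b) (hs : 0 < s)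
    (hXY : IsSample μ f κ X Y) (hπ0 : 0 ≤ π) (hπ1 : π ≤ 1) (hγ0 : 0 < γ) (hγ1 : γ ≤ 1)
    (hreg : IsRegularTree μ X Y τ P π γ) (hx : x ∈ unitCube d) {n : ℕ} (hn : 6 < γ ^ n * s) :
    selectedDist μ X τ P x ≤ d * ((1 - π * (γ * a / (2 * b))) ^ n +
      2 * (16 * (8 * d * b + 3) ^ (3 * d) * (1 / (γ ^ (n + 1) / 3)) ^ (3 * d + 2) / s)) := by
  have hb0 : 0 < b := ha0.trans_le hab
  have hθ : 0 ≤ 1 - π * (γ * a / (2 * b)) := by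
    have h1 : γ * a / (2 * b) ≤ 1 := by
      rw [div_le_one (by positivity)]
      nlinarith
    have h2 : 0 ≤ γ * a / (2 * b) := by positivity
    nlinarith
  have hint : ∀ i j, Integrable (fun ω => |X i ω j - x j|) μ := fun i j => by
    refine (integrable_sum_abs_sub hf hXY hx i).mono ((((measurable_pi_apply j).comp
      (hXY.measurable_X i)).sub_const (x j)).abs.aestronglyMeasurable) (ae_of_all _ fun ω => ?_)
    rw [Real.norm_of_nonneg (abs_nonneg _), Real.norm_of_nonneg
      (Finset.sum_nonneg fun _ _ => abs_nonneg _)]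
    exact Finset.single_le_sum (f := fun j => |X i ω j - x j|) (fun _ _ => abs_nonneg _)
      (Finset.mem_univ j)
  have e : selectedDist μ X τ P x = ∑ j, ∑ i, ∫ ω in selected X τ P x i, |X i ω j - x j| ∂μ := by
    rw [selectedDist, Finset.sum_comm]
    exact Finset.sum_congr rfl fun i _ => integral_finsetSum _ fun j _ => (hint i j).integrableOn
  rw [e]
  calc _ ≤ ∑ j : Fin d, _ := Finset.sum_le_sum fun j _ => ?_
    _ = _ := by rw [Finset.sum_const, nsmul_eq_mul, Finset.card_univ, Fintype.card_fin]
  have key := sum_lintegral_abs_sub_le hf ha0 hab ha hb hs hXY hπ0 hπ1 hγ0 hγ1 hreg hx hn j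
  have h2 : (0 : ℝ) ≤ 16 * (8 * d * b + 3) ^ (3 * d) *
      (1 / (γ ^ (n + 1) / 3)) ^ (3 * d + 2) / s := by positivity
  have h3 : ∑ i, ∫⁻ ω in selected X τ P x i, ENNReal.ofReal |X i ω j - x j| ∂μ =
      ENNReal.ofReal (∑ i, ∫ ω in selected X τ P x i, |X i ω j - x j| ∂μ) := by
    rw [ENNReal.ofReal_sum_of_nonneg fun i _ => integral_nonneg fun ω => abs_nonneg _]
    exact Finset.sum_congr rfl fun i _ =>
      (ofReal_integral_eq_lintegral_ofReal (hint i j).integrableOn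
        (ae_of_all _ fun ω => abs_nonneg _)).symm
  rw [h3, ← ENNReal.ofReal_ofNat 2, ← ENNReal.ofReal_mul zero_le_two,
    ← ENNReal.ofReal_add (pow_nonneg hθ n) (mul_nonneg zero_le_two h2)] at key
  exact (ENNReal.ofReal_le_ofReal_iff (add_nonneg (pow_nonneg hθ n)
    (mul_nonneg zero_le_two h2))).1 key

theorem tendsto_rpow_neg_mul_log_pow {c : ℝ} (hc : 0 < c) (k : ℕ) :
    Tendsto (fun s : ℕ => (s : ℝ) ^ (-c) * Real.log s ^ k) atTop (𝓝 0) := by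
  have h1 := (isLittleO_log_rpow_rpow_atTop (k : ℝ) hc).tendsto_div_nhds_zero
  refine (h1.comp tendsto_natCast_atTop_atTop).congr' ?_
  filter_upwards [eventually_gt_atTop 0] with s hs
  simp only [Function.comp_apply]
  rw [Real.rpow_natCast, Real.rpow_neg (Nat.cast_nonneg s), div_eq_mul_inv, mul_comm]

/-- The factor `ρ⁻¹` pays for rounding the exponent down. -/
theorem pow_natFloor_log_le {ρ w : ℝ} (hρ0 : 0 < ρ) (hρ1 : ρ ≤ 1) {s : ℝ} (hs : 1 ≤ s) :
    ρ ^ ⌊w * Real.log s⌋₊ ≤ ρ⁻¹ * s ^ (-(-Real.log ρ * w)) := by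
  have h1 := Nat.lt_floor_add_one (w * Real.log s)
  have hs0 : 0 < s := by linarith
  have h2 : Real.log ρ ≤ 0 := Real.log_nonpos hρ0.le hρ1
  rw [← Real.exp_log (pow_pos hρ0 _), Real.log_pow, Real.rpow_def_of_pos hs0,
    ← Real.exp_log (inv_pos.2 hρ0), Real.log_inv, ← Real.exp_add]
  refine Real.exp_le_exp.2 ?_
  nlinarith

theorem inv_pow_natFloor_log_le {γ w : ℝ} (hγ0 : 0 < γ) (hγ1 : γ ≤ 1) (hw : 0 ≤ w) {s : ℝ}
    (hs : 1 ≤ s) : (γ ^ ⌊w * Real.log s⌋₊)⁻¹ ≤ s ^ (-Real.log γ * w) := by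
  have hs0 : 0 < s := by linarith
  have h1 := Nat.floor_le (mul_nonneg hw (Real.log_nonneg hs))
  have h2 : Real.log γ ≤ 0 := Real.log_nonpos hγ0.le hγ1
  rw [← Real.exp_log (inv_pos.2 (pow_pos hγ0 _)), Real.log_inv, Real.log_pow,
    Real.rpow_def_of_pos hs0]
  refine Real.exp_le_exp.2 ?_
  nlinarith

/-- The selected point approaches the test point faster than any power of `log s`. -/
theorem tendsto_rate_mul_log_pow {D ρ γ B : ℝ} (hD : 0 ≤ D) (hρ0 : 0 < ρ) (hρ1 : ρ < 1)
    (hγ0 : 0 < γ) (hγ1 : γ < 1) (hB : 0 ≤ B) (q k : ℕ) (hq : 0 < q) {R : ℕ → ℝ}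
    (hR0 : ∀ s, 0 ≤ R s)
    (hR : ∀ s n : ℕ, 0 < s → 6 < γ ^ n * s →
      R s ≤ D * (ρ ^ n + 2 * (B * (1 / (γ ^ (n + 1) / 3)) ^ q / s))) :
    Tendsto (fun s => R s * Real.log s ^ k) atTop (𝓝 0) := by
  have hlγ : 0 < -Real.log γ := neg_pos.2 (Real.log_neg hγ0 hγ1)
  have hlρ : 0 < -Real.log ρ := neg_pos.2 (Real.log_neg hρ0 hρ1)
  have hq' : (0 : ℝ) < q := by exact_mod_cast hq
  -- For `n = ⌊w log s⌋` this gives `γ ^ (-(n q)) ≤ s ^ (1 / 2)`, so the deviation probability stays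
  -- of order `s ^ (-1 / 2)` while `ρ ^ n` still decays like a power of `s`.
  set w : ℝ := 1 / (2 * q * -Real.log γ) with hw
  have hw0 : 0 < w := by positivity
  have hwq : -Real.log γ * w = 1 / (2 * q) := by
    have hne := (neg_pos.1 hlγ).ne
    rw [hw]
    field_simp
  have hbound : ∀ᶠ s : ℕ in atTop, R s ≤ D * ρ⁻¹ * (s : ℝ) ^ (-(-Real.log ρ * w)) +
      D * (2 * (B * (3 / γ) ^ q)) * (s : ℝ) ^ (-(1 / 2 : ℝ)) := by
    -- Beyond `36` the square root of `s` exceeds `6`, and `γ ^ n * s` is at least that square root.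
    filter_upwards [eventually_gt_atTop 36] with s hs
    have hs1 : (36 : ℝ) < s := by exact_mod_cast hs
    have hs0 : (0 : ℝ) < s := by linarith
    set n := ⌊w * Real.log s⌋₊
    have h1 : ρ ^ n ≤ ρ⁻¹ * (s : ℝ) ^ (-(-Real.log ρ * w)) :=
      pow_natFloor_log_le hρ0 hρ1.le (by linarith)
    have h2 : (γ ^ n)⁻¹ ≤ (s : ℝ) ^ (1 / (2 * q) : ℝ) := by
      rw [← hwq]
      exact inv_pow_natFloor_log_le hγ0 hγ1.le hw0.le (by linarith)
    have hγn : 0 < γ ^ n := pow_pos hγ0 n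
    have h3 : ((γ ^ n)⁻¹) ^ q ≤ (s : ℝ) ^ (1 / 2 : ℝ) := by
      calc _ ≤ ((s : ℝ) ^ (1 / (2 * q) : ℝ)) ^ q := pow_le_pow_left₀ (by positivity) h2 q
        _ = _ := by
            rw [← Real.rpow_natCast, ← Real.rpow_mul hs0.le]
            congr 1
            field_simp
    have h4 : (s : ℝ) ^ (1 / 2 : ℝ) * (s : ℝ) ^ (1 / 2 : ℝ) = s := by
      rw [← Real.rpow_add hs0]; norm_num
    have hsq0 : 0 < (s : ℝ) ^ (1 / 2 : ℝ) := Real.rpow_pos_of_pos hs0 _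
    have h5 : 6 < γ ^ n * s := by
      have h6 : (γ ^ n)⁻¹ ≤ (s : ℝ) ^ (1 / 2 : ℝ) := by
        refine h2.trans (Real.rpow_le_rpow_of_exponent_le (by linarith) ?_)
        have : (1 : ℝ) ≤ q := by exact_mod_cast hq
        exact one_div_le_one_div_of_le two_pos (by linarith)
      have h7 : 6 < (s : ℝ) ^ (1 / 2 : ℝ) := by nlinarith
      have h8 : 1 ≤ γ ^ n * (s : ℝ) ^ (1 / 2 : ℝ) := by
        rwa [inv_le_iff_one_le_mul₀ hγn, mul_comm] at h6
      nlinarith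
    have h9 := hR s n (by omega) h5
    have h10 : (1 / (γ ^ (n + 1) / 3)) ^ q / s ≤ (3 / γ) ^ q * (s : ℝ) ^ (-(1 / 2 : ℝ)) := by
      have e1 : (1 / (γ ^ (n + 1) / 3)) ^ q = (3 / γ) ^ q * ((γ ^ n)⁻¹) ^ q := by
        rw [← mul_pow]; congr 1; rw [pow_succ]; field_simp
      have e2 : (s : ℝ) ^ (-(1 / 2 : ℝ)) = (s : ℝ) ^ (1 / 2 : ℝ) / s := by
        rw [Real.rpow_neg hs0.le, eq_div_iff hs0.ne', inv_mul_eq_iff_eq_mul₀ hsq0.ne']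
        exact h4.symm
      rw [e1, e2, ← mul_div_assoc]
      gcongr
    calc _ ≤ _ := h9
      _ ≤ D * (ρ⁻¹ * (s : ℝ) ^ (-(-Real.log ρ * w)) +
            2 * (B * ((3 / γ) ^ q * (s : ℝ) ^ (-(1 / 2 : ℝ))))) := by
          rw [mul_div_assoc]
          gcongr
      _ = _ := by ring
  have hlim := ((tendsto_rpow_neg_mul_log_pow (mul_pos hlρ hw0) k).const_mul (D * ρ⁻¹)).add
    ((tendsto_rpow_neg_mul_log_pow (c := 1 / 2) (by norm_num) k).const_mul
      (D * (2 * (B * (3 / γ) ^ q))))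
  simp only [mul_zero, add_zero] at hlim
  refine squeeze_zero' ?_ ?_ hlim
  · filter_upwards [eventually_ge_atTop 1] with s hs
    exact mul_nonneg (hR0 s) (pow_nonneg (Real.log_nonneg (by exact_mod_cast hs)) k)
  · filter_upwards [hbound, eventually_ge_atTop 1] with s h hs
    refine (mul_le_mul_of_nonneg_right h
      (pow_nonneg (Real.log_nonneg (by exact_mod_cast hs)) k)).trans (le_of_eq ?_)
    ring

end Rates

/-! ### Incrementality -/

section Incremental

/-- `volume_spannedVolume_le` with the exponent `1 - 1 / log s`. -/
theorem volume_real_spannedVolume_le {m : ℕ} {x : Fin (m + 1) → ℝ} (hx : x ∈ unitCube (m + 1))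
    {s : ℝ} (hs : 0 < s) (hs1 : 1 < Real.log s) {v : ℝ} (hv : 1 / s ≤ 2 * v) :
    volume.real (unitCube (m + 1) ∩ {u | spannedVolume x u ≤ v}) ≤
      2 * v * Real.exp 1 * (2 * Real.log s) ^ m := by
  set L := Real.log s
  have hL0 : 0 < L := by linarith
  have hv0 : 0 < 2 * v := (by positivity : 0 < 1 / s).trans_le hv
  have hl1 : 1 - 1 / L < 1 := by have := one_div_pos.2 hL0; linarith
  have hl0 : 0 < 1 - 1 / L := by
    have : 1 / L < 1 := by rw [div_lt_one hL0]; exact hs1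
    linarith
  have h := volume_spannedVolume_le hx (v := v) (by linarith) hl0 hl1
  have h1 : 0 ≤ 2 / (1 - (1 - 1 / L)) := div_nonneg zero_le_two (by linarith)
  rw [ENNReal.ofReal_rpow_of_nonneg hv0.le hl0.le, ← ENNReal.ofReal_pow h1,
    ← ENNReal.ofReal_mul (Real.rpow_nonneg hv0.le _)] at h
  have h2 := ENNReal.toReal_mono ENNReal.ofReal_ne_top h
  rw [ENNReal.toReal_ofReal (mul_nonneg (Real.rpow_nonneg hv0.le _) (pow_nonneg h1 m))] at h2
  refine h2.trans ?_
  have e1 : 2 / (1 - (1 - 1 / L)) = 2 * L := by rw [sub_sub_cancel]; field_simp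
  -- Lowering the exponent by `1 / log s` costs only a factor `e`, because `2 * v` is not below `1 /
  -- s`.
  have e2 : (2 * v) ^ (1 - 1 / L) ≤ 2 * v * Real.exp 1 := by
    rw [Real.rpow_sub hv0, Real.rpow_one, div_eq_mul_inv, ← Real.rpow_neg hv0.le,
      Real.rpow_def_of_pos hv0]
    refine mul_le_mul_of_nonneg_left (Real.exp_le_exp.2 ?_) hv0.le
    have h3 : -L ≤ Real.log (2 * v) := by
      have := Real.log_le_log (by positivity) hv
      rwa [one_div, Real.log_inv] at this
    rw [mul_neg, mul_one_div, ← neg_div, div_le_one hL0]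
    linarith
  rw [e1]
  exact mul_le_mul_of_nonneg_right e2 (pow_nonneg (by linarith) m)

variable {d : ℕ} {κ : Kernel (Fin d → ℝ) ℝ} [IsMarkovKernel κ]
  {Ω : Type*} [mΩ : MeasurableSpace Ω] {μ : Measure Ω} [IsProbabilityMeasure μ] {s : ℕ}
  {f : (Fin d → ℝ) → ℝ} {X : Fin s → Ω → (Fin d → ℝ)} {Y : Fin s → Ω → ℝ}
  {τ : Ω → SplitTree d} {P : Ω → Finset (Fin s)} {π γ : ℝ} {x : Fin d → ℝ}

theorem measureReal_selected_inter_le (hf : IsBoundedDensity f) {a : ℝ} (ha0 : 0 < a)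
    (ha : ∀ u ∈ unitCube d, a ≤ f u) (hXY : IsSample μ f κ X Y)
    (hreg : IsRegularTree μ X Y τ P π γ) (hx : x ∈ unitCube d) (i : Fin s) {v : ℝ} (hv : 0 ≤ v)
    {B : Set (Fin d → ℝ)} (hB : MeasurableSet B)
    (hBv : ∀ u ∈ B, u ∈ unitCube d ∧ v ≤ spannedVolume x u) :
    μ.real (selected X τ P x i ∩ X i ⁻¹' B) ≤
      Real.exp (-((s / 2 - 1) * (a * v))) * (featureLaw f).real B := by
  have := hf.isProbabilityMeasure
  have h := ENNReal.toReal_mono (ENNReal.mul_ne_top ENNReal.ofReal_ne_top (measure_ne_top _ _))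
    (measure_selected_inter_le hf ha0 ha hXY hreg hx i hv hB hBv)
  rwa [ENNReal.toReal_mul, ENNReal.toReal_ofReal (Real.exp_pos _).le] at h

/-- The selected point is likely to span with the test point a box of small volume. -/
theorem one_sub_le_sum_measureReal (hf : IsBoundedDensity f) {a : ℝ} (ha0 : 0 < a)
    (ha : ∀ u ∈ unitCube d, a ≤ f u) (hXY : IsSample μ f κ X Y)
    (hreg : IsRegularTree μ X Y τ P π γ) (hx : x ∈ unitCube d) {v w : ℝ} (hv : 0 ≤ v) (hw : 0 ≤ w) :
    1 - s * (Real.exp (-((s / 2 - 1) * (a * v))) *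
        (featureLaw f).real (unitCube d ∩ {u | spannedVolume x u ≤ w}) +
        Real.exp (-((s / 2 - 1) * (a * w)))) ≤
      ∑ i, μ.real (selected X τ P x i ∩
        X i ⁻¹' (unitCube d ∩ {u | spannedVolume x u ≤ v})) := by
  have hprob := hf.isProbabilityMeasure
  have hV := (continuous_spannedVolume x).measurable
  have hC := measurableSet_unitCube d
  -- Two scales: for `B₁` the exponential is helped by the small mass of the shell, while for `B₂`
  -- the exponential is small enough alone and the mass is bounded by one.
  let B₁ : Set (Fin d → ℝ) := unitCube d ∩ {u | v ≤ spannedVolume x u ∧ spannedVolume x u ≤ w}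
  let B₂ : Set (Fin d → ℝ) := unitCube d ∩ {u | w ≤ spannedVolume x u}
  have hB₁ : MeasurableSet B₁ :=
    hC.inter ((measurableSet_le measurable_const hV).inter (measurableSet_le hV measurable_const))
  have hB₂ : MeasurableSet B₂ := hC.inter (measurableSet_le measurable_const hV)
  have hterm : ∀ i, μ.real (selected X τ P x i) ≤
      μ.real (selected X τ P x i ∩ X i ⁻¹' (unitCube d ∩ {u | spannedVolume x u ≤ v})) +
        (Real.exp (-((s / 2 - 1) * (a * v))) *
          (featureLaw f).real (unitCube d ∩ {u | spannedVolume x u ≤ w}) +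
          Real.exp (-((s / 2 - 1) * (a * w)))) := fun i => by
    have h1 := measureReal_selected_inter_le hf ha0 ha hXY hreg hx i hv hB₁
      fun u hu => ⟨hu.1, hu.2.1⟩
    have h2 := measureReal_selected_inter_le hf ha0 ha hXY hreg hx i hw hB₂
      fun u hu => ⟨hu.1, hu.2⟩
    have h3 : (featureLaw f).real B₁ ≤
        (featureLaw f).real (unitCube d ∩ {u | spannedVolume x u ≤ w}) :=
      measureReal_mono fun u hu => ⟨hu.1, hu.2.2⟩
    have h4 : (featureLaw f).real B₂ ≤ 1 := measureReal_le_one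
    have h5 : μ.real (selected X τ P x i) ≤
        μ.real (selected X τ P x i ∩ X i ⁻¹' (unitCube d ∩ {u | spannedVolume x u ≤ v}) ∪
          (selected X τ P x i ∩ X i ⁻¹' B₁ ∪ selected X τ P x i ∩ X i ⁻¹' B₂)) := by
      refine ENNReal.toReal_mono (measure_ne_top _ _) (measure_mono_ae ?_)
      filter_upwards [hXY.ae_mem_unitCube hf] with ω hω hsel
      rcases le_total (spannedVolume x (X i ω)) v with h | h
      · exact Or.inl ⟨hsel, hω i, h⟩
      · rcases le_total (spannedVolume x (X i ω)) w with h' | h'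
        · exact Or.inr (Or.inl ⟨hsel, hω i, h, h'⟩)
        · exact Or.inr (Or.inr ⟨hsel, hω i, h'⟩)
    have h6 := measureReal_union_le (μ := μ)
      (selected X τ P x i ∩ X i ⁻¹' (unitCube d ∩ {u | spannedVolume x u ≤ v}))
      (selected X τ P x i ∩ X i ⁻¹' B₁ ∪ selected X τ P x i ∩ X i ⁻¹' B₂)
    have h7 := measureReal_union_le (μ := μ) (selected X τ P x i ∩ X i ⁻¹' B₁)
      (selected X τ P x i ∩ X i ⁻¹' B₂)
    have h8 := mul_le_mul_of_nonneg_left h3 (Real.exp_pos (-((s / 2 - 1) * (a * v)))).le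
    have h9 := mul_le_mul_of_nonneg_left h4 (Real.exp_pos (-((s / 2 - 1) * (a * w)))).le
    linarith
  have hsum := Finset.sum_le_sum fun i (_ : i ∈ Finset.univ) => hterm i
  rw [sum_measureReal_selected hXY hreg hx, Finset.sum_add_distrib, Finset.sum_const, nsmul_eq_mul,
    Finset.card_univ, Fintype.card_fin] at hsum
  linarith

/-- The ratio of the variances of the projection and of the prediction, from a lower bound for the
covariance with the test function. -/
theorem le_variance_hajekProjection_div (hf : IsBoundedDensity f) (hXY : IsSample μ f κ X Y)
    (hκ : HasLipschitzMoments κ) {M K : ℝ} (hM : MomentBounds κ M K)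
    (hreg : IsRegularTree μ X Y τ P π γ) (hhon : IsHonestAt μ κ X Y τ P x) (hx : x ∈ unitCube d)
    {A : Set (Fin d → ℝ)} (hA : MeasurableSet A) {c D : ℝ} (hc : 0 < c) (hD : 0 < D)
    (hcov : c ≤ variance id (κ x) * ∑ i, μ.real (selected X τ P x i ∩ X i ⁻¹' A) -
      K * selectedDist μ X τ P x -
        √(K ^ 2 * selectedDist μ X τ P x * (s * (M * (featureLaw f).real A))))
    (hAD : s * (featureLaw f).real A ≤ D) :
    c ^ 2 / (M ^ 2 * D) ≤ variance (hajekProjection μ (fun i ω => (X i ω, Y i ω))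
      (treePrediction X Y τ P x)) μ / variance (treePrediction X Y τ P x) μ := by
  have hT := memLp_treePrediction (x := x) hf hXY hκ hM hreg
  have hZ : ∀ i, Measurable fun ω => (X i ω, Y i ω) := fun i =>
    (hXY.measurable_X i).prodMk (hXY.measurable_Y i)
  have hL2 := hXY.memLp_centeredLabel hf hκ hM hA
  have h0 := hXY.integral_centeredLabel hf hκ hM hA
  have hM0 : 0 < M := zero_lt_one.trans_le hM.one_le
  have h1 := le_integral_treePrediction_mul hf hXY hκ hM hreg hhon hx hA
  have h2 := sq_integral_mul_le_variance_hajekProjection hZ hXY.indep hT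
    (measurable_centeredLabel hA) hL2 h0
  have h3 := sq_integral_mul_le_variance hT (memLp_finsetSum Finset.univ fun i _ => hL2 i) (by
    rw [integral_finsetSum _ fun i _ => (hL2 i).integrable one_le_two]
    simp [h0])
  have h4 : ∫ ω, (∑ i, centeredLabel κ A (X i ω, Y i ω)) ^ 2 ∂μ ≤ M * D := by
    refine (hXY.integral_sum_centeredLabel_sq_le hf hκ hM hA).trans ?_
    rw [mul_left_comm]
    exact mul_le_mul_of_nonneg_left hAD hM0.le
  have h5 : c ^ 2 ≤ (∫ ω, treePrediction X Y τ P x ω *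
      ∑ i, centeredLabel κ A (X i ω, Y i ω) ∂μ) ^ 2 :=
    pow_le_pow_left₀ hc.le (hcov.trans h1) 2
  have h6 := variance_treePrediction_le hf hXY hκ hM hreg hhon hx
  have hV0 : 0 ≤ variance (treePrediction X Y τ P x) μ := variance_nonneg _ _
  have hH0 : 0 ≤ variance (hajekProjection μ (fun i ω => (X i ω, Y i ω))
      (treePrediction X Y τ P x)) μ := variance_nonneg _ _
  -- Zero variance would force the covariance to vanish, contrary to its positive lower bound.
  have hV : 0 < variance (treePrediction X Y τ P x) μ := by
    refine hV0.lt_of_ne fun h => ?_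
    rw [← h, zero_mul] at h3
    have := pow_pos hc 2
    linarith
  have h7 : c ^ 2 ≤ variance (hajekProjection μ (fun i ω => (X i ω, Y i ω))
      (treePrediction X Y τ P x)) μ * (M * D) :=
    h5.trans (h2.trans (mul_le_mul_of_nonneg_left h4 hH0))
  rw [div_le_div_iff₀ (by positivity) hV]
  calc _ ≤ c ^ 2 * M := mul_le_mul_of_nonneg_left h6 (sq_nonneg c)
    _ ≤ _ := by nlinarith

theorem IsRegularTree.mono {Ω : Type*} [MeasurableSpace Ω] {μ : Measure Ω} {d s : ℕ}
    {X : Fin s → Ω → (Fin d → ℝ)} {Y : Fin s → Ω → ℝ} {τ : Ω → SplitTree d}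
    {P : Ω → Finset (Fin s)} {π γ π' γ' : ℝ} (h : IsRegularTree μ X Y τ P π γ) (hπ : π' ≤ π)
    (hγ : γ' ≤ γ) : IsRegularTree μ X Y τ P π' γ' where
  measurable_tree := h.measurable_tree
  measurable_pred := h.measurable_pred
  split_prob v j E hE :=
    (mul_le_mul_of_nonneg_right hπ measureReal_nonneg).trans (h.split_prob v j E hE)
  balanced := h.balanced.imp (fun h => h.mono fun _ h => h.mono hγ)
    fun h => h.mono fun _ h => h.mono hγ
  pred_indep := h.pred_indep
  pred_card := h.pred_card
  fully_grown := h.fully_grown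

/-- The mass that the law of the examples gives to the points that span with `x` a box of volume at
most `v`. -/
theorem featureLaw_real_spannedVolume_le {m : ℕ} {f : (Fin (m + 1) → ℝ) → ℝ} {b : ℝ} (hb0 : 0 ≤ b)
    (hb : ∀ u ∈ unitCube (m + 1), f u ≤ b) {x : Fin (m + 1) → ℝ} (hx : x ∈ unitCube (m + 1))
    {s : ℝ} (hs : 0 < s) (hs1 : 1 < Real.log s) {v : ℝ} (hv : 1 / s ≤ 2 * v) :
    (featureLaw f).real (unitCube (m + 1) ∩ {u | spannedVolume x u ≤ v}) ≤
      b * (2 * v * Real.exp 1 * (2 * Real.log s) ^ m) := by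
  have hA : MeasurableSet (unitCube (m + 1) ∩ {u | spannedVolume x u ≤ v}) :=
    (measurableSet_unitCube _).inter
      (measurableSet_le (continuous_spannedVolume x).measurable measurable_const)
  have h := featureLaw_real_le hb0 hb hA
  rw [Set.inter_eq_left.2 Set.inter_subset_left] at h
  exact h.trans (mul_le_mul_of_nonneg_left (volume_real_spannedVolume_le hx hs hs1 hv) hb0)

/-! ### Bounds for a fixed sample size -/

section Sample

variable {m : ℕ} {κ : Kernel (Fin (m + 1) → ℝ) ℝ} [IsMarkovKernel κ]
  {Ω : Type*} [mΩ : MeasurableSpace Ω] {μ : Measure Ω} [IsProbabilityMeasure μ] {s : ℕ}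
  {f : (Fin (m + 1) → ℝ) → ℝ} {X : Fin s → Ω → (Fin (m + 1) → ℝ)} {Y : Fin s → Ω → ℝ}
  {τ : Ω → SplitTree (m + 1)} {P : Ω → Finset (Fin s)} {π γ a b : ℝ} {x : Fin (m + 1) → ℝ}

/-- With high probability, the selected point spans with the test point a box of volume at most
`log (log s) / s`, up to a constant. -/
theorem one_sub_div_log_le_sum_measureReal (hf : IsBoundedDensity f) (ha0 : 0 < a) (hb0 : 0 ≤ b)
    (ha : ∀ u ∈ unitCube (m + 1), a ≤ f u) (hb : ∀ u ∈ unitCube (m + 1), f u ≤ b)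
    (hXY : IsSample μ f κ X Y) (hreg : IsRegularTree μ X Y τ P π γ) (hx : x ∈ unitCube (m + 1))
    (hs : 4 ≤ s) (hs1 : 1 < Real.log s) (hs2 : 1 ≤ 2 * (8 / a * Real.log s)) :
    1 - (b * (2 * (8 / a) * Real.exp 1 * 2 ^ m) / Real.log s + 1 / s) ≤
      ∑ i, μ.real (selected X τ P x i ∩ X i ⁻¹' (unitCube (m + 1) ∩
        {u | spannedVolume x u ≤ 4 * (m + 2) / a * Real.log (Real.log s) / s})) := by
  have hs4 : (4 : ℝ) ≤ s := by exact_mod_cast hs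
  have hs0 : (0 : ℝ) < s := by linarith
  set L := Real.log s with hL
  have hL0 : 0 < L := by linarith
  have hl0 : 0 < Real.log L := Real.log_pos hs1
  have hlarge : (s : ℝ) / 4 ≤ s / 2 - 1 := by linarith
  -- The choice of `v` gives `exp ≤ L ^ (-(m + 2))`, one power more than needed against a shell of
  -- mass of order `L ^ (m + 1) / s`. The choice of `w` gives `exp ≤ s ^ (-2)`, which survives the
  -- sum over `s` indices.
  refine le_trans ?_ (one_sub_le_sum_measureReal hf ha0 ha hXY hreg hx
    (v := 4 * (m + 2) / a * Real.log L / s) (w := 8 / a * L / s) (by positivity) (by positivity))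
  have h1 : Real.exp (-((s / 2 - 1) * (a * (4 * (m + 2) / a * Real.log L / s)))) ≤
      (L ^ (m + 2))⁻¹ := by
    have e : (L ^ (m + 2))⁻¹ = Real.exp (-((m + 2) * Real.log L)) := by
      rw [Real.exp_neg]
      congr 1
      rw [← Real.exp_log (pow_pos hL0 (m + 2)), Real.log_pow]
      push_cast
      rfl
    rw [e]
    refine Real.exp_le_exp.2 (neg_le_neg ?_)
    calc ((m : ℝ) + 2) * Real.log L
        = s / 4 * (a * (4 * (m + 2) / a * Real.log L / s)) := by field_simp
      _ ≤ _ := mul_le_mul_of_nonneg_right hlarge (by positivity)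
  have h2 : Real.exp (-((s / 2 - 1) * (a * (8 / a * L / s)))) ≤ 1 / s * (1 / s) := by
    have e : 1 / (s : ℝ) * (1 / s) = Real.exp (-(2 * L)) := by
      rw [two_mul, neg_add, Real.exp_add, Real.exp_neg, hL, Real.exp_log hs0, one_div]
    rw [e]
    refine Real.exp_le_exp.2 (neg_le_neg ?_)
    calc 2 * L = s / 4 * (a * (8 / a * L / s)) := by field_simp; norm_num
      _ ≤ _ := mul_le_mul_of_nonneg_right hlarge (by positivity)
  have h3 := featureLaw_real_spannedVolume_le hb0 hb hx hs0 hs1 (v := 8 / a * L / s) (by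
    rw [← mul_div_assoc]
    gcongr)
  refine sub_le_sub_left ?_ 1
  calc _ ≤ (s : ℝ) * ((L ^ (m + 2))⁻¹ *
        (b * (2 * (8 / a * L / s) * Real.exp 1 * (2 * L) ^ m)) + 1 / s * (1 / s)) := by gcongr
    _ = _ := by
      rw [mul_pow]
      field_simp
      ring

/-- The lower bound for the ratio of the variances, for a sample of a given size. -/
theorem le_variance_ratio (hf : IsBoundedDensity f) (ha0 : 0 < a) (hb0 : 0 < b)
    (ha : ∀ u ∈ unitCube (m + 1), a ≤ f u) (hb : ∀ u ∈ unitCube (m + 1), f u ≤ b)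
    (hXY : IsSample μ f κ X Y) (hκ : HasLipschitzMoments κ) {M K : ℝ} (hM : MomentBounds κ M K)
    (hreg : IsRegularTree μ X Y τ P π γ) (hhon : IsHonestAt μ κ X Y τ P x)
    (hx : x ∈ unitCube (m + 1)) (hs : 4 ≤ s) (hs1 : 1 < Real.log s)
    (hs2 : 1 ≤ 2 * (8 / a * Real.log s))
    (hs3 : 1 ≤ 2 * (4 * (m + 2) / a * Real.log (Real.log s))) {c C D : ℝ} (hc : 0 < c)
    (hC : C = b * (2 * (4 * (m + 2) / a) * Real.exp 1 * 2 ^ m))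
    (hD : D = C * (Real.log (Real.log s) * Real.log s ^ m))
    (hcov : c ≤ variance id (κ x) *
        (1 - (b * (2 * (8 / a) * Real.exp 1 * 2 ^ m) / Real.log s + 1 / s)) -
      K * selectedDist μ X τ P x - √(K ^ 2 * selectedDist μ X τ P x * (M * D))) :
    c ^ 2 / (M ^ 2 * D) ≤ variance (hajekProjection μ (fun i ω => (X i ω, Y i ω))
      (treePrediction X Y τ P x)) μ / variance (treePrediction X Y τ P x) μ := by
  have hs4 : (4 : ℝ) ≤ s := by exact_mod_cast hs
  have hs0 : (0 : ℝ) < s := by linarith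
  have hl0 : 0 < Real.log (Real.log s) := Real.log_pos hs1
  have hL0 : 0 < Real.log s := by linarith
  have hM0 : 0 ≤ M := zero_le_one.trans hM.one_le
  have hR0 : 0 ≤ selectedDist μ X τ P x := selectedDist_nonneg
  have hD0 : 0 < D := by rw [hD, hC]; positivity
  have hA : MeasurableSet (unitCube (m + 1) ∩
      {u | spannedVolume x u ≤ 4 * (m + 2) / a * Real.log (Real.log s) / s}) :=
    (measurableSet_unitCube _).inter
      (measurableSet_le (continuous_spannedVolume x).measurable measurable_const)
  have hAD : s * (featureLaw f).real (unitCube (m + 1) ∩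
      {u | spannedVolume x u ≤ 4 * (m + 2) / a * Real.log (Real.log s) / s}) ≤ D := by
    have h := featureLaw_real_spannedVolume_le hb0.le hb hx hs0 hs1
      (v := 4 * (m + 2) / a * Real.log (Real.log s) / s) (by
        rw [← mul_div_assoc]
        gcongr)
    calc _ ≤ (s : ℝ) * _ := mul_le_mul_of_nonneg_left h hs0.le
      _ = D := by
        rw [hD, hC, mul_pow]
        field_simp
  refine le_variance_hajekProjection_div hf hXY hκ hM hreg hhon hx hA hc hD0 (hcov.trans ?_) hAD
  have h1 := mul_le_mul_of_nonneg_left (one_sub_div_log_le_sum_measureReal hf ha0 hb0.le ha hb hXY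
    hreg hx hs hs1 hs2) (variance_nonneg id (κ x))
  have h2 : √(K ^ 2 * selectedDist μ X τ P x * (s * (M * (featureLaw f).real (unitCube (m + 1) ∩
      {u | spannedVolume x u ≤ 4 * (m + 2) / a * Real.log (Real.log s) / s})))) ≤
      √(K ^ 2 * selectedDist μ X τ P x * (M * D)) := by
    refine Real.sqrt_le_sqrt (mul_le_mul_of_nonneg_left ?_ (by positivity))
    rw [mul_left_comm]
    exact mul_le_mul_of_nonneg_left hAD hM0
  linarith

end Sample

/-! ### Limits in the sample size and conclusion -/

theorem tendsto_log_natCast_atTop : Tendsto (fun s : ℕ => Real.log s) atTop atTop :=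
  Real.tendsto_log_atTop.comp tendsto_natCast_atTop_atTop

/-- The lower bound for the covariance is eventually positive. -/
theorem eventually_half_le_of_rate {m : ℕ} {R : ℕ → ℝ} (hR0 : ∀ s, 0 ≤ R s)
    (hR : Tendsto (fun s => R s * Real.log s ^ (m + 1)) atTop (𝓝 0)) {V : ℝ} (hV : 0 < V)
    (B K M C : ℝ) :
    ∀ᶠ s : ℕ in atTop, V / 2 ≤ V * (1 - (B / Real.log s + 1 / s)) - K * R s -
      √(K ^ 2 * R s * (M * (C * (Real.log (Real.log s) * Real.log s ^ m)))) := by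
  have hL := tendsto_log_natCast_atTop
  have hL1 : ∀ᶠ s : ℕ in atTop, 1 ≤ Real.log s := hL.eventually_ge_atTop 1
  have h1 : Tendsto R atTop (𝓝 0) := by
    refine tendsto_of_tendsto_of_tendsto_of_le_of_le' tendsto_const_nhds hR
      (Eventually.of_forall hR0) ?_
    filter_upwards [hL1] with s hs
    exact le_mul_of_one_le_right (hR0 s) (one_le_pow₀ hs)
  -- This is the product under the square root; `log log s ≤ log s` reduces it to the rate with `m +
  -- 1` logarithms.
  have h2 : Tendsto (fun s : ℕ => R s * (Real.log (Real.log s) * Real.log s ^ m)) atTop (𝓝 0) := by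
    refine tendsto_of_tendsto_of_tendsto_of_le_of_le' tendsto_const_nhds hR ?_ ?_
    · filter_upwards [hL1] with s hs
      have := Real.log_nonneg hs
      have := hR0 s
      positivity
    · filter_upwards [hL1] with s hs
      have := Real.log_le_self (zero_le_one.trans hs)
      have := hR0 s
      rw [pow_succ']
      gcongr
  have h3 : Tendsto (fun s : ℕ => B / Real.log s + 1 / (s : ℝ)) atTop (𝓝 (0 + 0)) :=
    (tendsto_const_nhds.div_atTop hL).add tendsto_one_div_atTop_nhds_zero_nat
  have h4 : Tendsto (fun s : ℕ => V * (1 - (B / Real.log s + 1 / s)) - K * R s -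
      √(K ^ 2 * M * C * (R s * (Real.log (Real.log s) * Real.log s ^ m)))) atTop
      (𝓝 (V * (1 - (0 + 0)) - K * 0 - √(K ^ 2 * M * C * 0))) :=
    (((h3.const_sub 1).const_mul V).sub (h1.const_mul K)).sub
      (Real.continuous_sqrt.continuousAt.tendsto.comp (h2.const_mul _))
  have h5 : V / 2 < V * (1 - (0 + 0)) - K * 0 - √(K ^ 2 * M * C * 0) := by
    rw [mul_zero, mul_zero, Real.sqrt_zero]
    linarith
  filter_upwards [h4.eventually (lt_mem_nhds h5)] with s hs
  refine hs.le.trans_eq ?_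
  congr 2
  ring

/-- Because `log log s / log s` tends to zero, the lower bound obtained wins over any multiple of `1
/ (log s) ^ (m + 1)`. This margin absorbs all constants lost on the way. -/
theorem eventually_div_log_pow_le {m : ℕ} {c D : ℝ} (hc : 0 < c) (hD : 0 < D) (C : ℝ) :
    ∀ᶠ s : ℕ in atTop, C / Real.log s ^ (m + 1) ≤
      c / (D * (Real.log (Real.log s) * Real.log s ^ m)) := by
  have hL := tendsto_log_natCast_atTop
  have h := (Real.isLittleO_log_id_atTop.tendsto_div_nhds_zero.comp hL).const_mul (C * D)
  rw [mul_zero] at h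
  filter_upwards [h.eventually (gt_mem_nhds hc), hL.eventually_gt_atTop 1] with s hs hs1
  have hL0 : 0 < Real.log s := by linarith
  have hl0 : 0 < Real.log (Real.log s) := Real.log_pos hs1
  simp only [Function.comp_apply, id] at hs
  rw [← mul_div_assoc, div_lt_iff₀ hL0] at hs
  rw [div_le_div_iff₀ (by positivity) (by positivity)]
  calc _ = C * D * Real.log (Real.log s) * Real.log s ^ m := by ring
    _ ≤ c * Real.log s * Real.log s ^ m := by gcongr
    _ = _ := by ring

theorem AsympGE.of_eventually_le {g h : ℕ → ℝ} (hh : ∀ᶠ s in atTop, 0 < h s)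
    (hgh : ∀ᶠ s in atTop, h s ≤ g s) : AsympGE g h := by
  refine le_liminf_of_le (by isBoundedDefault) ?_
  filter_upwards [hh, hgh] with s h1 h2
  exact_mod_cast (one_le_div h1).2 h2

end Incremental

theorem theorem2 {d : ℕ} (hd : 0 < d) (f : (Fin d → ℝ) → ℝ) (hf : IsBoundedDensity f) :
    ∃ C : ℝ, 0 < C ∧
      ((∀ u ∈ unitCube d, f u = 1) → C = 2 ^ (d + 1) / ((d - 1).factorial : ℝ)) ∧
      ∀ (κ : Kernel (Fin d → ℝ) ℝ) [IsMarkovKernel κ], HasLipschitzMoments κ →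
      ∀ x ∈ unitCube d, 0 < variance id (κ x) →
      ∀ (Ω : ℕ → Type*) [∀ s, MeasurableSpace (Ω s)]
        (μ : ∀ s, Measure (Ω s)) [∀ s, IsProbabilityMeasure (μ s)]
        (X : ∀ s, Fin s → Ω s → (Fin d → ℝ)) (Y : ∀ s, Fin s → Ω s → ℝ)
        (τ : ∀ s, Ω s → SplitTree d) (P : ∀ s, Ω s → Finset (Fin s)),
        (∀ s, IsSample (μ s) f κ (X s) (Y s)) →
        (∃ π > 0, ∃ γ > 0, ∀ s, 1 ≤ s →
          IsRegularTree (μ s) (X s) (Y s) (τ s) (P s) π γ) →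
        (∀ s, 1 ≤ s → IsHonestAt (μ s) κ (X s) (Y s) (τ s) (P s) x) →
        IsIncremental μ (fun s i ω => (X s i ω, Y s i ω))
          (fun s => treePrediction (X s) (Y s) (τ s) (P s) x)
          (fun s => C / Real.log s ^ d) := by
  -- The value prescribed for the uniform density serves every `f`, as the lower bound holds with
  -- any constant.
  refine ⟨2 ^ (d + 1) / ((d - 1).factorial : ℝ), by positivity, fun _ => rfl, ?_⟩
  intro κ _ hκ x hx hV Ω _ μ _ X Y τ P hXY ⟨π, hπ, γ, hγ, hreg⟩ hhon
  obtain ⟨m, rfl⟩ := Nat.exists_eq_succ_of_ne_zero hd.ne'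
  obtain ⟨a, ha0, b, hab⟩ := hf.bounds
  obtain ⟨M, K, hM⟩ := hκ.exists_momentBounds
  have ha : ∀ u ∈ unitCube (m + 1), a ≤ f u := fun u hu => (hab u hu).1
  have hb : ∀ u ∈ unitCube (m + 1), f u ≤ b := fun u hu => (hab u hu).2
  have hab' : a ≤ b := (ha x hx).trans (hb x hx)
  have hb0 : 0 < b := ha0.trans_le hab'
  have hM0 : 0 < M := zero_lt_one.trans_le hM.one_le
  -- Regularity persists for smaller constants. The cap at `1 / 2` puts the contraction factor `1 -
  -- π' * (γ' * a / (2 * b))` strictly between `0` and `1` and makes `log γ'` negative.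
  set π' := min π (1 / 2)
  set γ' := min γ (1 / 2)
  have hπ' : 0 < π' := lt_min hπ one_half_pos
  have hγ' : 0 < γ' := lt_min hγ one_half_pos
  have hπ1 : π' ≤ 1 / 2 := min_le_right _ _
  have hγ1 : γ' ≤ 1 / 2 := min_le_right _ _
  have hreg' : ∀ s, 1 ≤ s → IsRegularTree (μ s) (X s) (Y s) (τ s) (P s) π' γ' := fun s hs =>
    (hreg s hs).mono (min_le_left _ _) (min_le_left _ _)
  have hq0 : 0 < γ' * a / (2 * b) := by positivity
  have hq1 : γ' * a / (2 * b) ≤ 1 := by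
    rw [div_le_one (by positivity)]
    nlinarith
  have hrate := tendsto_rate_mul_log_pow (D := (m + 1 : ℕ)) (ρ := 1 - π' * (γ' * a / (2 * b)))
    (γ := γ') (B := 16 * (8 * (m + 1 : ℕ) * b + 3) ^ (3 * (m + 1))) (Nat.cast_nonneg _)
    (by nlinarith) (by nlinarith) hγ' (by linarith) (by positivity) (3 * (m + 1) + 2) (m + 1)
    (by positivity) (R := fun s => selectedDist (μ s) (X s) (τ s) (P s) x)
    (fun s => selectedDist_nonneg) fun s n hs hn =>
      selectedDist_le hf ha0 hab' ha hb hs (hXY s) hπ'.le (by linarith) hγ' (by linarith)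
        (hreg' s hs) hx hn
  have hL := tendsto_log_natCast_atTop
  set C₁ := b * (2 * (4 * (m + 2) / a) * Real.exp 1 * 2 ^ m) with hC₁
  have hC₁0 : 0 < C₁ := by positivity
  refine AsympGE.of_eventually_le ?_ ?_
  · filter_upwards [hL.eventually_gt_atTop 0] with s hs
    positivity
  · filter_upwards [eventually_half_le_of_rate (fun s => selectedDist_nonneg) hrate hV
        (b * (2 * (8 / a) * Real.exp 1 * 2 ^ m)) K M C₁,
      eventually_div_log_pow_le (m := m) (c := (variance id (κ x) / 2) ^ 2) (D := M ^ 2 * C₁)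
        (by positivity) (by positivity) (2 ^ (m + 1 + 1) / ((m + 1 - 1).factorial : ℝ)),
      eventually_ge_atTop 4, hL.eventually_gt_atTop 1,
      ((hL.const_mul_atTop (by positivity : 0 < 8 / a)).const_mul_atTop
        two_pos).eventually_ge_atTop 1,
      (((Real.tendsto_log_atTop.comp hL).const_mul_atTop
        (by positivity : (0 : ℝ) < 4 * (m + 2) / a)).const_mul_atTop
          two_pos).eventually_ge_atTop 1] with s h1 h2 hs hs1 hs2 hs3
    refine h2.trans ?_
    rw [mul_assoc]
    exact le_variance_ratio hf ha0 hb0 ha hb (hXY s) hκ hM (hreg' s (by omega)) (hhon s (by omega))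
      hx hs hs1 hs2 hs3 (half_pos hV) hC₁ rfl h1
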